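/- Let $a>0$, $\mathbf v_1=a(\tfrac{\sqrt3}{2},\tfrac12)$, $\mathbf v_2=a(\tfrac{\sqrt3}{2},-\tfrac12)$, $\Lambda=\mathbb Z\mathbf v_1\oplus\mathbb Z\mathbf v_2$, $\Gamma=\mathbb R^2/\Lambda$, $\mathbf x_0=\tfrac23(\mathbf v_1+\mathbf v_2)$ and $Y=\{\mathbf y_1,\mathbf y_2\}=\{\mathbf 0,\mathbf x_0\}$. Let $\mathbf k_1,\mathbf k_2$ be the dual basis, $\mathbf k_i\cdot\mathbf v_j=2\pi\delta_{ij}$, let $\xi_{\mathbf m}=m_1\mathbf k_1+m_2\mathbf k_2$ for $\mathbf m\in\mathbb Z^2$, let $\mathcal B$ be the (hexagonal) Brillouin zone, and let $\mathbf K=\tfrac23\mathbf k_1+\tfrac13\mathbf k_2$ (a vertex of $\mathcal B$, a Dirac point). For $\alpha\in\mathbb R$ and $\mathbf k\in\mathbb R^2$ let $-\Delta_{\alpha,Y}(\mathbf k)$ be the self-adjoint operator of the honeycomb point scatterer with equal strengths $\alpha$ at $\mathbf 0$ and $\mathbf x_0$ in the space $L^2_{\mathbf k}(\Gamma)$ of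 $\mathbf k$-quasi-periodic functions. Its resolvent is, in terms of the Fourier coefficients $f_{\mathbf m}$ of $f=\sum_{\mathbf m} f_{\mathbf m}e^{i(\xi_{\mathbf m}+\mathbf k)\cdot\mathbf x}$, $$\big((-\Delta_{\alpha,Y}(\mathbf k)-z)^{-1}f\big)_{\mathbf m}=\frac{f_{\mathbf m}}{|\xi_{\mathbf m}+\mathbf k|^2-z}+\frac1{\mathrm{area}(\Gamma)}\sum_{j,j'=1}^2[\Gamma_{\alpha}(z,\mathbf k)^{-1}]_{jj'}\Big(\sum_{\mathbf n}\frac{e^{i(\xi_{\mathbf n}+\mathbf k)\cdot\mathbf y_j}f_{\mathbf n}}{|\xi_{\mathbf n}+\mathbf k|^2-z}\Big)\frac{e^{-i(\xi_{\mathbf m}+\mathbf k)\cdot\mathbf y_{j'}}}{|\xi_{\mathbf m}+\mathbf k|^2-z},\qquad z\in\mathbb C\setminus\mathbb R,$$ where $[\Gamma_\alpha(z,\mathbf k)]_{jj'}=\alpha\delta_{jj'}-g_z(\mathbf y_{j'}-\mathbf y_j,\mathbf k)$ and $$g_z(\mathbf x,\mathbf k)=\frac1{\mathrm{area}(\Gamma)}\lim_{r\to\infty}\sum_{|\xi_{\mathbf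 m}+\mathbf k|\le r}\frac{e^{i(\xi_{\mathbf m}+\mathbf k)\cdot\mathbf x}}{|\xi_{\mathbf m}+\mathbf k|^2-z}\quad(\mathbf x\notin\Lambda),$$ $$g_z(\mathbf x,\mathbf k)=\frac1{\mathrm{area}(\Gamma)}\lim_{r\to\infty}\Big[\sum_{|\xi_{\mathbf m}+\mathbf k|\le r}\frac1{|\xi_{\mathbf m}+\mathbf k|^2-z}-\frac{2\pi}{\mathrm{area}(\mathcal B)}\ln r\Big]\quad(\mathbf x\in\Lambda).$$ Then for every $\alpha\in\mathbb R$ and every $\mathbf k$ the eigenvalues of $-\Delta_{\alpha,Y}(\mathbf k)$, repeated according to their finite multiplicities, form a sequence $\lambda_1(\mathbf k,\alpha)\le\lambda_2(\mathbf k,\alpha)\le\cdots$, and $$\lambda_1(\mathbf K,\alpha)=\lambda_2(\mathbf K,\alpha),\qquad \lambda_4(\mathbf K,\alpha)=\lambda_5(\mathbf K,\alpha),$$ where neither of these two values belongs to $\sigma(-\Delta(\mathbf K))=\{|\xi_{\mathbf m}+\mathbf K|^2:\mathbf m\in\mathbb Z^2\}$. Moreover, as $\mathbf k\to\mathbf K$,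 $$\begin{aligned} \lambda_1(\mathbf k,\alpha)-\lambda_1(\mathbf K,\alpha)&=-c(\lambda_1(\mathbf K,\alpha))\,|\mathbf k-\mathbf K|+o(|\mathbf k-\mathbf K|),\\ \lambda_2(\mathbf k,\alpha)-\lambda_2(\mathbf K,\alpha)&=c(\lambda_1(\mathbf K,\alpha))\,|\mathbf k-\mathbf K|+o(|\mathbf k-\mathbf K|),\\ \lambda_4(\mathbf k,\alpha)-\lambda_4(\mathbf K,\alpha)&=-c(\lambda_4(\mathbf K,\alpha))\,|\mathbf k-\mathbf K|+o(|\mathbf k-\mathbf K|),\\ \lambda_5(\mathbf k,\alpha)-\lambda_5(\mathbf K,\alpha)&=c(\lambda_4(\mathbf K,\alpha))\,|\mathbf k-\mathbf K|+o(|\mathbf k-\mathbf K|), \end{aligned}$$ with the direction-independent slope $$c(\mu)=\frac{4\pi}{a}\,\frac{\Big|\sum_{\mathbf m\in\mathbb Z^2}\frac{m_1e^{i\xi_{\mathbf m}\cdot\mathbf x_0}}{(|\xi_{\mathbf m}+\mathbf K|^2-\mu)^2}\Big|}{\sum_{\mathbf m\in\mathbb Z^2}\frac1{(|\xi_{\mathbf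 m}+\mathbf K|^2-\mu)^2}}.$$ -/

import Mathlib

open MeasureTheory Filter Topology Asymptotics

namespace Honeycomb

noncomputable section

/-- The Euclidean plane `ℝ²`. -/
abbrev Plane : Type := EuclideanSpace ℝ (Fin 2)

/-- First generator of the triangular lattice `Λ` with lattice constant `a`. -/
def v₁ (a : ℝ) : Plane := !₂[a * (√3 / 2), a * (1 / 2)]

/-- Second generator of the triangular lattice `Λ`. -/
def v₂ (a : ℝ) : Plane := !₂[a * (√3 / 2), a * (-(1 / 2))]

/-- The triangular lattice `Λ = ℤ v₁ ⊕ ℤ v₂`. -/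
def lattice (a : ℝ) : Set Plane :=
  Set.range fun m : ℤ × ℤ => (m.1 : ℝ) • v₁ a + (m.2 : ℝ) • v₂ a

/-- The position `x₀ = (2/3)(v₁ + v₂)` of the second scatterer of the honeycomb cell. -/
def x₀ (a : ℝ) : Plane := (2 / 3 : ℝ) • (v₁ a + v₂ a)

/-- The two scatterers `y₁ = 0`, `y₂ = x₀` in the fundamental domain. -/
def scatterer (a : ℝ) : Fin 2 → Plane := ![0, x₀ a]

/-- First generator of the dual lattice. -/
def k₁ (a : ℝ) : Plane :=
  !₂[4 * Real.pi / (a * √3) * (1 / 2), 4 * Real.pi / (a * √3) * (√3 / 2)]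

/-- Second generator of the dual lattice. -/
def k₂ (a : ℝ) : Plane :=
  !₂[4 * Real.pi / (a * √3) * (1 / 2), 4 * Real.pi / (a * √3) * (-(√3 / 2))]

/-- The dual lattice vector `ξ_m = m₁ k₁ + m₂ k₂`. -/
def ξ (a : ℝ) (m : ℤ × ℤ) : Plane := (m.1 : ℝ) • k₁ a + (m.2 : ℝ) • k₂ a

/-- The Dirac point `K = (2/3) k₁ + (1/3) k₂`. -/
def diracPoint (a : ℝ) : Plane := (2 / 3 : ℝ) • k₁ a + (1 / 3 : ℝ) • k₂ a

/-- The fundamental cell `Γ` of `Λ`: the parallelogram spanned by `v₁`, `v₂`. -/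
def cell (a : ℝ) : Set Plane := parallelepiped ![v₁ a, v₂ a]

/-- `area(Γ)`. -/
def areaCell (a : ℝ) : ℝ := volume.real (cell a)

/-- `area(ℬ)`, the area of a fundamental domain of the dual lattice; the hexagonal Brillouin zone
and the parallelogram spanned by `k₁`, `k₂` are both such domains. -/
def areaDual (a : ℝ) : ℝ := volume.real (parallelepiped ![k₁ a, k₂ a])

theorem isCompact_cell (a : ℝ) : IsCompact (cell a) := by
  unfold cell parallelepiped
  exact isCompact_Icc.image (by fun_prop)

instance isFiniteMeasure_cell (a : ℝ) : IsFiniteMeasure (volume.restrict (cell a)) :=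
  isFiniteMeasure_restrict.2 (isCompact_cell a).measure_lt_top.ne

/-- The Hilbert space `L²_𝐤(Γ)`. A function with `f (x + v) = e^{i k·v} f x` for `v ∈ Λ` is
determined by its restriction to the cell, and every square-integrable function on the cell
extends in this way; so the underlying Hilbert space is `L²` of the cell for each `k`, and `k`
enters through the plane waves below. -/
abbrev L2Cell (a : ℝ) : Type := Lp ℂ 2 (volume.restrict (cell a))

/-- The phase `e^{i (ξ_m + k)·x}`. -/
def phase (a : ℝ) (k : Plane) (m : ℤ × ℤ) (x : Plane) : ℂ :=
  Complex.exp (Complex.I * ((inner ℝ (ξ a m + k) x : ℝ) : ℂ))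

theorem memLp_phase (a : ℝ) (k : Plane) (m : ℤ × ℤ) :
    MemLp (phase a k m) 2 (volume.restrict (cell a)) := by
  refine MemLp.of_bound (C := 1) ?_ (Eventually.of_forall fun x => ?_)
  · exact Continuous.aestronglyMeasurable (by unfold phase; fun_prop)
  · rw [phase, mul_comm, Complex.norm_exp_ofReal_mul_I]

/-- The quasi-periodic plane wave `x ↦ e^{i (ξ_m + k)·x}` as an element of `L²_𝐤(Γ)`. -/
def planeWave (a : ℝ) (k : Plane) (m : ℤ × ℤ) : L2Cell a := (memLp_phase a k m).toLp

/-- The Fourier coefficient `f_m = area(Γ)⁻¹ ∫_Γ f(x) e^{-i (ξ_m + k)·x} dx`, so that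
`f(x) = ∑ f_m e^{i (ξ_m + k)·x}`. -/
def coeff (a : ℝ) (k : Plane) (m : ℤ × ℤ) (f : L2Cell a) : ℂ :=
  (areaCell a : ℂ)⁻¹ * inner ℂ (planeWave a k m) f

open Classical in
/-- The (renormalized) Green function `g_z(x, k)` of the fiber Laplacian. Lattice sums, which do
not converge absolutely, are limits of sums over the discs `|ξ_m + k| ≤ r`. -/
def green (a : ℝ) (z : ℂ) (x k : Plane) : ℂ :=
  if x ∈ lattice a then
    (areaCell a : ℂ)⁻¹ * limUnder atTop fun r : ℝ =>
      (∑ᶠ m ∈ {m : ℤ × ℤ | ‖ξ a m + k‖ ≤ r}, 1 / (((‖ξ a m + k‖ ^ 2 : ℝ) : ℂ) - z))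
        - ((2 * Real.pi / areaDual a * Real.log r : ℝ) : ℂ)
  else
    (areaCell a : ℂ)⁻¹ * limUnder atTop fun r : ℝ =>
      ∑ᶠ m ∈ {m : ℤ × ℤ | ‖ξ a m + k‖ ≤ r}, phase a k m x / (((‖ξ a m + k‖ ^ 2 : ℝ) : ℂ) - z)

/-- The matrix `Γ_{α,Y}(z, k)`, with equal strengths `α` at both scatterers. -/
def gammaMatrix (a α : ℝ) (z : ℂ) (k : Plane) : Matrix (Fin 2) (Fin 2) ℂ :=
  Matrix.of fun j j' =>
    (if j = j' then (α : ℂ) else 0) - green a z (scatterer a j' - scatterer a j) k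

/-- The relation `u = (-Δ_{α,Y}(k) - z)⁻¹ f`, given by Krein's resolvent formula in Fourier
coefficients. Here `-Δ(k)` is multiplication by `|ξ_m + k|²`, `w j = ((-Δ(k) - z)⁻¹ f)(y_j)`
is the pairing of `f` with the Green function at `y_j`, and the last factor together with
`area(Γ)⁻¹` is the Fourier coefficient of the Green function with pole at `y_{j'}`. -/
def IsResolvent (a α : ℝ) (k : Plane) (z : ℂ) (f u : L2Cell a) : Prop :=
  ∃ w : Fin 2 → ℂ,
    (∀ j, HasSum (fun n : ℤ × ℤ => phase a k n (scatterer a j) /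
      (((‖ξ a n + k‖ ^ 2 : ℝ) : ℂ) - z) * coeff a k n f) (w j)) ∧
    ∀ m : ℤ × ℤ, coeff a k m u =
      coeff a k m f / (((‖ξ a m + k‖ ^ 2 : ℝ) : ℂ) - z) +
      (areaCell a : ℂ)⁻¹ * ∑ j, ∑ j', (gammaMatrix a α z k)⁻¹ j j' * w j *
        (phase a k m (-scatterer a j') / (((‖ξ a m + k‖ ^ 2 : ℝ) : ℂ) - z))

theorem IsResolvent.add {a α : ℝ} {k : Plane} {z : ℂ} {f u f' u' : L2Cell a}
    (h : IsResolvent a α k z f u) (h' : IsResolvent a α k z f' u') :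
    IsResolvent a α k z (f + f') (u + u') := by
  obtain ⟨w, hw, hu⟩ := h
  obtain ⟨w', hw', hu'⟩ := h'
  have hc : ∀ n (p q : L2Cell a), coeff a k n (p + q) = coeff a k n p + coeff a k n q := by
    intro n p q
    simp only [coeff, inner_add_right, mul_add]
  refine ⟨w + w', fun j => ?_, fun m => ?_⟩
  · simpa only [hc, mul_add, Pi.add_apply] using (hw j).add (hw' j)
  · rw [hc, hc, hu, hu']
    simp only [Pi.add_apply, Fin.sum_univ_two]
    ring

theorem IsResolvent.smul {a α : ℝ} {k : Plane} {z : ℂ} {f u : L2Cell a} (c : ℂ)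
    (h : IsResolvent a α k z f u) : IsResolvent a α k z (c • f) (c • u) := by
  obtain ⟨w, hw, hu⟩ := h
  have hc : ∀ n (p : L2Cell a), coeff a k n (c • p) = c * coeff a k n p := by
    intro n p
    simp only [coeff, inner_smul_right]
    ring
  refine ⟨c • w, fun j => ?_, fun m => ?_⟩
  · simpa only [hc, mul_left_comm, Pi.smul_apply, smul_eq_mul] using (hw j).mul_left c
  · rw [hc, hc, hu]
    simp only [Pi.smul_apply, smul_eq_mul, Fin.sum_univ_two]
    ring

/-- The graph of the self-adjoint fiber operator `-Δ_{α,Y}(k)` in `L²_𝐤(Γ)`, `Y = {0, x₀}`: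
the pairs `(u, h)`, `h = -Δ_{α,Y}(k) u`, i.e. those with
`u = (-Δ_{α,Y}(k) - z)⁻¹ (h - z u)` for every non-real `z`. -/
def fiberGraph (a α : ℝ) (k : Plane) : Submodule ℂ (L2Cell a × L2Cell a) where
  carrier := {p | ∀ z : ℂ, z.im ≠ 0 → IsResolvent a α k z (p.2 - z • p.1) p.1}
  zero_mem' := fun z _ => ⟨0, fun j => by simp [coeff, hasSum_zero], fun m => by simp [coeff]⟩
  add_mem' := fun {p q} hp hq z hz => by
    have h := (hp z hz).add (hq z hz)
    have e : (p + q).2 - z • (p + q).1 = (p.2 - z • p.1) + (q.2 - z • q.1) := by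
      simp only [Prod.fst_add, Prod.snd_add, smul_add]; abel
    rw [e]; exact h
  smul_mem' := fun c p hp z hz => by
    have h := (hp z hz).smul c
    have e : (c • p).2 - z • (c • p).1 = c • (p.2 - z • p.1) := by
      simp only [Prod.smul_fst, Prod.smul_snd, smul_sub, smul_comm z c]
    rw [e]; exact h

/-- The eigenspace `{u ∈ D(-Δ_{α,Y}(k)) : -Δ_{α,Y}(k) u = μ u}`. -/
def eigenspace (a α : ℝ) (k : Plane) (μ : ℝ) : Submodule ℂ (L2Cell a) :=
  (fiberGraph a α k).comap (LinearMap.id.prod ((μ : ℂ) • LinearMap.id))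

/-- `lam 1 ≤ lam 2 ≤ ⋯` are the eigenvalues of `-Δ_{α,Y}(k)`, all of them, each repeated according
to its (finite) multiplicity. -/
def IsEigenvalueSeq (a α : ℝ) (k : Plane) (lam : ℕ+ → ℝ) : Prop :=
  Monotone lam ∧ ∀ μ : ℝ, Module.Finite ℂ (eigenspace a α k μ) ∧
    {j : ℕ+ | lam j = μ}.encard = (Module.finrank ℂ (eigenspace a α k μ) : ℕ∞)

/-- The slope
`c(μ) = (4π/a) |∑ m₁ e^{i ξ_m·x₀} / (|ξ_m + K|² - μ)²| / ∑ (|ξ_m + K|² - μ)⁻²`. -/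
def slope (a μ : ℝ) : ℝ :=
  4 * Real.pi / a *
    (‖∑' m : ℤ × ℤ, (m.1 : ℂ) * phase a 0 m (x₀ a) /
        (((‖ξ a m + diracPoint a‖ ^ 2 - μ) ^ 2 : ℝ) : ℂ)‖ /
      ∑' m : ℤ × ℤ, 1 / (‖ξ a m + diracPoint a‖ ^ 2 - μ) ^ 2)

end

end Honeycomb

/-! Fourier coefficients identify `L²_k(Γ)` with `ℓ²(ℤ²)`. In them Krein's formula says that `u` is
an eigenvector at `μ` iff `(|ξ_m + k|² - μ) u_m = Q₀ + Q₁ e^{-iξ_m·x₀}` for some amplitudes `Q₀,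
Q₁`, together with two boundary conditions relating renormalized sums of `u` to `Q₀, Q₁`
(`mem_eigenspace_iff`). Off the free spectrum `Q` determines `u`, so the eigenspace is the kernel of
the matrix `[[β - D, -Ḡ], [-G, β - D]]` (`eigenspace_eq_comap`). Here `β = α·area(Γ) - γ`, `D(k, μ)
= ∑ ((|ξ_m + k|² - μ)⁻¹ - w_m⁻¹)`, and `G` is the same sum with the phases `e^{iξ_m·x₀}` inserted.
The reference weight `w_m = |ξ_m + K|² + 1` makes both sums absolutely convergent.

For `s` large the resolvent at `-s` is a positive compact operator. Its approximation numbers list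
its eigenvalues with multiplicity and are 1-Lipschitz in the operator norm. Their reciprocals,
shifted by `s`, therefore form the eigenvalue sequence and are continuous at `K`
(`exists_eigenvalueSeq`).

Rotation by `2π/3` about `K` preserves `|ξ_m + K|` and multiplies `e^{iξ_m·x₀}` by a primitive cube
root of unity. Hence `G(K, ·) = 0`, and off the free spectrum the eigenvalues at `K` are the roots
of `D(K, μ) = β`, all of them double. On each of the gaps `(-∞, κ)` and `(κ, 4κ)`, with `κ = |K|²`,
the function `D(K, ·)` increases from `-∞` to `+∞` and has exactly one such root. At `κ` itself the
threefold free eigenspace is cut down to dimension one. The multiplicities 2, 1, 2 give the two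
coincidences (`dirac_levels`).

Near `K` the levels solve `|β - D| = |G|`. With `δ = |k - K|`, the same rotation gives `D(k, ν) = β
+ O(δ²)`, `|G(k, ν)| = ℓδ + O(δ²)` with `ℓ` independent of direction, `∂_μ G = 0` and `∂_μ D = S >
0` at the root `ν`. So both levels lie at distance `(ℓ/S)δ + o(δ)` from `ν`. They lie on opposite
sides: on the same side `|β - D|` would separate them at rate `S` but `|G|` only at rate `o(1)`,
which forces them to coincide. A coincidence makes the matrix vanish, so `D = β`, and this fails
away from `ν` (`conical_branches`, `dirac_cone`). -/

namespace Honeycomb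

noncomputable section

/-! ### Approximation numbers of compact positive operators -/

section ApproximationNumbers

variable {E : Type*} [NormedAddCommGroup E] [InnerProductSpace ℂ E]

/-- The operators of rank at most `n`. -/
def finiteRank (E : Type*) [NormedAddCommGroup E] [InnerProductSpace ℂ E] (n : ℕ) :
    Set (E →L[ℂ] E) :=
  {F | FiniteDimensional ℂ (LinearMap.range (F : E →ₗ[ℂ] E)) ∧
    Module.finrank ℂ (LinearMap.range (F : E →ₗ[ℂ] E)) ≤ n}

/-- The `n`-th approximation number of a bounded operator (starting from `n = 0`). -/
def approxNumber (T : E →L[ℂ] E) (n : ℕ) : ℝ := sInf ((fun F => ‖T - F‖) '' finiteRank E n)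

theorem zero_mem_finiteRank (n : ℕ) : (0 : E →L[ℂ] E) ∈ finiteRank E n := by
  have h : LinearMap.range ((0 : E →L[ℂ] E) : E →ₗ[ℂ] E) = ⊥ := by simp
  constructor
  · rw [h]; infer_instance
  · rw [h]; simp

theorem bddBelow_approx (T : E →L[ℂ] E) (n : ℕ) :
    BddBelow ((fun F => ‖T - F‖) '' finiteRank E n) :=
  ⟨0, by rintro _ ⟨F, -, rfl⟩; exact norm_nonneg _⟩

theorem approxNumber_antitone (T : E →L[ℂ] E) : Antitone (approxNumber T) := fun m n h =>
  csInf_le_csInf (bddBelow_approx T n) ⟨_, 0, zero_mem_finiteRank m, rfl⟩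
    (Set.image_mono fun _ hF => ⟨hF.1, hF.2.trans h⟩)

theorem approxNumber_le_add (T S : E →L[ℂ] E) (n : ℕ) :
    approxNumber T n ≤ approxNumber S n + ‖T - S‖ := by
  rw [← sub_le_iff_le_add]
  refine le_csInf ⟨_, 0, zero_mem_finiteRank n, rfl⟩ ?_
  rintro _ ⟨F, hF, rfl⟩
  have h1 : approxNumber T n ≤ ‖T - F‖ := csInf_le (bddBelow_approx T n) ⟨F, hF, rfl⟩
  have h2 : ‖T - F‖ ≤ ‖T - S‖ + ‖S - F‖ := by
    simpa using norm_add_le (T - S) (S - F)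
  simp only
  linarith

/-- This transfers norm convergence of the resolvents to each single eigenvalue, without a min-max
principle. -/
theorem continuous_approxNumber (n : ℕ) :
    Continuous fun T : E →L[ℂ] E => approxNumber T n := by
  refine LipschitzWith.continuous (K := 1) (LipschitzWith.of_dist_le_mul fun T S => ?_)
  rw [NNReal.coe_one, one_mul, Real.dist_eq, abs_le, dist_eq_norm]
  have h1 := approxNumber_le_add T S n
  have h2 := approxNumber_le_add S T n
  rw [norm_sub_rev] at h2
  constructor <;> linarith

open Module.End in
/-- A positive definite compact operator has a Hilbert basis of eigenvectors, indexed by its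
eigenvalues and their multiplicities. -/
theorem exists_hilbertBasis_eigenvector [CompleteSpace E] {T : E →L[ℂ] E} (hc : IsCompactOperator T)
    (hs : (T : E →ₗ[ℂ] E).IsSymmetric) (hpos : ∀ u, u ≠ 0 → 0 < (inner ℂ u (T u)).re) :
    ∃ b : HilbertBasis (Σ μ : {μ : ℝ // 0 < μ},
        Fin (Module.finrank ℂ (Module.End.eigenspace (T : E →ₗ[ℂ] E) ((μ : ℝ) : ℂ)))) ℂ E,
      ∀ i, T (b i) = ((i.1 : ℝ) : ℂ) • b i := by
  have hfin : ∀ μ : {μ : ℝ // 0 < μ},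
      FiniteDimensional ℂ (Module.End.eigenspace (T : E →ₗ[ℂ] E) ((μ : ℝ) : ℂ)) := fun μ =>
    ContinuousLinearMap.finite_dimensional_eigenspace hc _ (by exact_mod_cast μ.2.ne')
  have hO : OrthogonalFamily ℂ
      (fun μ : {μ : ℝ // 0 < μ} => Module.End.eigenspace (T : E →ₗ[ℂ] E) ((μ : ℝ) : ℂ))
      (fun μ => (Module.End.eigenspace (T : E →ₗ[ℂ] E) ((μ : ℝ) : ℂ)).subtypeₗᵢ) :=
    hs.orthogonalFamily_eigenspaces.comp (γ := {μ : ℝ // 0 < μ}) (f := fun μ => ((μ : ℝ) : ℂ))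
      (fun x y h => Subtype.ext (Complex.ofReal_injective h))
  have hon := hO.orthonormal_sigma_orthonormal
    (v_family := fun μ => (stdOrthonormalBasis ℂ (Module.End.eigenspace (T : E →ₗ[ℂ] E) ((μ : ℝ) : ℂ))))
    (fun μ => (stdOrthonormalBasis ℂ _).orthonormal)
  have hsp : (Submodule.span ℂ (Set.range fun a : Σ μ : {μ : ℝ // 0 < μ},
      Fin (Module.finrank ℂ (Module.End.eigenspace (T : E →ₗ[ℂ] E) ((μ : ℝ) : ℂ))) =>
      (Module.End.eigenspace (T : E →ₗ[ℂ] E) ((a.1 : ℝ) : ℂ)).subtypeₗᵢ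
        (stdOrthonormalBasis ℂ (Module.End.eigenspace (T : E →ₗ[ℂ] E) ((a.1 : ℝ) : ℂ)) a.2)))ᗮ = ⊥ := by
    -- By the spectral theorem the eigenspaces span a dense subspace. Symmetry makes the eigenvalues
    -- real and positivity makes them positive, so those indexed here suffice.
    rw [eq_bot_iff, ← ContinuousLinearMap.orthogonalComplement_iSup_eigenspaces_eq_bot hc hs]
    refine Submodule.orthogonal_le (iSup_le fun μ => ?_)
    by_cases hμ : ∃ v ∈ Module.End.eigenspace (T : E →ₗ[ℂ] E) μ, v ≠ 0
    · obtain ⟨v, hv, hv0⟩ := hμ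
      have hev : HasEigenvalue (T : E →ₗ[ℂ] E) μ :=
        hasEigenvalue_of_hasEigenvector ⟨hv, hv0⟩
      have hreal : ((μ.re : ℝ) : ℂ) = μ :=
        Complex.conj_eq_iff_re.1 (hs.conj_eigenvalue_eq_self hev)
      have hp : 0 < μ.re := by
        have h := hpos v hv0
        have hTv : T v = μ • v := mem_eigenspace_iff.1 hv
        rw [hTv, ← hreal, inner_smul_right, inner_self_eq_norm_sq_to_K, Complex.re_ofReal_mul] at h
        norm_cast at h
        have hn : 0 < ‖v‖ ^ 2 := by positivity
        exact pos_of_mul_pos_left h hn.le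
      rw [← hreal]
      intro x hx
      have := hfin ⟨μ.re, hp⟩
      have hx' := (stdOrthonormalBasis ℂ (Module.End.eigenspace (T : E →ₗ[ℂ] E) ((μ.re : ℝ) : ℂ))).sum_repr
        ⟨x, hx⟩
      have hx2 := congrArg Subtype.val hx'
      refine (congrArg (· ∈ Submodule.span ℂ _) hx2).mp ?_
      simp only [Submodule.coe_sum, Submodule.coe_smul]
      exact Submodule.sum_mem _ fun i _ => Submodule.smul_mem _ _
        (Submodule.subset_span ⟨⟨⟨μ.re, hp⟩, i⟩, rfl⟩)
    · push Not at hμ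
      intro v hv
      rw [hμ v hv]
      exact Submodule.zero_mem _
  refine ⟨HilbertBasis.mkOfOrthogonalEqBot hon hsp, fun i => ?_⟩
  rw [HilbertBasis.coe_mkOfOrthogonalEqBot]
  exact mem_eigenspace_iff.1 (Subtype.prop (stdOrthonormalBasis ℂ
    (Module.End.eigenspace (T : E →ₗ[ℂ] E) ((i.1 : ℝ) : ℂ)) i.2))

/-- A compact operator with an orthonormal family of eigenvectors has only finitely many of the
eigenvalues above a positive threshold. -/
theorem finite_setOf_lt_eigenvalue {I : Type*} {T : E →L[ℂ] E} (hc : IsCompactOperator T)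
    {b : I → E} (hb : Orthonormal ℂ b) {ν : I → ℝ} (hT : ∀ i, T (b i) = (ν i : ℂ) • b i)
    {t : ℝ} (ht : 0 < t) : {i | t < ν i}.Finite := by
  by_contra hinf
  have hK := (isCompactOperator_iff_isCompact_closure_image_closedBall
    (T : E →ₗ[ℂ] E) zero_lt_one).1 hc
  -- The images of these eigenvectors are `t`-separated, so infinitely many of them cannot sit in a
  -- compact set.
  have hdist : ∀ i j, t < ν i → i ≠ j → t < dist (T (b i)) (T (b j)) := by
    intro i j hi hij
    have h1 : inner ℂ (b i) (T (b i) - T (b j)) = (ν i : ℂ) := by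
      rw [inner_sub_right, hT, hT, inner_smul_right, inner_smul_right,
        inner_self_eq_norm_sq_to_K, hb.1 i, hb.2 hij]
      simp
    have h2 := norm_inner_le_norm (𝕜 := ℂ) (b i) (T (b i) - T (b j))
    rw [h1, hb.1 i, one_mul, Complex.norm_real] at h2
    rw [dist_eq_norm]
    exact hi.trans_le ((le_abs_self _).trans h2)
  have hinj : Set.InjOn (fun i => T (b i)) {i | t < ν i} := by
    intro i hi j _ h
    by_contra hne
    have := hdist i j hi hne
    simp only at h
    rw [h, dist_self] at this
    linarith
  have himg : ((fun i => T (b i)) '' {i | t < ν i}).Infinite := Set.Infinite.image hinj hinf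
  obtain ⟨x, -, hx⟩ := himg.exists_accPt_of_subset_isCompact hK (by
    rintro _ ⟨i, -, rfl⟩
    exact subset_closure ⟨b i, by simp [hb.1 i], rfl⟩)
  rw [accPt_iff_nhds] at hx
  obtain ⟨y, ⟨hy, i, hi, rfl⟩, hyx⟩ := hx (Metric.ball x (t / 2)) (Metric.ball_mem_nhds _ (by linarith))
  -- The second radius in the minimum forces the new point to be closer to `x` than the first, hence
  -- different from it.
  obtain ⟨y', ⟨hy', j, hj, rfl⟩, hyx'⟩ := hx (Metric.ball x (min (t / 2) (dist (T (b i)) x)))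
    (Metric.ball_mem_nhds _ (lt_min (by linarith) (dist_pos.2 hyx)))
  have hij : i ≠ j := by
    rintro rfl
    exact lt_irrefl _ ((Metric.mem_ball.1 hy').trans_le (min_le_right _ _))
  have h1 := hdist i j hi hij
  have h2 := Metric.mem_ball.1 hy
  have h3 := (Metric.mem_ball.1 hy').trans_le (min_le_left _ _)
  have h4 := dist_triangle_right (T (b i)) (T (b j)) x
  simp only at h1 h2 h3 h4
  linarith

/-- Truncation of `T` to the eigenvectors in `J` has rank at most `J.card` and leaves a diagonal
remainder with entries at most `t`. -/
theorem approxNumber_le_of_forall {I : Type*} {T : E →L[ℂ] E} (b : HilbertBasis I ℂ E) {ν : I → ℝ}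
    (hν : ∀ i, 0 < ν i)
    (hT : ∀ i, T (b i) = (ν i : ℂ) • b i) {t : ℝ} (J : Finset I) (hJ : ∀ i ∉ J, ν i ≤ t)
    (ht : 0 ≤ t) (hs : (T : E →ₗ[ℂ] E).IsSymmetric) : approxNumber T J.card ≤ t := by
  classical
  let F : E →L[ℂ] E := ∑ i ∈ J, (innerSL ℂ (b i)).smulRight ((ν i : ℂ) • b i)
  have hFu : ∀ u, F u = ∑ i ∈ J, (inner ℂ (b i) u) • ((ν i : ℂ) • b i) := fun u => by
    simp [F]
  have hFr : LinearMap.range (F : E →ₗ[ℂ] E) ≤ Submodule.span ℂ (J.image b : Set E) := by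
    rintro _ ⟨u, rfl⟩
    rw [ContinuousLinearMap.coe_coe, hFu]
    refine Submodule.sum_mem _ fun i hi => Submodule.smul_mem _ _ (Submodule.smul_mem _ _
      (Submodule.subset_span ?_))
    simpa using ⟨i, hi, rfl⟩
  have hF : F ∈ finiteRank E J.card := by
    refine ⟨Submodule.finiteDimensional_of_le hFr, (Submodule.finrank_mono hFr).trans ?_⟩
    exact (finrank_span_finset_le_card _).trans Finset.card_image_le
  refine (csInf_le (bddBelow_approx T _) ⟨F, hF, rfl⟩).trans ?_
  refine ContinuousLinearMap.opNorm_le_bound _ ht fun u => ?_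
  have hco : ∀ i, b.repr ((T - F) u) i = (if i ∈ J then 0 else (ν i : ℂ)) * b.repr u i := by
    intro i
    rw [b.repr_apply_apply, b.repr_apply_apply, _root_.sub_apply, inner_sub_right]
    have h1 : inner ℂ (b i) (T u) = (ν i : ℂ) * inner ℂ (b i) u := by
      have := hs (b i) u
      simp only [ContinuousLinearMap.coe_coe] at this
      rw [← this, hT, inner_smul_left, Complex.conj_ofReal]
    have h2 : inner ℂ (b i) (F u) = if i ∈ J then (ν i : ℂ) * inner ℂ (b i) u else 0 := by
      rw [hFu, inner_sum]
      simp only [inner_smul_right, orthonormal_iff_ite.1 b.orthonormal]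
      simp [mul_comm]
    rw [h1, h2]
    split_ifs <;> simp
  have hn : ‖b.repr ((T - F) u)‖ ≤ ‖((t : ℝ) : ℂ) • b.repr u‖ := by
    have hsq : ‖b.repr ((T - F) u)‖ ^ (2 : ℝ) ≤ ‖((t : ℝ) : ℂ) • b.repr u‖ ^ (2 : ℝ) := by
      have h2 : (0 : ℝ) < (2 : ENNReal).toReal := by norm_num
      have e1 := lp.hasSum_norm h2 (b.repr ((T - F) u))
      have e2 := lp.hasSum_norm h2 (((t : ℝ) : ℂ) • b.repr u)
      simp only [ENNReal.toReal_ofNat] at e1 e2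
      refine hasSum_le (fun i => ?_) e1 e2
      refine Real.rpow_le_rpow (norm_nonneg _) ?_ (by norm_num)
      rw [hco, lp.coeFn_smul, Pi.smul_apply, smul_eq_mul, norm_mul, norm_mul]
      refine mul_le_mul_of_nonneg_right ?_ (norm_nonneg _)
      split_ifs with h
      · simp
      · rw [Complex.norm_real, Complex.norm_real, Real.norm_of_nonneg (hν i).le,
          Real.norm_of_nonneg ht]
        exact hJ i h
    exact (Real.rpow_le_rpow_iff (norm_nonneg _) (norm_nonneg _) (by norm_num)).1 hsq
  rw [norm_smul, Complex.norm_real, Real.norm_of_nonneg ht, LinearIsometryEquiv.norm_map,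
    LinearIsometryEquiv.norm_map] at hn
  exact hn

/-- Dimension count: an operator of rank at most `n` kills a nonzero vector in the span of more than
`n` eigenvectors, and `T` stretches every vector of that span by at least `t`. -/
theorem le_approxNumber_of_forall {I : Type*} {T : E →L[ℂ] E} {b : I → E} (hb : Orthonormal ℂ b)
    {ν : I → ℝ} (hT : ∀ i, T (b i) = (ν i : ℂ) • b i) {t : ℝ} (ht : 0 ≤ t) (J : Finset I)
    (hJ : ∀ i ∈ J, t ≤ ν i) {n : ℕ} (hn : n < J.card) : t ≤ approxNumber T n := by
  classical
  refine le_csInf ⟨_, 0, zero_mem_finiteRank n, rfl⟩ ?_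
  rintro _ ⟨F, ⟨hF1, hF2⟩, rfl⟩
  have hbJ : Orthonormal ℂ (fun i : J => b i) := hb.comp _ Subtype.val_injective
  let L : (J → ℂ) →ₗ[ℂ] LinearMap.range (F : E →ₗ[ℂ] E) :=
    (LinearMap.rangeRestrict (F : E →ₗ[ℂ] E)).comp (Fintype.linearCombination ℂ (fun i : J => b i))
  have hker : LinearMap.ker L ≠ ⊥ := by
    apply LinearMap.ker_ne_bot_of_finrank_lt
    simpa using hF2.trans_lt hn
  obtain ⟨c, hc, hc0⟩ := (Submodule.ne_bot_iff _).1 hker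
  set u : E := ∑ i : J, c i • b i with hu
  have hFu : F u = 0 := by
    have := congrArg Subtype.val (LinearMap.mem_ker.1 hc)
    simpa [L, Fintype.linearCombination_apply, hu] using this
  have hTu : T u = ∑ i : J, (c i * (ν i : ℂ)) • b i := by
    rw [hu, map_sum]
    refine Finset.sum_congr rfl fun i _ => ?_
    rw [map_smul, hT, smul_smul]
  have nsq : ∀ d : J → ℂ, ‖∑ i : J, d i • b i‖ ^ 2 = ∑ i, ‖d i‖ ^ 2 := by
    intro d
    have h := hbJ.inner_sum d d Finset.univ
    rw [inner_self_eq_norm_sq_to_K] at h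
    have h' : ((‖∑ i : J, d i • b i‖ ^ 2 : ℝ) : ℂ) = ((∑ i, ‖d i‖ ^ 2 : ℝ) : ℂ) := by
      push_cast
      rw [← Complex.coe_algebraMap] at *
      refine h.trans (Finset.sum_congr rfl fun i _ => ?_)
      rw [Complex.conj_mul']
      simp
    exact_mod_cast h'
  have hu0 : 0 < ‖u‖ := by
    rw [norm_pos_iff]
    intro h0
    have h1 := nsq c
    rw [← hu, h0, norm_zero] at h1
    obtain ⟨i, hi⟩ := Function.ne_iff.1 hc0
    have h2 : 0 < ∑ i, ‖c i‖ ^ 2 := Finset.sum_pos' (fun i _ => by positivity)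
      ⟨i, Finset.mem_univ _, by have := norm_pos_iff.2 hi; positivity⟩
    rw [← h1] at h2
    norm_num at h2
  have hle : t * ‖u‖ ≤ ‖T u‖ := by
    refine abs_le_of_sq_le_sq' ?_ (norm_nonneg _) |>.2
    rw [mul_pow, hTu, nsq, nsq, Finset.mul_sum]
    refine Finset.sum_le_sum fun i _ => ?_
    rw [norm_mul, mul_pow, mul_comm (‖c i‖ ^ 2), Complex.norm_real]
    refine mul_le_mul_of_nonneg_right (pow_le_pow_left₀ ht ?_ 2) (by positivity)
    exact (hJ i i.2).trans (le_abs_self _)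
  have h3 := (T - F).le_opNorm u
  rw [_root_.sub_apply, hFu, sub_zero] at h3
  exact le_of_mul_le_mul_right (hle.trans h3) hu0

/-- The approximation numbers of a positive definite compact operator on an infinite-dimensional
space are positive, and list its eigenvalues with multiplicity. -/
theorem approxNumber_pos_and_encard [CompleteSpace E] (hE : ¬ FiniteDimensional ℂ E) {T : E →L[ℂ] E}
    (hc : IsCompactOperator T) (hs : (T : E →ₗ[ℂ] E).IsSymmetric)
    (hpos : ∀ u, u ≠ 0 → 0 < (inner ℂ u (T u)).re) :
    (∀ n, 0 < approxNumber T n) ∧ ∀ ν : ℝ, 0 < ν → {n | approxNumber T n = ν}.encard =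
      (Module.finrank ℂ (Module.End.eigenspace (T : E →ₗ[ℂ] E) (ν : ℂ)) : ℕ∞) := by
  classical
  obtain ⟨b, hb⟩ := exists_hilbertBasis_eigenvector hc hs hpos
  let I := Σ μ : {μ : ℝ // 0 < μ},
    Fin (Module.finrank ℂ (Module.End.eigenspace (T : E →ₗ[ℂ] E) ((μ : ℝ) : ℂ)))
  have hfin : ∀ t : ℝ, 0 < t → {i : I | t < (i.1 : ℝ)}.Finite := fun t ht =>
    finite_setOf_lt_eigenvalue hc b.orthonormal hb ht
  have hge : ∀ t : ℝ, 0 < t → {i : I | t ≤ (i.1 : ℝ)}.Finite := fun t ht =>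
    (hfin (t / 2) (by linarith)).subset fun i hi => by
      simp only [Set.mem_ofPred_eq] at hi ⊢; linarith
  have hinf : Infinite I := by
    by_contra hI
    rw [not_infinite_iff_finite] at hI
    have := Fintype.ofFinite I
    exact hE (Module.Basis.finiteDimensional_of_finite b.toOrthonormalBasis.toBasis)
  -- The counting function of the eigenvalues `≥ t` is read off from the approximation numbers.
  -- Together with its strict analogue `hgt` this gives the multiplicities.
  have hlt : ∀ t (ht : 0 < t) n, n < (hge t ht).toFinset.card ↔ t ≤ approxNumber T n := by
    intro t ht n
    constructor
    · exact fun h => le_approxNumber_of_forall b.orthonormal hb ht.le _ (fun i hi =>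
        (hge t ht).mem_toFinset.1 hi) h
    · intro h
      by_contra hn
      push Not at hn
      set J := (hge t ht).toFinset
      -- Only finitely many eigenvalues lie in `[t/2, t)`, so the eigenvalues below `t` stay below
      -- some `s < t`.
      obtain ⟨s, hs0, hst, hsJ⟩ : ∃ s, 0 ≤ s ∧ s < t ∧ ∀ i ∉ J, (i.1 : ℝ) ≤ s := by
        set J' := (hge (t / 2) (by linarith)).toFinset \ J
        by_cases hJ' : J'.Nonempty
        · obtain ⟨i₀, hi₀, hmax⟩ := J'.exists_max_image (fun i => (i.1 : ℝ)) hJ'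
          have hi1 : t / 2 ≤ (i₀.1 : ℝ) ∧ ¬ t ≤ (i₀.1 : ℝ) := by simpa [J', J] using hi₀
          refine ⟨i₀.1, i₀.1.2.le, not_le.1 hi1.2, fun i hi => ?_⟩
          by_cases h2 : t / 2 ≤ (i.1 : ℝ)
          · exact hmax i (by simpa [J', J, h2] using hi)
          · linarith
        · refine ⟨t / 2, by linarith, by linarith, fun i hi => ?_⟩
          by_contra hcon
          exact hJ' ⟨i, by
            have : ¬ t ≤ (i.1 : ℝ) := by simpa [J] using hi
            simpa [J', J] using ⟨(not_le.1 hcon).le, not_le.1 this⟩⟩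
      have h1 := approxNumber_le_of_forall b (fun i => i.1.2) hb J hsJ hs0 hs
      have h2 := approxNumber_antitone T hn
      linarith
  refine ⟨fun n => ?_, fun ν hν => ?_⟩
  · obtain ⟨J, hJ⟩ := Infinite.exists_subset_card_eq I (n + 1)
    have hJn : J.Nonempty := Finset.card_pos.1 (by omega)
    obtain ⟨i₀, -, hmin⟩ := J.exists_min_image (fun i => (i.1 : ℝ)) hJn
    exact i₀.1.2.trans_le (le_approxNumber_of_forall b.orthonormal hb i₀.1.2.le J hmin (by omega))
  · have hgt : ∀ n, n < (hfin ν hν).toFinset.card ↔ ν < approxNumber T n := by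
      intro n
      constructor
      · intro h
        have hJn : (hfin ν hν).toFinset.Nonempty := Finset.card_pos.1 (by omega)
        obtain ⟨i₀, hi₀, hmin⟩ := (hfin ν hν).toFinset.exists_min_image (fun i => (i.1 : ℝ)) hJn
        have : ν < (i₀.1 : ℝ) := by simpa using hi₀
        exact this.trans_le
          (le_approxNumber_of_forall b.orthonormal hb i₀.1.2.le _ hmin h)
      · intro h
        have h' := (hlt _ (hν.trans h) n).2 le_rfl
        refine h'.trans_le (Finset.card_le_card fun i hi => ?_)
        simp only [Set.Finite.mem_toFinset, Set.mem_ofPred_eq] at hi ⊢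
        linarith
    -- The indices with value `ν` fill the interval between the number of eigenvalues `> ν` and the
    -- number of those `≥ ν`.
    have hset : {n | approxNumber T n = ν} =
        (Finset.Ico (hfin ν hν).toFinset.card (hge ν hν).toFinset.card : Set ℕ) := by
      ext n
      rw [Finset.coe_Ico, Set.mem_Ico, Set.mem_ofPred_eq, hlt ν hν, ← not_lt, hgt]
      exact ⟨fun h => by simp [h], fun h => le_antisymm (not_lt.1 h.1) h.2⟩
    rw [hset, Set.encard_coe_eq_coe_finsetCard, Nat.card_Ico]
    have hsub : (hfin ν hν).toFinset ⊆ (hge ν hν).toFinset := fun i hi => by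
      simp only [Set.Finite.mem_toFinset, Set.mem_ofPred_eq] at hi ⊢
      linarith
    rw [← Finset.card_sdiff_of_subset hsub]
    have himg : (hge ν hν).toFinset \ (hfin ν hν).toFinset =
        Finset.univ.map (Function.Embedding.sigmaMk (⟨ν, hν⟩ : {μ : ℝ // 0 < μ})) := by
      ext i
      simp only [Finset.mem_sdiff, Set.Finite.mem_toFinset, Set.mem_ofPred_eq, not_lt,
        Finset.mem_map, Finset.mem_univ, true_and]
      constructor
      · rintro ⟨h1, h2⟩
        obtain ⟨⟨μ, hμ⟩, j⟩ := i
        obtain rfl : μ = ν := le_antisymm h2 h1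
        exact ⟨j, rfl⟩
      · rintro ⟨j, rfl⟩
        exact ⟨le_rfl, le_rfl⟩
    rw [himg]
    simp

end ApproximationNumbers

/-! ### Lebesgue measure in a basis of the plane -/

section PlaneBases

theorem parallelepiped_pair_eq (b : Module.Basis (Fin 2) ℝ Plane) :
    parallelepiped ![b 0, b 1] = b.equivFun.symm.toContinuousLinearEquiv '' Set.Icc 0 1 := by
  ext x
  simp [parallelepiped, Module.Basis.equivFun_symm_apply, eq_comm]

theorem measurableSet_parallelepiped_pair (b : Module.Basis (Fin 2) ℝ Plane) :
    MeasurableSet (parallelepiped ![b 0, b 1]) := by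
  rw [parallelepiped_pair_eq]
  exact (b.equivFun.symm.toContinuousLinearEquiv.toHomeomorph.measurableEmbedding.measurableSet_image
    ).2 measurableSet_Icc

/-- Lebesgue measure in the coordinates of a basis is Lebesgue measure divided by the area of the
parallelogram that the basis spans. -/
theorem map_basis_volume (b : Module.Basis (Fin 2) ℝ Plane) :
    volume (parallelepiped ![b 0, b 1]) ≠ 0 ∧ volume (parallelepiped ![b 0, b 1]) ≠ ⊤ ∧
    Measure.map b.equivFun.symm.toContinuousLinearEquiv (volume : Measure (Fin 2 → ℝ)) =
      (volume (parallelepiped ![b 0, b 1]))⁻¹ • (volume : Measure Plane) := by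
  set L := b.equivFun.symm.toContinuousLinearEquiv
  obtain ⟨c, hc0, hct, hc⟩ : ∃ c : ENNReal, c ≠ 0 ∧ c ≠ ⊤ ∧
      Measure.map L (volume : Measure (Fin 2 → ℝ)) = c • (volume : Measure Plane) := by
    refine ⟨(Measure.addHaarScalarFactor (Measure.map L (volume : Measure (Fin 2 → ℝ))) volume :
      NNReal), ?_, ENNReal.coe_ne_top, ?_⟩
    · exact_mod_cast (Measure.addHaarScalarFactor_pos_of_isAddHaarMeasure _ _).ne'
    · exact Measure.isAddLeftInvariant_eq_smul _ _
  -- Haar measure is unique up to a scalar. The scalar is found on the unit square, whose image is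
  -- the parallelogram.
  have h1 : c * volume (parallelepiped ![b 0, b 1]) = 1 := by
    have h := congrArg (fun μ : Measure Plane => μ (parallelepiped ![b 0, b 1])) hc
    simp only [Measure.smul_apply, smul_eq_mul] at h
    rw [← h, Measure.map_apply L.continuous.measurable (measurableSet_parallelepiped_pair b),
      parallelepiped_pair_eq, Set.preimage_image_eq _ L.injective, Real.volume_Icc_pi]
    simp
  have hne0 : volume (parallelepiped ![b 0, b 1]) ≠ 0 := by
    intro h; rw [h, mul_zero] at h1; exact zero_ne_one h1
  have hnet : volume (parallelepiped ![b 0, b 1]) ≠ ⊤ := by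
    intro h; rw [h, ENNReal.mul_top hc0] at h1; exact ENNReal.top_ne_one h1
  refine ⟨hne0, hnet, ?_⟩
  rw [hc, ENNReal.eq_inv_of_mul_eq_one_left h1]

end PlaneBases

/-! ### The lattice and its dual -/

section Lattice

variable {a : ℝ}

theorem linearIndependent_v (ha : 0 < a) : LinearIndependent ℝ ![v₁ a, v₂ a] := by
  rw [LinearIndependent.pair_iff]
  intro s t h
  have h0 := congrFun (congrArg WithLp.ofLp h) 0
  have h1 := congrFun (congrArg WithLp.ofLp h) 1
  simp [v₁, v₂] at h0 h1
  have h3 : (0 : ℝ) < √3 := by positivity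
  have e0 : (s + t) * (a * √3) = 0 := by linarith
  have e1 : (s - t) * a = 0 := by linarith
  have f0 := (mul_eq_zero.1 e0).resolve_right (by positivity)
  have f1 := (mul_eq_zero.1 e1).resolve_right ha.ne'
  constructor <;> linarith

theorem linearIndependent_k (ha : 0 < a) : LinearIndependent ℝ ![k₁ a, k₂ a] := by
  rw [LinearIndependent.pair_iff]
  intro s t h
  have h0 := congrFun (congrArg WithLp.ofLp h) 0
  have h1 := congrFun (congrArg WithLp.ofLp h) 1
  simp [k₁, k₂] at h0 h1
  have h3 : (0 : ℝ) < √3 := by positivity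
  have hc : 0 < 4 * Real.pi / (a * √3) := by positivity
  set c := 4 * Real.pi / (a * √3)
  have e0 : (s + t) * c = 0 := by linarith
  have e1 : (s - t) * (c * √3) = 0 := by linarith
  have f0 := (mul_eq_zero.1 e0).resolve_right hc.ne'
  have f1 := (mul_eq_zero.1 e1).resolve_right (by positivity)
  constructor <;> linarith

/-- The basis `v₁, v₂` of the plane. -/
def basisV (ha : 0 < a) : Module.Basis (Fin 2) ℝ Plane :=
  basisOfLinearIndependentOfCardEqFinrank (linearIndependent_v ha) (by simp)

/-- The basis `k₁, k₂` of the plane. -/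
def basisK (ha : 0 < a) : Module.Basis (Fin 2) ℝ Plane :=
  basisOfLinearIndependentOfCardEqFinrank (linearIndependent_k ha) (by simp)

@[simp] theorem basisV_zero (ha : 0 < a) : basisV ha 0 = v₁ a := by simp [basisV]
@[simp] theorem basisV_one (ha : 0 < a) : basisV ha 1 = v₂ a := by simp [basisV]
@[simp] theorem basisK_zero (ha : 0 < a) : basisK ha 0 = k₁ a := by simp [basisK]
@[simp] theorem basisK_one (ha : 0 < a) : basisK ha 1 = k₂ a := by simp [basisK]

theorem areaCell_pos (ha : 0 < a) : 0 < areaCell a := by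
  have h := map_basis_volume (basisV ha)
  simp only [basisV_zero, basisV_one] at h
  exact ENNReal.toReal_pos h.1 h.2.1

theorem areaDual_pos (ha : 0 < a) : 0 < areaDual a := by
  have h := map_basis_volume (basisK ha)
  simp only [basisK_zero, basisK_one] at h
  exact ENNReal.toReal_pos h.1 h.2.1

theorem inner_plane (x y : Plane) : inner ℝ x y = x 0 * y 0 + x 1 * y 1 := by
  simp [PiLp.inner_apply, Fin.sum_univ_two, mul_comm]

/-- This is the duality `k_i · v_j = 2π δ_ij`, verified on the explicit coordinates. -/
theorem inner_ξ (ha : 0 < a) (m : ℤ × ℤ) (s t : ℝ) :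
    inner ℝ (ξ a m) (s • v₁ a + t • v₂ a) = 2 * Real.pi * (m.1 * s + m.2 * t) := by
  have h3 : √3 * √3 = 3 := Real.mul_self_sqrt (by norm_num)
  have hs : √3 ≠ 0 := by positivity
  simp only [inner_plane, ξ, k₁, k₂, v₁, v₂, PiLp.add_apply, PiLp.smul_apply, smul_eq_mul,
    Matrix.cons_val_zero, Matrix.cons_val_one]
  field_simp
  ring

end Lattice

/-! ### Quasi-periodic plane waves as a Hilbert basis -/

section FourierBasis

-- The circle carries Haar probability measure, for which the monomials `mFourier` are orthonormal.
local instance : MeasureSpace UnitAddCircle := ⟨AddCircle.haarAddCircle⟩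

local instance : Measure.IsAddHaarMeasure (volume : Measure UnitAddCircle) :=
  inferInstanceAs (Measure.IsAddHaarMeasure AddCircle.haarAddCircle)

local instance : IsProbabilityMeasure (volume : Measure UnitAddCircle) :=
  inferInstanceAs (IsProbabilityMeasure AddCircle.haarAddCircle)

variable {a : ℝ}

/-- The coordinate parametrization of the cell by the unit torus. -/
def torusToCell (ha : 0 < a) (x : UnitAddTorus (Fin 2)) : Plane :=
  (basisV ha).equivFun.symm.toContinuousLinearEquiv
    ((UnitAddTorus.measurableEquivPiIoc (0 : Fin 2 → ℝ) x : _) : Fin 2 → ℝ)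

theorem measurable_torusToCell (ha : 0 < a) : Measurable (torusToCell ha) :=
  (basisV ha).equivFun.symm.toContinuousLinearEquiv.continuous.measurable.comp
    (measurable_subtype_coe.comp (UnitAddTorus.measurableEquivPiIoc (0 : Fin 2 → ℝ)).measurable)

/-- The half-open unit square differs from the closed one by a null set, and the linear map onto the
cell scales area by `volume (cell a)`. -/
theorem measurePreserving_torusToCell (ha : 0 < a) :
    MeasurePreserving (torusToCell ha) volume
      ((volume (cell a))⁻¹ • volume.restrict (cell a)) := by
  refine ⟨measurable_torusToCell ha, ?_⟩
  set L := (basisV ha).equivFun.symm.toContinuousLinearEquiv with hL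
  have hcell : cell a = L '' Set.Icc 0 1 := by
    have := parallelepiped_pair_eq (basisV ha)
    rwa [basisV_zero, basisV_one] at this
  have h1 : Measure.map (torusToCell ha) volume = Measure.map L (Measure.map Subtype.val
      (Measure.map (UnitAddTorus.measurableEquivPiIoc (0 : Fin 2 → ℝ)) volume)) := by
    rw [Measure.map_map measurable_subtype_coe
      (UnitAddTorus.measurableEquivPiIoc (0 : Fin 2 → ℝ)).measurable,
      Measure.map_map L.continuous.measurable (measurable_subtype_coe.comp
      (UnitAddTorus.measurableEquivPiIoc (0 : Fin 2 → ℝ)).measurable)]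
    rfl
  have hms : MeasurableSet {x : Fin 2 → ℝ | ∀ i, x i ∈ Set.Ioc ((0 : Fin 2 → ℝ) i)
      ((0 : Fin 2 → ℝ) i + 1)} := MeasurableSet.univ_pi' (fun i => measurableSet_Ioc)
  have h2 : Measure.map Subtype.val
      (Measure.map (UnitAddTorus.measurableEquivPiIoc (0 : Fin 2 → ℝ)) volume) =
      (volume : Measure (Fin 2 → ℝ)).restrict (Set.Icc 0 1) := by
    rw [(UnitAddTorus.measurePreserving_equivPiIoc (0 : Fin 2 → ℝ)).map_eq]
    refine (map_comap_subtype_coe hms volume).trans ?_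
    refine Measure.restrict_congr_set ?_
    have := Measure.univ_pi_Ioc_ae_eq_Icc (μ := fun _ : Fin 2 => (volume : Measure ℝ))
      (f := (0 : Fin 2 → ℝ)) (g := 1)
    have he : {x : Fin 2 → ℝ | ∀ i, x i ∈ Set.Ioc ((0 : Fin 2 → ℝ) i) ((0 : Fin 2 → ℝ) i + 1)} =
        Set.univ.pi fun i => Set.Ioc ((0 : Fin 2 → ℝ) i) ((1 : Fin 2 → ℝ) i) := by
      ext x
      simp [Set.mem_pi]
    rw [he]
    exact this
  have h3 := (map_basis_volume (basisV ha)).2.2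
  simp only [basisV_zero, basisV_one] at h3
  rw [h1, h2]
  have h4 := (L.toHomeomorph.measurableEmbedding).restrict_map
    (volume : Measure (Fin 2 → ℝ)) (cell a)
  have h5 : L.toHomeomorph ⁻¹' (cell a) = Set.Icc 0 1 := by
    rw [hcell]; exact Set.preimage_image_eq _ L.injective
  rw [h5] at h4
  refine h4.symm.trans ?_
  rw [← Measure.restrict_smul]
  congr 1

/-- In lattice coordinates only the unimodular factor `e^{ik·x}`, common to all `m`, distinguishes
the plane waves from Fourier monomials. Orthogonality and completeness are thus inherited from the
torus. -/
theorem phase_torusToCell (ha : 0 < a) (k : Plane) (m : ℤ × ℤ) (x : UnitAddTorus (Fin 2)) :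
    phase a k m (torusToCell ha x) = UnitAddTorus.mFourier ![m.1, m.2] x *
      Complex.exp (Complex.I * ((inner ℝ k (torusToCell ha x) : ℝ) : ℂ)) := by
  rw [phase, inner_add_left]
  push_cast
  rw [mul_add, Complex.exp_add]
  congr 1
  set y := ((UnitAddTorus.measurableEquivPiIoc (0 : Fin 2 → ℝ) x : _) : Fin 2 → ℝ) with hy
  have hx : ∀ i, x i = (y i : UnitAddCircle) := fun i => by
    rw [hy, UnitAddTorus.coe_measurableEquivPiIoc_apply]
    simp
  have ht : torusToCell ha x = y 0 • v₁ a + y 1 • v₂ a := by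
    rw [torusToCell, ← hy]
    simp [Module.Basis.equivFun_symm_apply]
  rw [ht, inner_ξ ha]
  simp only [UnitAddTorus.mFourier, ContinuousMap.coe_mk, Fin.prod_univ_two, hx]
  simp only [Matrix.cons_val_zero, Matrix.cons_val_one, fourier_coe_apply, ← Complex.exp_add]
  congr 1
  push_cast
  ring

theorem inner_planeWave (a : ℝ) (k : Plane) (m : ℤ × ℤ) (f : L2Cell a) :
    inner ℂ (planeWave a k m) f =
      ∫ x, f x * (starRingEnd ℂ) (phase a k m x) ∂volume.restrict (cell a) := by
  rw [L2.inner_def]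
  refine integral_congr_ae ?_
  filter_upwards [(memLp_phase a k m).coeFn_toLp] with x hx
  rw [planeWave, hx]
  rfl

theorem integral_cell (ha : 0 < a) {g : Plane → ℂ}
    (hg : AEStronglyMeasurable g (volume.restrict (cell a))) :
    ∫ x, g x ∂volume.restrict (cell a) = (areaCell a : ℂ) * ∫ x, g (torusToCell ha x) := by
  have h := map_basis_volume (basisV ha)
  simp only [basisV_zero, basisV_one] at h
  have hmp := measurePreserving_torusToCell ha
  have h1 : ∫ x, g x ∂((volume (cell a))⁻¹ • volume.restrict (cell a)) =
      ∫ x, g (torusToCell ha x) := by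
    rw [← hmp.map_eq, integral_map hmp.measurable.aemeasurable]
    rw [hmp.map_eq]
    exact hg.smul_measure _
  rw [← h1, integral_smul_measure, areaCell, Measure.real, ENNReal.toReal_inv]
  have : ((volume (cell a)).toReal : ℂ) ≠ 0 := by
    exact_mod_cast (areaCell_pos ha).ne'
  rw [Complex.real_smul]
  push_cast
  rw [← mul_assoc, mul_inv_cancel₀ this, one_mul]

theorem norm_exp_inner (k x : Plane) :
    Complex.exp (Complex.I * ((inner ℝ k x : ℝ) : ℂ)) *
      (starRingEnd ℂ) (Complex.exp (Complex.I * ((inner ℝ k x : ℝ) : ℂ))) = 1 := by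
  rw [Complex.mul_conj, mul_comm, Complex.normSq_eq_norm_sq, Complex.norm_exp_ofReal_mul_I]
  simp

theorem inner_planeWave_planeWave (ha : 0 < a) (k : Plane) (m n : ℤ × ℤ) :
    inner ℂ (planeWave a k m) (planeWave a k n) = if m = n then (areaCell a : ℂ) else 0 := by
  have h1 : inner ℂ (planeWave a k m) (planeWave a k n) =
      ∫ x, phase a k n x * (starRingEnd ℂ) (phase a k m x) ∂volume.restrict (cell a) := by
    rw [inner_planeWave]
    refine integral_congr_ae ?_
    filter_upwards [(memLp_phase a k n).coeFn_toLp] with x hx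
    rw [planeWave, hx]
  have hc : ∀ m, Continuous (phase a k m) := fun m => by unfold phase; fun_prop
  rw [h1, integral_cell ha (g := fun x => phase a k n x * (starRingEnd ℂ) (phase a k m x))
    ((hc n).mul (Complex.continuous_conj.comp (hc m))).aestronglyMeasurable]
  have h2 : ∀ x, phase a k n (torusToCell ha x) *
      (starRingEnd ℂ) (phase a k m (torusToCell ha x)) =
      UnitAddTorus.mFourier ![n.1, n.2] x * (starRingEnd ℂ) (UnitAddTorus.mFourier ![m.1, m.2] x) := by
    intro x
    rw [phase_torusToCell, phase_torusToCell, map_mul, mul_mul_mul_comm, norm_exp_inner, mul_one]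
  simp only [h2]
  have h3 := orthonormal_iff_ite.1 (UnitAddTorus.orthonormal_mFourier (d := Fin 2))
    ![m.1, m.2] ![n.1, n.2]
  rw [ContinuousMap.inner_toLp] at h3
  rw [h3]
  have : (![m.1, m.2] = ![n.1, n.2]) ↔ m = n := by
    constructor
    · intro h
      exact Prod.ext (congrFun h 0) (congrFun h 1)
    · rintro rfl; rfl
  simp [this]

/-- After multiplication by `e^{-ik·x}` the hypothesis says that all Fourier coefficients on the
torus vanish. -/
theorem eq_zero_of_forall_inner_planeWave (ha : 0 < a) (k : Plane) {f : L2Cell a}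
    (hf : ∀ m, inner ℂ (planeWave a k m) f = 0) : f = 0 := by
  have hmp := measurePreserving_torusToCell ha
  have h := map_basis_volume (basisV ha)
  simp only [basisV_zero, basisV_one] at h
  have hne : (volume (cell a))⁻¹ ≠ 0 := ENNReal.inv_ne_zero.2 h.2.1
  have hnt : (volume (cell a))⁻¹ ≠ ⊤ := ENNReal.inv_ne_top.2 h.1
  have hfm : MemLp (f ∘ torusToCell ha) 2 volume :=
    ((Lp.memLp f).smul_measure hnt).comp_measurePreserving hmp
  let e : UnitAddTorus (Fin 2) → ℂ := fun x =>
    (starRingEnd ℂ) (Complex.exp (Complex.I * ((inner ℝ k (torusToCell ha x) : ℝ) : ℂ)))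
  have he : Measurable e := by
    have := measurable_torusToCell ha
    have h' : Continuous fun y : Plane =>
      (starRingEnd ℂ) (Complex.exp (Complex.I * ((inner ℝ k y : ℝ) : ℂ))) := by fun_prop
    exact h'.measurable.comp this
  have hen : ∀ x, ‖e x‖ = 1 := fun x => by
    simp only [e, RCLike.norm_conj]
    rw [mul_comm, Complex.norm_exp_ofReal_mul_I]
  have hg : MemLp (fun x => f (torusToCell ha x) * e x) 2 volume := by
    refine hfm.of_le (hfm.aestronglyMeasurable.mul he.aestronglyMeasurable)
      (Eventually.of_forall fun x => ?_)
    simp [hen]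
  have hz : hg.toLp = 0 := by
    apply (UnitAddTorus.mFourierBasis (d := Fin 2)).repr.injective
    ext n
    rw [UnitAddTorus.mFourierBasis_repr, map_zero]
    have h1 := hf (n 0, n 1)
    rw [inner_planeWave, integral_cell ha] at h1
    · have h2 := (mul_eq_zero.1 h1).resolve_left (by exact_mod_cast (areaCell_pos ha).ne')
      refine Eq.trans ?_ h2
      rw [UnitAddTorus.mFourierCoeff]
      refine integral_congr_ae ?_
      filter_upwards [hg.coeFn_toLp] with x hx
      have hn : (![n 0, n 1] : Fin 2 → ℤ) = n := by ext i; fin_cases i <;> rfl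
      rw [hx, phase_torusToCell, map_mul, smul_eq_mul, UnitAddTorus.mFourier_neg, hn]
      simp only [e]
      ring
    · exact (Lp.aestronglyMeasurable f).mul
        (Continuous.aestronglyMeasurable (by unfold phase; fun_prop))
  have h0 : ∀ᵐ x, f (torusToCell ha x) = 0 := by
    have := hg.coeFn_toLp
    rw [hz] at this
    filter_upwards [this, Lp.coeFn_zero ℂ 2 (volume : Measure (UnitAddTorus (Fin 2)))] with x h1 h2
    rw [h2] at h1
    have hex : e x ≠ 0 := by
      intro h'; have := hen x; rw [h', norm_zero] at this; exact zero_ne_one this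
    exact (mul_eq_zero.1 h1.symm).resolve_right hex
  have h1 : ∀ᵐ y ∂((volume (cell a))⁻¹ • volume.restrict (cell a)), f y = 0 := by
    rw [← hmp.map_eq, ae_map_iff hmp.measurable.aemeasurable]
    · exact h0
    · exact measurableSet_eq_fun (Lp.stronglyMeasurable f).measurable measurable_const
  rw [Measure.ae_ennreal_smul_measure_iff hne] at h1
  exact (Lp.eq_zero_iff_ae_eq_zero).2 h1

/-- The Hilbert basis of normalized quasi-periodic plane waves. -/
def planeWaveBasis (ha : 0 < a) (k : Plane) : HilbertBasis (ℤ × ℤ) ℂ (L2Cell a) :=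
  HilbertBasis.mkOfOrthogonalEqBot
    (v := fun m => ((√(areaCell a))⁻¹ : ℂ) • planeWave a k m)
    (by
      have hA := areaCell_pos ha
      have hs : ((√(areaCell a) : ℝ) : ℂ) * (√(areaCell a) : ℝ) = (areaCell a : ℂ) := by
        exact_mod_cast Real.mul_self_sqrt hA.le
      have hs0 : ((√(areaCell a) : ℝ) : ℂ) ≠ 0 := by
        exact_mod_cast (Real.sqrt_pos.2 hA).ne'
      rw [orthonormal_iff_ite]
      intro m n
      rw [inner_smul_left, inner_smul_right, inner_planeWave_planeWave ha, map_inv₀,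
        Complex.conj_ofReal]
      split_ifs
      · rw [← hs]; field_simp
      · simp)
    (by
      rw [eq_bot_iff]
      intro f hf
      rw [Submodule.mem_orthogonal] at hf
      refine (Submodule.mem_bot ℂ).2 (eq_zero_of_forall_inner_planeWave ha k fun m => ?_)
      have h := hf _ (Submodule.subset_span ⟨m, rfl⟩)
      simp only [inner_smul_left] at h
      have hA := areaCell_pos ha
      have hs0 : ((√(areaCell a) : ℝ) : ℂ) ≠ 0 := by
        exact_mod_cast (Real.sqrt_pos.2 hA).ne'
      refine (mul_eq_zero.1 h).resolve_left ?_
      simpa using hs0)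

/-- Fourier coefficients identify `L²_𝐤(Γ)` with `ℓ²(ℤ²)`. -/
def coeffEquiv (ha : 0 < a) (k : Plane) : L2Cell a ≃ₗ[ℂ] lp (fun _ : ℤ × ℤ => ℂ) 2 :=
  (planeWaveBasis ha k).repr.toLinearEquiv.trans
    (LinearEquiv.smulOfNeZero ℂ _ ((√(areaCell a) : ℝ) : ℂ)⁻¹ (inv_ne_zero (by
      exact_mod_cast (Real.sqrt_pos.2 (areaCell_pos ha)).ne')))

/-- The orthonormal basis contributes one factor `area(Γ)^{-1/2}`; the scaling in `coeffEquiv`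
supplies the other. -/
theorem coeffEquiv_apply (ha : 0 < a) (k : Plane) (f : L2Cell a) (m : ℤ × ℤ) :
    coeffEquiv ha k f m = coeff a k m f := by
  have hA := areaCell_pos ha
  have hs : ((√(areaCell a) : ℝ) : ℂ) * (√(areaCell a) : ℝ) = (areaCell a : ℂ) := by
    exact_mod_cast Real.mul_self_sqrt hA.le
  simp only [coeffEquiv, LinearEquiv.trans_apply, LinearEquiv.smulOfNeZero_apply, lp.coeFn_smul,
    Pi.smul_apply, smul_eq_mul, coeff]
  change _ * (planeWaveBasis ha k).repr f m = _
  rw [HilbertBasis.repr_apply_apply, planeWaveBasis, HilbertBasis.coe_mkOfOrthogonalEqBot,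
    inner_smul_left, map_inv₀, Complex.conj_ofReal, ← mul_assoc, ← mul_inv, hs]

end FourierBasis

/-! ### Free energies at the Dirac point and the reference weight -/

section Geometry

variable {a : ℝ}

/-- The eigenvalues `|ξ_m + k|²` of the free fiber Laplacian. -/
def free (a : ℝ) (k : Plane) (m : ℤ × ℤ) : ℝ := ‖ξ a m + k‖ ^ 2

theorem free_nonneg (a : ℝ) (k : Plane) (m : ℤ × ℤ) : 0 ≤ free a k m := sq_nonneg _

/-- The lowest eigenvalue `|K|²` of the free Laplacian at the Dirac point. -/
def groundEnergy (a : ℝ) : ℝ := 16 * Real.pi ^ 2 / (9 * a ^ 2)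

theorem groundEnergy_pos (ha : 0 < a) : 0 < groundEnergy a := by
  unfold groundEnergy; positivity

/-- The quadratic form that governs the free spectrum at the Dirac point. -/
def hexForm (m : ℤ × ℤ) : ℤ := m.1 ^ 2 + m.2 ^ 2 - m.1 * m.2 + m.1

/-- The free spectrum at `K` becomes a question about values of an integral quadratic polynomial. -/
theorem free_dirac (ha : 0 < a) (m : ℤ × ℤ) :
    free a (diracPoint a) m = groundEnergy a * (1 + 3 * (hexForm m : ℝ)) := by
  have h3 : √3 * √3 = 3 := Real.mul_self_sqrt (by norm_num)
  have h3' : √3 ^ 2 = 3 := Real.sq_sqrt (by norm_num)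
  have hs : √3 ≠ 0 := by positivity
  rw [free, ← real_inner_self_eq_norm_sq, inner_plane]
  simp only [ξ, k₁, k₂, diracPoint, PiLp.add_apply, PiLp.smul_apply, smul_eq_mul,
    Matrix.cons_val_zero, Matrix.cons_val_one, groundEnergy, hexForm]
  push_cast
  field_simp
  ring_nf
  simp only [h3']
  ring

/-- `4·hexForm = (2q - p)² + 3p² + 4p`, and `3p² + 4p + 1 = (3p + 1)(p + 1) ≥ 0` at integers. So
`4·hexForm ≥ -1`, and integrality does the rest. -/
theorem hexForm_nonneg (m : ℤ × ℤ) : 0 ≤ hexForm m := by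
  unfold hexForm
  obtain ⟨p, q⟩ := m
  simp only
  have h : 0 ≤ (2 * q - p) ^ 2 := sq_nonneg _
  have h2 : 0 ≤ 3 * p ^ 2 + 4 * p + 1 := by
    rcases le_or_gt 0 p with hp | hp
    · positivity
    · have : 0 ≤ (-p - 1) * (-3 * p - 1) := mul_nonneg (by omega) (by omega)
      linarith
  nlinarith

theorem groundEnergy_le_free (ha : 0 < a) (m : ℤ × ℤ) :
    groundEnergy a ≤ free a (diracPoint a) m := by
  rw [free_dirac ha]
  have h : (0 : ℝ) ≤ hexForm m := by exact_mod_cast hexForm_nonneg m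
  nlinarith [groundEnergy_pos ha]

/-- Coercivity, already valid for real arguments: the weight grows at least like `|m|²`. -/
theorem sq_norm_le_hexForm (m : ℤ × ℤ) : ‖m‖ ^ 2 ≤ 4 + 3 * (hexForm m : ℝ) := by
  obtain ⟨p, q⟩ := m
  have key : ∀ x y : ℝ, x ^ 2 ≤ 4 + 3 * (x ^ 2 + y ^ 2 - x * y + x) ∧
      y ^ 2 ≤ 4 + 3 * (x ^ 2 + y ^ 2 - x * y + x) := fun x y =>
    ⟨by nlinarith [sq_nonneg (x - 2 * y), sq_nonneg (5 * x + 6), sq_nonneg x],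
     by nlinarith [sq_nonneg (2 * x - y + 1), sq_nonneg (5 * y + 6), sq_nonneg y]⟩
  have h := key p q
  simp only [hexForm]
  push_cast
  rw [Prod.norm_mk]
  rcases max_choice ‖p‖ ‖q‖ with h' | h' <;> rw [h', Int.norm_eq_abs, sq_abs]
  · exact h.1
  · exact h.2

/-- The reference weight `|ξ_m + K|² + 1`. -/
def weight (a : ℝ) (m : ℤ × ℤ) : ℝ := free a (diracPoint a) m + 1

theorem one_le_weight (a : ℝ) (m : ℤ × ℤ) : 1 ≤ weight a m := by
  unfold weight; linarith [free_nonneg a (diracPoint a) m]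

theorem weight_pos (a : ℝ) (m : ℤ × ℤ) : 0 < weight a m := by linarith [one_le_weight a m]

theorem one_le_sqrt_weight (a : ℝ) (m : ℤ × ℤ) : 1 ≤ √(weight a m) := by
  rw [Real.one_le_sqrt]; exact one_le_weight a m

theorem sqrt_weight_mul_self (a : ℝ) (m : ℤ × ℤ) : √(weight a m) * √(weight a m) = weight a m :=
  Real.mul_self_sqrt (weight_pos a m).le

theorem norm_add_dirac_le (a : ℝ) (m : ℤ × ℤ) : ‖ξ a m + diracPoint a‖ ≤ √(weight a m) := by
  apply Real.le_sqrt_of_sq_le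
  unfold weight free
  linarith

theorem sq_norm_le_weight (ha : 0 < a) :
    ∃ C : ℝ, 0 < C ∧ ∀ m : ℤ × ℤ, ‖m‖ ^ 2 ≤ C * weight a m := by
  have hκ := groundEnergy_pos ha
  refine ⟨(groundEnergy a)⁻¹ + 3, by positivity, fun m => ?_⟩
  have h := sq_norm_le_hexForm m
  have h1 : 1 + 3 * (hexForm m : ℝ) = (groundEnergy a)⁻¹ * free a (diracPoint a) m := by
    rw [free_dirac ha]; field_simp
  have h2 := free_nonneg a (diracPoint a) m
  have h3 : 0 < (groundEnergy a)⁻¹ := by positivity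
  unfold weight
  nlinarith

theorem norm_le_sqrt_weight (ha : 0 < a) :
    ∃ C : ℝ, 0 < C ∧ ∀ m : ℤ × ℤ, ‖m‖ ≤ C * √(weight a m) := by
  obtain ⟨C, hC, h⟩ := sq_norm_le_weight ha
  refine ⟨√C, Real.sqrt_pos.2 hC, fun m => ?_⟩
  rw [← Real.sqrt_mul hC.le]
  exact Real.le_sqrt_of_sq_le (h m)

/-- `w^{3/2}` dominates `|m|³`, and the exponent 3 exceeds the dimension 2. Differences of two
resolvent terms decay exactly at this rate. -/
theorem summable_weight (ha : 0 < a) :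
    Summable fun m : ℤ × ℤ => (weight a m * √(weight a m))⁻¹ := by
  obtain ⟨C, hC, h⟩ := norm_le_sqrt_weight ha
  have h1 : Summable fun m : ℤ × ℤ => ‖m‖ ^ (-(3 : ℝ)) := by
    have h0 := EisensteinSeries.summable_one_div_norm_rpow (k := 3) (by norm_num)
    rw [← (finTwoArrowEquiv _).symm.summable_iff] at h0
    refine h0.congr fun m => ?_
    simp [Prod.norm_def, EisensteinSeries.norm_eq_max_natAbs, Int.norm_eq_abs,
      Nat.cast_natAbs]
  refine Summable.of_norm_bounded_eventually (h1.mul_left (C ^ 3)) ?_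
  filter_upwards [(Set.finite_singleton (0 : ℤ × ℤ)).compl_mem_cofinite] with m hm
  have hm0 : 0 < ‖m‖ := norm_pos_iff.2 hm
  have hp : 0 < √(weight a m) := by linarith [one_le_sqrt_weight a m]
  have hw := weight_pos a m
  rw [Real.norm_of_nonneg (by positivity), Real.rpow_neg hm0.le,
    show (3 : ℝ) = ((3 : ℕ) : ℝ) by norm_num, Real.rpow_natCast, ← div_eq_mul_inv,
    inv_le_comm₀ (by positivity) (by positivity), inv_div, div_le_iff₀ (by positivity)]
  calc ‖m‖ ^ 3 ≤ (C * √(weight a m)) ^ 3 := pow_le_pow_left₀ hm0.le (h m) 3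
    _ = weight a m * √(weight a m) * C ^ 3 := by
      rw [mul_pow, pow_succ (√(weight a m)), Real.sq_sqrt hw.le]; ring

theorem summable_inv_weight_sq (ha : 0 < a) :
    Summable fun m : ℤ × ℤ => (weight a m ^ 2)⁻¹ := by
  refine Summable.of_nonneg_of_le (fun m => by positivity) (fun m => ?_) (summable_weight ha)
  have hw := weight_pos a m
  have hp := one_le_sqrt_weight a m
  gcongr
  rw [sq]
  gcongr
  nlinarith [sqrt_weight_mul_self a m]

theorem tendsto_weight (ha : 0 < a) : Tendsto (weight a) cofinite atTop := by
  obtain ⟨C, hC, h⟩ := norm_le_sqrt_weight ha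
  have h1 := (summable_weight ha).tendsto_cofinite_zero
  rw [tendsto_atTop]
  intro B
  have hB : 0 < (max B 1 ^ 2)⁻¹ := by positivity
  filter_upwards [h1.eventually (gt_mem_nhds hB)] with m hm
  have hw := one_le_weight a m
  have hp := one_le_sqrt_weight a m
  by_contra hlt
  push Not at hlt
  have h2 : weight a m * √(weight a m) ≤ max B 1 ^ 2 := by
    have h3 : √(weight a m) ≤ weight a m := by
      nlinarith [sqrt_weight_mul_self a m]
    have h4 : weight a m ≤ max B 1 := hlt.le.trans (le_max_left _ _)
    rw [sq]
    gcongr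
    exact h3.trans h4
  exact absurd hm (not_lt.2 (inv_anti₀ (by positivity) h2))

theorem free_sub_dirac (a : ℝ) (k : Plane) (m : ℤ × ℤ) :
    free a k m - free a (diracPoint a) m =
      2 * inner ℝ (ξ a m + diracPoint a) (k - diracPoint a) + ‖k - diracPoint a‖ ^ 2 := by
  have : ξ a m + k = (ξ a m + diracPoint a) + (k - diracPoint a) := by abel
  rw [free, free, this, norm_add_sq_real]
  ring

/-- Moving `k` changes an energy only by the order of its square root. This half power makes
differences of lattice sums absolutely convergent. -/
theorem abs_free_sub_dirac_le (a : ℝ) (k : Plane) (m : ℤ × ℤ) :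
    |free a k m - free a (diracPoint a) m| ≤
      (2 * ‖k - diracPoint a‖ + ‖k - diracPoint a‖ ^ 2) * √(weight a m) := by
  rw [free_sub_dirac]
  have h1 := abs_real_inner_le_norm (ξ a m + diracPoint a) (k - diracPoint a)
  have h2 := norm_add_dirac_le a m
  have h3 := one_le_sqrt_weight a m
  have h4 := norm_nonneg (k - diracPoint a)
  have h5 : ‖ξ a m + diracPoint a‖ * ‖k - diracPoint a‖ ≤ √(weight a m) * ‖k - diracPoint a‖ := by
    gcongr
  calc _ ≤ |2 * inner ℝ (ξ a m + diracPoint a) (k - diracPoint a)| + |‖k - diracPoint a‖ ^ 2| :=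
        abs_add_le _ _
    _ ≤ 2 * (√(weight a m) * ‖k - diracPoint a‖) + ‖k - diracPoint a‖ ^ 2 * √(weight a m) := by
        rw [abs_mul, abs_two, abs_of_nonneg (sq_nonneg ‖k - diracPoint a‖)]
        gcongr
        · exact h1.trans h5
        · exact le_mul_of_one_le_right (by positivity) h3
    _ = _ := by ring

end Geometry

/-! ### Phases and the threefold rotation symmetry -/

section Phases

variable {a : ℝ}

/-- The phase `e^{i ξ_m·x₀}`. -/
def hexPhase (m : ℤ × ℤ) : ℂ :=
  Complex.exp (((4 * Real.pi / 3 * (m.1 + m.2) : ℝ) : ℂ) * Complex.I)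

theorem norm_hexPhase (m : ℤ × ℤ) : ‖hexPhase m‖ = 1 := Complex.norm_exp_ofReal_mul_I _

theorem hexPhase_mul_conj (m : ℤ × ℤ) : hexPhase m * (starRingEnd ℂ) (hexPhase m) = 1 := by
  rw [Complex.mul_conj, Complex.normSq_eq_norm_sq, norm_hexPhase]; simp

theorem conj_mul_hexPhase (m : ℤ × ℤ) : (starRingEnd ℂ) (hexPhase m) * hexPhase m = 1 := by
  rw [mul_comm, hexPhase_mul_conj]

/-- The Bloch phase `e^{i k·x₀}`. -/
def blochPhase (a : ℝ) (k : Plane) : ℂ := Complex.exp (((inner ℝ k (x₀ a) : ℝ) : ℂ) * Complex.I)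

theorem blochPhase_mul_conj (a : ℝ) (k : Plane) :
    blochPhase a k * (starRingEnd ℂ) (blochPhase a k) = 1 := by
  rw [Complex.mul_conj, Complex.normSq_eq_norm_sq, blochPhase, Complex.norm_exp_ofReal_mul_I]; simp

theorem inner_ξ_x₀ (ha : 0 < a) (m : ℤ × ℤ) :
    inner ℝ (ξ a m) (x₀ a) = 4 * Real.pi / 3 * (m.1 + m.2) := by
  rw [x₀, smul_add, inner_ξ ha]; ring

theorem phase_x₀ (ha : 0 < a) (k : Plane) (m : ℤ × ℤ) :
    phase a k m (x₀ a) = blochPhase a k * hexPhase m := by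
  rw [phase, inner_add_left, inner_ξ_x₀ ha, blochPhase, hexPhase, ← Complex.exp_add]
  congr 1
  push_cast
  ring

theorem phase_neg (a : ℝ) (k : Plane) (m : ℤ × ℤ) (x : Plane) :
    phase a k m (-x) = (starRingEnd ℂ) (phase a k m x) := by
  rw [phase, phase, ← Complex.exp_conj, inner_neg_right]
  congr 1
  simp

theorem phase_neg_x₀ (ha : 0 < a) (k : Plane) (m : ℤ × ℤ) :
    phase a k m (-x₀ a) = (starRingEnd ℂ) (blochPhase a k) * (starRingEnd ℂ) (hexPhase m) := by
  rw [phase_neg, phase_x₀ ha, map_mul]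

theorem phase_zero (a : ℝ) (k : Plane) (m : ℤ × ℤ) : phase a k m 0 = 1 := by simp [phase]

theorem phase_zero_x₀ (ha : 0 < a) (m : ℤ × ℤ) : phase a 0 m (x₀ a) = hexPhase m := by
  rw [phase_x₀ ha]; simp [blochPhase]

/-- Rotation by `2π/3` about the Dirac point, on the labels of the dual lattice. -/
def rot : ℤ × ℤ ≃ ℤ × ℤ where
  toFun m := (-m.2 - 1, m.1 - m.2)
  invFun m := (m.2 - m.1 - 1, -m.1 - 1)
  left_inv m := by
    ext
    · simp; ring
    · simp
  right_inv m := by ext <;> simp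

theorem hexForm_rot (m : ℤ × ℤ) : hexForm (rot m) = hexForm m := by
  simp only [hexForm, rot, Equiv.coe_fn_mk]; ring

theorem free_dirac_rot (ha : 0 < a) (m : ℤ × ℤ) :
    free a (diracPoint a) (rot m) = free a (diracPoint a) m := by
  rw [free_dirac ha, free_dirac ha, hexForm_rot]

/-- The primitive third root of unity `e^{2πi/3}`. -/
def cubeRoot : ℂ := Complex.exp (2 * Real.pi * Complex.I / 3)

theorem cubeRoot_eq : cubeRoot = -(1 / 2) + (√3 / 2 : ℝ) * Complex.I := by
  have h : (2 * Real.pi * Complex.I / 3 : ℂ) = ((Real.pi - Real.pi / 3 : ℝ) : ℂ) * Complex.I := by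
    push_cast; ring
  rw [cubeRoot, h, Complex.exp_mul_I, ← Complex.ofReal_cos, ← Complex.ofReal_sin,
    Real.cos_pi_sub, Real.sin_pi_sub, Real.cos_pi_div_three, Real.sin_pi_div_three]
  push_cast
  ring

theorem cubeRoot_sq_add : cubeRoot ^ 2 + cubeRoot + 1 = 0 := by
  have h3 : ((√3 : ℝ) : ℂ) ^ 2 = 3 := by
    exact_mod_cast Real.sq_sqrt (show (0 : ℝ) ≤ 3 by norm_num)
  rw [cubeRoot_eq]
  push_cast
  ring_nf
  rw [Complex.I_sq, h3]
  ring

theorem cubeRoot_ne_one : cubeRoot ≠ 1 := by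
  intro h
  have := cubeRoot_sq_add
  rw [h] at this
  norm_num at this

/-- Rotation changes `m₁ + m₂` by `-3m₂ - 1`. Hence the phase is not invariant but transforms by a
nontrivial character, which is the origin of the degeneracy. -/
theorem hexPhase_rot (m : ℤ × ℤ) : hexPhase (rot m) = cubeRoot * hexPhase m := by
  rw [hexPhase, hexPhase, cubeRoot, ← Complex.exp_add, Complex.exp_eq_exp_iff_exists_int]
  -- The exponent changes by `-4πm₂ - 4π/3 = 2π/3 + 2π(-2m₂ - 1)`.
  refine ⟨-2 * m.2 - 1, ?_⟩
  simp only [rot, Equiv.coe_fn_mk]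
  push_cast
  ring

theorem hexPhase_zero : hexPhase (0, 0) = 1 := by simp [hexPhase]

theorem hexPhase_rot_zero : hexPhase (rot (0, 0)) = cubeRoot := by
  rw [hexPhase_rot, hexPhase_zero, mul_one]

theorem hexPhase_rot_rot_zero : hexPhase (rot (rot (0, 0))) = cubeRoot ^ 2 := by
  rw [hexPhase_rot, hexPhase_rot_zero, sq]

theorem eq_zero_of_eq_cubeRoot_mul {S : ℂ} (h : S = cubeRoot * S) : S = 0 := by
  have h' : (1 - cubeRoot) * S = 0 := by rw [sub_mul, one_mul, ← h, sub_self]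
  exact (mul_eq_zero.1 h').resolve_left (sub_ne_zero.2 cubeRoot_ne_one.symm)

/-- Reindexing by the rotation gives `S = ωS` with `ω ≠ 1`. Pulling out `ω` needs no convergence, so
`F` is arbitrary. -/
theorem tsum_hexPhase_mul (ha : 0 < a) (F : ℝ → ℂ) :
    ∑' m, hexPhase m * F (free a (diracPoint a) m) = 0 := by
  apply eq_zero_of_eq_cubeRoot_mul
  conv_lhs => rw [← rot.tsum_eq]
  simp only [hexPhase_rot, free_dirac_rot ha, mul_assoc]
  rw [tsum_mul_left]

theorem inner_add_dirac (a : ℝ) (m : ℤ × ℤ) (d : Plane) :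
    inner ℝ (ξ a m + diracPoint a) d =
      ((m.1 : ℝ) + 2 / 3) * inner ℝ (k₁ a) d + ((m.2 : ℝ) + 1 / 3) * inner ℝ (k₂ a) d := by
  simp only [ξ, diracPoint, inner_add_left, inner_smul_left, RCLike.conj_to_real]
  ring

/-- Pairing with `k₁` would give `3m₁ = 2`. This selects the unrenormalized branch of `green`. -/
theorem x₀_not_mem_lattice (ha : 0 < a) : x₀ a ∉ lattice a := by
  rintro ⟨m, hm⟩
  have h := congrArg (fun v => inner ℝ (ξ a (1, 0)) v) hm
  simp only [inner_ξ ha, inner_ξ_x₀ ha] at h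
  have hp := Real.pi_pos
  push_cast at h
  have h1 : (3 * m.1 : ℝ) = 2 := by
    have : 2 * Real.pi * (3 * m.1 - 2 : ℝ) = 0 := by linarith
    have := (mul_eq_zero.1 this).resolve_left (by positivity)
    linarith
  have h2 : 3 * m.1 = 2 := by exact_mod_cast h1
  omega

theorem neg_x₀_not_mem_lattice (ha : 0 < a) : -x₀ a ∉ lattice a := by
  rintro ⟨m, hm⟩
  apply x₀_not_mem_lattice ha
  refine ⟨-m, ?_⟩
  simp only at hm
  simp only [Prod.fst_neg, Prod.snd_neg, Int.cast_neg, neg_smul]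
  rw [← neg_add, hm, neg_neg]

theorem zero_mem_lattice (a : ℝ) : (0 : Plane) ∈ lattice a := ⟨0, by simp⟩

end Phases

/-! ### Counting dual lattice points in discs -/

section Counting

variable {a : ℝ}

theorem finite_disc (ha : 0 < a) (k : Plane) (r : ℝ) : {m : ℤ × ℤ | ‖ξ a m + k‖ ≤ r}.Finite := by
  have h := (tendsto_weight ha).eventually
    (eventually_gt_atTop ((r + ‖diracPoint a - k‖) ^ 2 + 1))
  refine (Filter.eventually_cofinite.1 h).subset fun m hm => ?_
  simp only [Set.mem_ofPred_eq, not_lt] at hm ⊢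
  have h1 : ‖ξ a m + diracPoint a‖ ≤ r + ‖diracPoint a - k‖ := by
    have : ξ a m + diracPoint a = (ξ a m + k) + (diracPoint a - k) := by abel
    rw [this]
    exact (norm_add_le _ _).trans (by linarith)
  unfold weight free
  gcongr

/-- The labels of the dual lattice vectors with `|ξ_m + k| ≤ r`. -/
def disc (ha : 0 < a) (k : Plane) (r : ℝ) : Finset (ℤ × ℤ) := (finite_disc ha k r).toFinset

@[simp] theorem mem_disc (ha : 0 < a) (k : Plane) (r : ℝ) (m : ℤ × ℤ) :
    m ∈ disc ha k r ↔ ‖ξ a m + k‖ ≤ r := by simp [disc]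

theorem disc_mono (ha : 0 < a) (k : Plane) : Monotone (disc ha k) := fun r s h m hm => by
  rw [mem_disc] at hm ⊢; exact hm.trans h

theorem tendsto_disc (ha : 0 < a) (k : Plane) : Tendsto (disc ha k) atTop atTop :=
  tendsto_atTop_finset_of_monotone (disc_mono ha k) fun m => ⟨_, (mem_disc ha k _ m).2 le_rfl⟩

theorem tendsto_sum_disc (ha : 0 < a) (k : Plane) {f : ℤ × ℤ → ℂ} (hf : Summable f) :
    Tendsto (fun r => ∑ m ∈ disc ha k r, f m) atTop (𝓝 (∑' m, f m)) :=
  hf.hasSum.comp (tendsto_disc ha k)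

theorem volume_preimage_closedBall (ha : 0 < a) {ρ : ℝ} (hρ : 0 ≤ ρ) :
    volume ((basisK ha).equivFun.symm.toContinuousLinearEquiv ⁻¹' Metric.closedBall 0 ρ) =
      ENNReal.ofReal (Real.pi / areaDual a * ρ ^ 2) := by
  set L := (basisK ha).equivFun.symm.toContinuousLinearEquiv
  have h := map_basis_volume (basisK ha)
  simp only [basisK_zero, basisK_one] at h
  have hA : volume (parallelepiped ![k₁ a, k₂ a]) = ENNReal.ofReal (areaDual a) := by
    rw [areaDual, Measure.real, ENNReal.ofReal_toReal h.2.1]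
  have hp := areaDual_pos ha
  rw [← Measure.map_apply L.continuous.measurable Metric.isClosed_closedBall.measurableSet, h.2.2,
    Measure.smul_apply, EuclideanSpace.volume_closedBall_fin_two, hA, smul_eq_mul,
    ← ENNReal.ofReal_inv_of_pos hp, ← ENNReal.ofReal_pow hρ, ← ENNReal.ofReal_mul (by positivity),
    ← ENNReal.ofReal_mul (by positivity)]
  congr 1
  field_simp

/-- The unit cube with lower corner `m`. -/
def unitCube (m : ℤ × ℤ) : Set (Fin 2 → ℝ) :=
  Set.pi Set.univ fun i => Set.Ico (((![m.1, m.2] i : ℤ)) : ℝ) ((![m.1, m.2] i : ℤ) + 1)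

theorem mem_unitCube (m : ℤ × ℤ) (t : Fin 2 → ℝ) : t ∈ unitCube m ↔ m = (⌊t 0⌋, ⌊t 1⌋) := by
  simp only [unitCube, Set.mem_pi, Set.mem_univ, forall_true_left, Fin.forall_fin_two,
    Matrix.cons_val_zero, Matrix.cons_val_one, Set.mem_Ico, ← Int.floor_eq_iff, Prod.ext_iff]
  constructor <;> rintro ⟨h1, h2⟩ <;> exact ⟨h1.symm, h2.symm⟩

theorem volume_biUnion_unitCube (S : Finset (ℤ × ℤ)) :
    volume (⋃ m ∈ S, unitCube m) = (S.card : ENNReal) := by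
  rw [measure_biUnion_finset]
  · have h : ∀ m, volume (unitCube m) = 1 := fun m => by
      rw [unitCube, Real.volume_pi_Ico]
      simp
    simp [h]
  · intro m _ n _ hmn
    refine Set.disjoint_left.2 fun t ht ht' => hmn ?_
    rw [mem_unitCube] at ht ht'
    rw [ht, ht']
  · intro m _
    exact MeasurableSet.univ_pi fun i => measurableSet_Ico

theorem norm_coord_sub_floor_le (ha : 0 < a) (t : Fin 2 → ℝ) :
    ‖(basisK ha).equivFun.symm.toContinuousLinearEquiv t -
      (ξ a (⌊t 0⌋, ⌊t 1⌋) + diracPoint a)‖ ≤ ‖k₁ a‖ + ‖k₂ a‖ + ‖diracPoint a‖ := by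
  have h : (basisK ha).equivFun.symm.toContinuousLinearEquiv t -
      (ξ a (⌊t 0⌋, ⌊t 1⌋) + diracPoint a) =
      Int.fract (t 0) • k₁ a + Int.fract (t 1) • k₂ a - diracPoint a := by
    simp only [LinearEquiv.coe_toContinuousLinearEquiv', Module.Basis.equivFun_symm_apply,
      Fin.sum_univ_two, basisK_zero, basisK_one, ξ, Int.fract, sub_smul]
    abel
  rw [h]
  have key : ∀ (s : ℝ) (v : Plane), ‖Int.fract s • v‖ ≤ ‖v‖ := fun s v => by
    rw [norm_smul, Real.norm_of_nonneg (Int.fract_nonneg s)]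
    exact mul_le_of_le_one_left (norm_nonneg _) (Int.fract_lt_one s).le
  calc _ ≤ ‖Int.fract (t 0) • k₁ a + Int.fract (t 1) • k₂ a‖ + ‖diracPoint a‖ := norm_sub_le _ _
    _ ≤ _ := by
      gcongr
      exact (norm_add_le _ _).trans (add_le_add (key _ _) (key _ _))

/-- The number of dual lattice points in a disc is its area up to a boundary term. -/
theorem abs_card_disc_sub_le (ha : 0 < a) : ∃ D : ℝ, 0 < D ∧ ∀ r : ℝ, 0 ≤ r →
    |((disc ha (diracPoint a) r).card : ℝ) - Real.pi / areaDual a * r ^ 2| ≤ D * (r + 1) := by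
  set d := ‖k₁ a‖ + ‖k₂ a‖ + ‖diracPoint a‖ with hd
  set C := Real.pi / areaDual a with hC
  have hC0 : 0 < C := div_pos Real.pi_pos (areaDual_pos ha)
  have hd0 : 0 ≤ d := by positivity
  set L := (basisK ha).equivFun.symm.toContinuousLinearEquiv with hL
  refine ⟨C * (2 * d + d ^ 2) + 1, by positivity, fun r hr => ?_⟩
  set N := (disc ha (diracPoint a) r).card with hN
  have hmem : ∀ t, t ∈ (⋃ m ∈ disc ha (diracPoint a) r, unitCube m) ↔
      ‖ξ a (⌊t 0⌋, ⌊t 1⌋) + diracPoint a‖ ≤ r := fun t => by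
    simp only [Set.mem_iUnion, mem_unitCube, mem_disc, exists_prop]
    constructor
    · rintro ⟨m, h, rfl⟩; exact h
    · exact fun h => ⟨_, h, rfl⟩
  -- The unit cubes labelled by the disc have total volume `N`. Their images lie in the disc
  -- enlarged by `d`, and for `hlo` they cover the disc shrunk by `d`.
  have hup : (N : ℝ) ≤ C * (r + d) ^ 2 := by
    have h1 : (⋃ m ∈ disc ha (diracPoint a) r, unitCube m) ⊆
        L ⁻¹' Metric.closedBall 0 (r + d) := fun t ht => by
      rw [hmem] at ht
      rw [Set.mem_preimage, mem_closedBall_zero_iff]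
      have h2 := norm_coord_sub_floor_le ha t
      have h3 := norm_le_norm_add_norm_sub' (L t) (ξ a (⌊t 0⌋, ⌊t 1⌋) + diracPoint a)
      linarith
    have h2 := measure_mono (μ := volume) h1
    rw [volume_biUnion_unitCube, volume_preimage_closedBall ha (by positivity)] at h2
    have h3 := ENNReal.toReal_mono ENNReal.ofReal_ne_top h2
    rwa [ENNReal.toReal_natCast, ENNReal.toReal_ofReal (by positivity)] at h3
  have hlo : C * r ^ 2 - C * (2 * d) * r ≤ (N : ℝ) := by
    rcases le_or_gt d r with hdr | hdr
    · have h1 : L ⁻¹' Metric.closedBall 0 (r - d) ⊆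
          (⋃ m ∈ disc ha (diracPoint a) r, unitCube m) := fun t ht => by
        rw [hmem]
        rw [Set.mem_preimage, mem_closedBall_zero_iff] at ht
        have h2 := norm_coord_sub_floor_le ha t
        have h3 := norm_le_norm_add_norm_sub (L t) (ξ a (⌊t 0⌋, ⌊t 1⌋) + diracPoint a)
        linarith
      have h2 := measure_mono (μ := volume) h1
      rw [volume_biUnion_unitCube, volume_preimage_closedBall ha (by linarith)] at h2
      have h3 := ENNReal.toReal_mono (ENNReal.natCast_ne_top _) h2
      rw [ENNReal.toReal_natCast, ENNReal.toReal_ofReal (by positivity)] at h3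
      nlinarith [mul_nonneg hC0.le (sq_nonneg d)]
    -- For `r < d` there is no shrunken disc, but the claimed lower bound is then nonpositive.
    · have h1 : (0 : ℝ) ≤ N := Nat.cast_nonneg _
      have h2 : C * r ^ 2 ≤ C * d * r := by
        rw [sq, ← mul_assoc]; gcongr
      nlinarith [mul_nonneg (mul_nonneg hC0.le hd0) hr]
  have e1 : 0 ≤ C * d ^ 2 := by positivity
  have e2 : 0 ≤ C * d * r := by positivity
  have e3 : 0 ≤ C * d ^ 2 * r := by positivity
  have e4 : 0 ≤ C * d := by positivity
  rw [abs_le]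
  constructor <;> nlinarith

/-- The areas of the two discs differ by `O(r)`, as do the boundary errors. The annulus contains
every label on which discs of radius `r` about `k` and `K` disagree. -/
theorem exists_card_sub_card_le (ha : 0 < a) (k : Plane) : ∃ D : ℝ, ∀ r : ℝ,
    ‖k - diracPoint a‖ ≤ r →
    ((disc ha (diracPoint a) (r + ‖k - diracPoint a‖)).card : ℝ) -
      (disc ha (diracPoint a) (r - ‖k - diracPoint a‖)).card ≤ D * (r + 1) := by
  obtain ⟨D, hD, h⟩ := abs_card_disc_sub_le ha
  set δ := ‖k - diracPoint a‖
  have hδ : 0 ≤ δ := norm_nonneg _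
  set C := Real.pi / areaDual a with hC
  have hC0 : 0 < C := div_pos Real.pi_pos (areaDual_pos ha)
  refine ⟨4 * C * δ + 2 * D, fun r hr => ?_⟩
  have h1 := (abs_le.1 (h (r + δ) (by linarith))).2
  have h2 := (abs_le.1 (h (r - δ) (by linarith))).1
  nlinarith [mul_nonneg hC0.le hδ]

/-- Discs about different centres give the same limits for terms of order `|ξ_m|⁻²`. -/
theorem tendsto_sum_disc_sub (ha : 0 < a) (k : Plane) {f : ℤ × ℤ → ℂ} {B : ℝ}
    (hf : ∀ m, ‖f m‖ ≤ B / weight a m) :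
    Tendsto (fun r => ∑ m ∈ disc ha k r, f m - ∑ m ∈ disc ha (diracPoint a) r, f m) atTop
      (𝓝 0) := by
  classical
  obtain ⟨D, hD⟩ := exists_card_sub_card_le ha k
  set δ := ‖k - diracPoint a‖ with hδ'
  have hδ : 0 ≤ δ := norm_nonneg _
  set K := diracPoint a
  have hB : 0 ≤ B := by
    have := (norm_nonneg _).trans (hf 0)
    exact nonneg_of_mul_nonneg_left (by rwa [div_eq_mul_inv] at this)
      (inv_pos.2 (weight_pos a 0))
  have hdist : ∀ m, |‖ξ a m + k‖ - ‖ξ a m + K‖| ≤ δ := fun m => by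
    have := abs_norm_sub_norm_le (ξ a m + k) (ξ a m + K)
    rwa [show ξ a m + k - (ξ a m + K) = k - K by abel] at this
  -- There are `O(r)` disputed labels, each with a term `O(r⁻²)`.
  refine squeeze_zero_norm' (a := fun r => D * (r + 1) * (B / ((r - δ) ^ 2 + 1))) ?_ ?_
  · filter_upwards [eventually_ge_atTop δ] with r hr
    set P := disc ha K (r + δ) \ disc ha K (r - δ)
    have hP : (P.card : ℝ) ≤ D * (r + 1) := by
      rw [Finset.card_sdiff_of_subset (disc_mono ha K (by linarith)),
        Nat.cast_sub (Finset.card_le_card (disc_mono ha K (by linarith)))]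
      exact hD r hr
    have hterm : ∀ S : Finset (ℤ × ℤ), S ⊆ P → ‖∑ m ∈ S, f m‖ ≤
        S.card * (B / ((r - δ) ^ 2 + 1)) := fun S hS => by
      refine (norm_sum_le_of_le S (fun m hm => (hf m).trans ?_)).trans_eq
        (by rw [Finset.sum_const, nsmul_eq_mul])
      have hm' := hS hm
      simp only [P, Finset.mem_sdiff, mem_disc, not_le] at hm'
      unfold weight free
      have : 0 ≤ r - δ := by linarith
      gcongr
      exact hm'.2.le
    have e1 := Finset.sum_sdiff_sub_sum_sdiff (s₁ := disc ha K r) (s₂ := disc ha k r) (f := f)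
    rw [← e1]
    have s1 : disc ha k r \ disc ha K r ⊆ P := fun m hm => by
      simp only [P, Finset.mem_sdiff, mem_disc, not_le] at hm ⊢
      have := abs_le.1 (hdist m)
      constructor <;> linarith
    have s2 : disc ha K r \ disc ha k r ⊆ P := fun m hm => by
      simp only [P, Finset.mem_sdiff, mem_disc, not_le] at hm ⊢
      have := abs_le.1 (hdist m)
      constructor <;> linarith
    have hdis : Disjoint (disc ha k r \ disc ha K r) (disc ha K r \ disc ha k r) :=
      disjoint_sdiff_sdiff
    have hcard : ((disc ha k r \ disc ha K r).card : ℝ) + (disc ha K r \ disc ha k r).card ≤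
        P.card := by
      rw [← Nat.cast_add, ← Finset.card_union_of_disjoint hdis]
      exact_mod_cast Finset.card_le_card (Finset.union_subset s1 s2)
    refine (norm_sub_le _ _).trans ((add_le_add (hterm _ s1) (hterm _ s2)).trans ?_)
    rw [← add_mul]
    have : 0 ≤ B / ((r - δ) ^ 2 + 1) := by positivity
    gcongr
    exact hcard.trans hP
  · have h1 : Tendsto (fun r : ℝ => D * B * ((r + 1) / ((r - δ) ^ 2 + 1))) atTop
        (𝓝 (D * B * 0)) := by
      refine Tendsto.const_mul _ ?_
      have h2 : Tendsto (fun r : ℝ => (1 + (δ + 1)) * (r - δ)⁻¹) atTop (𝓝 ((1 + (δ + 1)) * 0)) :=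
        (tendsto_inv_atTop_zero.comp (tendsto_atTop_add_const_right _ (-δ) tendsto_id)).const_mul _
      rw [mul_zero] at h2
      refine squeeze_zero' ?_ ?_ h2
      · filter_upwards [eventually_ge_atTop 0] with r hr
        positivity
      · filter_upwards [eventually_ge_atTop (δ + 1)] with r hr
        have h3 : 1 ≤ r - δ := by linarith
        rw [div_le_iff₀ (by positivity), mul_assoc, inv_mul_eq_div]
        have h4 : r - δ ≤ ((r - δ) ^ 2 + 1) / (r - δ) := by
          rw [le_div_iff₀ (by linarith)]; nlinarith
        nlinarith
    rw [mul_zero] at h1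
    refine h1.congr fun r => by ring

end Counting

/-! ### The logarithmically renormalized lattice sum -/

section LogLimit

variable {a : ℝ}

theorem hasDerivAt_inv_sq_add_one (t : ℝ) :
    HasDerivAt (fun t : ℝ => -(t ^ 2 + 1)⁻¹) (2 * t / (t ^ 2 + 1) ^ 2) t := by
  have h := (((hasDerivAt_pow 2 t).add_const 1).inv (by positivity)).neg
  refine h.congr_deriv ?_
  field_simp
  push_cast
  ring

theorem continuous_kernel : Continuous fun t : ℝ => 2 * t / (t ^ 2 + 1) ^ 2 :=
  Continuous.div (by fun_prop) (by fun_prop) fun t => by positivity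

theorem integral_indicator_kernel {e r : ℝ} (he : 0 < e) (her : e ≤ r) :
    ∫ t in (0 : ℝ)..r, (Set.Ici e).indicator (fun t : ℝ => 2 * t / (t ^ 2 + 1) ^ 2) t =
      (e ^ 2 + 1)⁻¹ - (r ^ 2 + 1)⁻¹ := by
  have h0 : 0 ≤ r := he.le.trans her
  have hset : Set.Ioc 0 r ∩ Set.Ici e = Set.Icc e r := by
    ext t
    simp only [Set.mem_inter_iff, Set.mem_Ioc, Set.mem_Ici, Set.mem_Icc]
    constructor
    · exact fun h => ⟨h.2, h.1.2⟩
    · exact fun h => ⟨⟨he.trans_le h.1, h.2⟩, h.1⟩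
  rw [intervalIntegral.integral_of_le h0, MeasureTheory.setIntegral_indicator measurableSet_Ici,
    hset, integral_Icc_eq_integral_Ioc, ← intervalIntegral.integral_of_le her,
    intervalIntegral.integral_eq_sub_of_hasDerivAt (fun t _ => hasDerivAt_inv_sq_add_one t)
      (continuous_kernel.intervalIntegrable _ _)]
  ring

theorem integral_sq_mul_kernel (r : ℝ) :
    ∫ t in (0 : ℝ)..r, t ^ 2 * (2 * t / (t ^ 2 + 1) ^ 2) =
      Real.log (r ^ 2 + 1) + (r ^ 2 + 1)⁻¹ - 1 := by
  have hd : ∀ t : ℝ, HasDerivAt (fun t : ℝ => Real.log (t ^ 2 + 1) - -(t ^ 2 + 1)⁻¹)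
      (t ^ 2 * (2 * t / (t ^ 2 + 1) ^ 2)) t := fun t => by
    have h1 := ((hasDerivAt_pow 2 t).add_const 1).log (by positivity)
    have h2 := h1.sub (hasDerivAt_inv_sq_add_one t)
    have hp : t ^ 2 + 1 ≠ 0 := by positivity
    refine h2.congr_deriv ?_
    field_simp
    push_cast
    ring
  rw [intervalIntegral.integral_eq_sub_of_hasDerivAt (fun t _ => hd t)
    (((continuous_pow 2).mul continuous_kernel).intervalIntegrable _ _)]
  simp

/-- Abel summation: the kernel is minus the derivative of `(t² + 1)⁻¹`, and each label contributes
the integral of the kernel from its own radius up to `r`. -/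
theorem sum_disc_inv_weight (ha : 0 < a) {r : ℝ} (hr : 0 ≤ r) :
    ∑ m ∈ disc ha (diracPoint a) r, (weight a m)⁻¹ =
      (disc ha (diracPoint a) r).card * (r ^ 2 + 1)⁻¹ +
      ∫ t in (0 : ℝ)..r, ((disc ha (diracPoint a) t).card : ℝ) * (2 * t / (t ^ 2 + 1) ^ 2) := by
  have hint : ∀ m, IntervalIntegrable ((Set.Ici ‖ξ a m + diracPoint a‖).indicator
      (fun t : ℝ => 2 * t / (t ^ 2 + 1) ^ 2)) volume 0 r := fun m =>
    (intervalIntegrable_iff.2 ((intervalIntegrable_iff.1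
      (continuous_kernel.intervalIntegrable 0 r)).indicator measurableSet_Ici))
  have h1 : ∫ t in (0 : ℝ)..r, ((disc ha (diracPoint a) t).card : ℝ) * (2 * t / (t ^ 2 + 1) ^ 2) =
      ∫ t in (0 : ℝ)..r, ∑ m ∈ disc ha (diracPoint a) r,
        (Set.Ici ‖ξ a m + diracPoint a‖).indicator (fun t : ℝ => 2 * t / (t ^ 2 + 1) ^ 2) t := by
    refine intervalIntegral.integral_congr fun t ht => ?_
    rw [Set.uIcc_of_le hr] at ht
    simp only [Set.indicator_apply, Set.mem_Ici, ← Finset.sum_filter, Finset.sum_const,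
      nsmul_eq_mul]
    congr 3
    ext m
    simp only [mem_disc, Finset.mem_filter]
    exact ⟨fun h => ⟨h.trans ht.2, h⟩, fun h => h.2⟩
  rw [h1, intervalIntegral.integral_finsetSum fun m _ => hint m, ← nsmul_eq_mul, ← Finset.sum_const,
    ← Finset.sum_add_distrib]
  refine Finset.sum_congr rfl fun m hm => ?_
  rw [mem_disc] at hm
  have hpos : 0 < ‖ξ a m + diracPoint a‖ := by
    have h := groundEnergy_le_free ha m
    have h' := groundEnergy_pos ha
    unfold free at h
    by_contra hcon
    have : ‖ξ a m + diracPoint a‖ = 0 := le_antisymm (not_lt.1 hcon) (norm_nonneg _)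
    rw [this] at h
    norm_num at h
    linarith
  rw [integral_indicator_kernel hpos hm, weight, free]
  ring

/-- The logarithmically renormalized lattice sum converges. -/
theorem exists_tendsto_sum_disc_sub_log (ha : 0 < a) : ∃ γ : ℝ,
    Tendsto (fun r => ∑ m ∈ disc ha (diracPoint a) r, (weight a m)⁻¹ -
      2 * Real.pi / areaDual a * Real.log r) atTop (𝓝 γ) := by
  obtain ⟨D, hD, hN⟩ := abs_card_disc_sub_le ha
  set C := Real.pi / areaDual a with hC
  set N : ℝ → ℝ := fun t => ((disc ha (diracPoint a) t).card : ℝ) with hNdef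
  have hNm : Monotone N := fun s t h => by
    simp only [N]
    exact_mod_cast Finset.card_le_card (disc_mono ha _ h)
  -- The counting error is `O(t)` and the kernel `O(t⁻³)`, so `g` is integrable. The main term `C
  -- t²` integrates in closed form to the logarithm.
  set g : ℝ → ℝ := fun t => (N t - C * t ^ 2) * (2 * t / (t ^ 2 + 1) ^ 2) with hg
  have hgm : Measurable g :=
    (hNm.measurable.sub (by fun_prop)).mul continuous_kernel.measurable
  have hgi : IntegrableOn g (Set.Ioi 0) := by
    refine Integrable.mono' ((integrable_inv_one_add_sq.const_mul (4 * D)).integrableOn)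
      hgm.aestronglyMeasurable ?_
    filter_upwards [ae_restrict_mem measurableSet_Ioi] with t ht
    have ht0 : 0 < t := ht
    rw [Real.norm_eq_abs, abs_mul, abs_of_nonneg (show 0 ≤ 2 * t / (t ^ 2 + 1) ^ 2 by positivity)]
    calc _ ≤ D * (t + 1) * (2 * t / (t ^ 2 + 1) ^ 2) := by
          gcongr; exact hN t ht0.le
      _ ≤ 4 * D * (1 + t ^ 2)⁻¹ := by
          rw [mul_div_assoc', ← div_eq_mul_inv, div_le_div_iff₀ (by positivity) (by positivity)]
          have : 0 ≤ D * (t ^ 2 + 1) * (t - 1) ^ 2 := by positivity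
          nlinarith [mul_pos hD (pow_pos ht0 2), mul_pos hD (pow_pos ht0 4), hD]
  have hlim := intervalIntegral_tendsto_integral_Ioi 0 hgi tendsto_id
  -- Limits of, in order: the boundary term, the error integral, and the explicit integral after
  -- subtraction of `2C log r`.
  refine ⟨C + (∫ t in Set.Ioi 0, g t) + C * (0 + 0 - 1), ?_⟩
  have hinv : Tendsto (fun r : ℝ => (r ^ 2 + 1)⁻¹) atTop (𝓝 0) :=
    tendsto_inv_atTop_zero.comp
      (tendsto_atTop_add_const_right _ 1 (tendsto_pow_atTop (two_ne_zero)))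
  have hNlim : Tendsto (fun r => N r * (r ^ 2 + 1)⁻¹) atTop (𝓝 C) := by
    have h1 : Tendsto (fun r : ℝ => (N r - C * r ^ 2) * (r ^ 2 + 1)⁻¹) atTop (𝓝 0) := by
      have h2 : Tendsto (fun r : ℝ => 2 * D * r⁻¹) atTop (𝓝 (2 * D * 0)) :=
        tendsto_inv_atTop_zero.const_mul _
      rw [mul_zero] at h2
      refine squeeze_zero_norm' ?_ h2
      filter_upwards [eventually_ge_atTop 1] with r hr
      have hr0 : 0 < r := by linarith
      rw [Real.norm_eq_abs, abs_mul, abs_of_nonneg (show 0 ≤ (r ^ 2 + 1)⁻¹ by positivity)]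
      calc _ ≤ D * (r + 1) * (r ^ 2 + 1)⁻¹ := by gcongr; exact hN r (by linarith)
        _ ≤ 2 * D * r⁻¹ := by
          rw [← div_eq_mul_inv, ← div_eq_mul_inv, div_le_div_iff₀ (by positivity) hr0]
          nlinarith [mul_nonneg hD.le (mul_nonneg hr0.le (sub_nonneg.2 hr)), hD]
    have h3 : Tendsto (fun r : ℝ => C - C * (r ^ 2 + 1)⁻¹) atTop (𝓝 (C - C * 0)) :=
      (hinv.const_mul C).const_sub C
    have h4 := h1.add h3
    rw [mul_zero, sub_zero, zero_add] at h4
    refine h4.congr fun r => ?_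
    have : r ^ 2 + 1 ≠ 0 := by positivity
    field_simp
    ring
  have hlog : Tendsto (fun r : ℝ => Real.log (r ^ 2 + 1) - 2 * Real.log r) atTop (𝓝 0) := by
    have h1 : Tendsto (fun r : ℝ => Real.log (1 + (r⁻¹) ^ 2)) atTop (𝓝 (Real.log (1 + 0 ^ 2))) :=
      ((tendsto_inv_atTop_zero.pow 2).const_add 1).log (by norm_num)
    norm_num at h1
    refine h1.congr' ?_
    filter_upwards [eventually_gt_atTop 0] with r hr
    rw [show (2 : ℝ) * Real.log r = Real.log (r ^ 2) by rw [Real.log_pow]; norm_num,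
      ← Real.log_div (by positivity) (by positivity)]
    congr 1
    field_simp
  have hall := (hNlim.add hlim).add ((((hlog.add hinv).sub_const 1)).const_mul C)
  refine hall.congr' ?_
  filter_upwards [eventually_ge_atTop 0] with r hr
  have hi1 : IntervalIntegrable g volume 0 r :=
    (intervalIntegrable_iff_integrableOn_Ioc_of_le hr).2
      (hgi.mono_set Set.Ioc_subset_Ioi_self)
  have hi2 : IntervalIntegrable (fun t : ℝ => C * (t ^ 2 * (2 * t / (t ^ 2 + 1) ^ 2))) volume 0 r :=
    ((((continuous_pow 2).mul continuous_kernel).const_mul C).intervalIntegrable _ _)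
  rw [sum_disc_inv_weight ha hr]
  have hsplit : ∫ t in (0 : ℝ)..r, N t * (2 * t / (t ^ 2 + 1) ^ 2) =
      (∫ t in (0 : ℝ)..r, g t) + C * (Real.log (r ^ 2 + 1) + (r ^ 2 + 1)⁻¹ - 1) := by
    rw [← integral_sq_mul_kernel, ← intervalIntegral.integral_const_mul,
      ← intervalIntegral.integral_add hi1 hi2]
    refine intervalIntegral.integral_congr fun t _ => ?_
    simp only [g]
    ring
  simp only [N] at hsplit ⊢
  rw [hsplit, hC]
  simp only [id]
  ring

end LogLimit

/-! ### Absolutely convergent resolvent sums -/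

section ResolventSums

variable {a : ℝ}

/-- The denominators `|ξ_m + k|² - z`. -/
def den (a : ℝ) (k : Plane) (z : ℂ) (m : ℤ × ℤ) : ℂ := (free a k m : ℂ) - z

theorem norm_den_sub_le (a : ℝ) (k : Plane) (z z' : ℂ) (m : ℤ × ℤ) :
    ‖den a k z m - den a (diracPoint a) z' m‖ ≤
      (2 * ‖k - diracPoint a‖ + ‖k - diracPoint a‖ ^ 2 + ‖z - z'‖) * √(weight a m) := by
  have h1 : den a k z m - den a (diracPoint a) z' m =
      ((free a k m - free a (diracPoint a) m : ℝ) : ℂ) - (z - z') := by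
    unfold den; push_cast; ring
  rw [h1]
  refine (norm_sub_le _ _).trans ?_
  rw [Complex.norm_real, Real.norm_eq_abs, add_mul]
  exact add_le_add (abs_free_sub_dirac_le a k m)
    (le_mul_of_one_le_right (norm_nonneg _) (one_le_sqrt_weight a m))

theorem den_dirac_neg_one (a : ℝ) (m : ℤ × ℤ) : den a (diracPoint a) (-1) m = (weight a m : ℂ) := by
  unfold den weight; push_cast; ring

theorem norm_den_sub_weight_le (a : ℝ) (k : Plane) (z : ℂ) (m : ℤ × ℤ) :
    ‖den a k z m - (weight a m : ℂ)‖ ≤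
      (2 * ‖k - diracPoint a‖ + ‖k - diracPoint a‖ ^ 2 + ‖z + 1‖) * √(weight a m) := by
  have := norm_den_sub_le a k z (-1) m
  rwa [den_dirac_neg_one, sub_neg_eq_add] at this

theorem tendsto_sqrt_weight (ha : 0 < a) :
    Tendsto (fun m => √(weight a m)) cofinite atTop :=
  Real.tendsto_sqrt_atTop.comp (tendsto_weight ha)

/-- Far out the denominator differs from the weight by at most half of it; the finitely many
remaining labels are handled by a maximum of quotients. -/
theorem exists_mul_weight_le_norm_den (ha : 0 < a) {k : Plane} {z : ℂ}
    (h : ∀ m, den a k z m ≠ 0) : ∃ c : ℝ, 0 < c ∧ ∀ m, c * weight a m ≤ ‖den a k z m‖ := by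
  set C := 2 * ‖k - diracPoint a‖ + ‖k - diracPoint a‖ ^ 2 + ‖z + 1‖ with hC
  have hfin : {m | ¬ (2 * C < √(weight a m))}.Finite := Filter.eventually_cofinite.1
    ((tendsto_sqrt_weight ha).eventually (eventually_gt_atTop (2 * C)))
  obtain ⟨B, hB⟩ := (hfin.image fun m => weight a m / ‖den a k z m‖).bddAbove
  refine ⟨(max B 2)⁻¹, by positivity, fun m => ?_⟩
  have hw := weight_pos a m
  have hd : 0 < ‖den a k z m‖ := norm_pos_iff.2 (h m)
  rw [inv_mul_le_iff₀ (by positivity)]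
  by_cases hm : 2 * C < √(weight a m)
  · have h1 := norm_den_sub_weight_le a k z m
    rw [← hC] at h1
    have h2 := norm_le_norm_add_norm_sub' (weight a m : ℂ) (den a k z m)
    rw [norm_sub_rev, Complex.norm_real, Real.norm_of_nonneg hw.le] at h2
    have h3 : C * √(weight a m) ≤ weight a m / 2 := by
      nlinarith [one_le_sqrt_weight a m, sqrt_weight_mul_self a m]
    have h4 : weight a m ≤ 2 * ‖den a k z m‖ := by linarith
    exact h4.trans (mul_le_mul_of_nonneg_right (le_max_right _ _) hd.le)
  · have h1 := hB ⟨m, hm, rfl⟩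
    simp only at h1
    rw [div_le_iff₀ hd] at h1
    exact h1.trans (mul_le_mul_of_nonneg_right (le_max_left _ _) hd.le)

/-- Away from the free spectrum at the Dirac point, the denominators are bounded below uniformly
in a neighbourhood. -/
theorem eventually_mul_weight_le_norm_den (ha : 0 < a) {z₀ : ℂ}
    (h : ∀ m, den a (diracPoint a) z₀ m ≠ 0) : ∃ c : ℝ, 0 < c ∧
    ∀ᶠ p : Plane × ℂ in 𝓝 (diracPoint a, z₀), ∀ m, c * weight a m ≤ ‖den a p.1 p.2 m‖ := by
  obtain ⟨c, hc, h1⟩ := exists_mul_weight_le_norm_den ha h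
  refine ⟨c / 2, by positivity, ?_⟩
  have h2 : Tendsto (fun p : Plane × ℂ => 2 * ‖p.1 - diracPoint a‖ + ‖p.1 - diracPoint a‖ ^ 2 +
      ‖p.2 - z₀‖) (𝓝 (diracPoint a, z₀)) (𝓝 0) := by
    have : Continuous (fun p : Plane × ℂ => 2 * ‖p.1 - diracPoint a‖ + ‖p.1 - diracPoint a‖ ^ 2 +
      ‖p.2 - z₀‖) := by fun_prop
    have h := this.tendsto (diracPoint a, z₀)
    simpa using h
  filter_upwards [h2.eventually (gt_mem_nhds (show 0 < c / 2 by positivity))] with p hp m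
  have h3 := norm_den_sub_le a p.1 p.2 z₀ m
  have h4 := norm_le_norm_add_norm_sub' (den a (diracPoint a) z₀ m) (den a p.1 p.2 m)
  rw [norm_sub_rev] at h4
  have h5 := h1 m
  have h6 : √(weight a m) ≤ weight a m := by
    nlinarith [sqrt_weight_mul_self a m, one_le_sqrt_weight a m]
  have hw := weight_pos a m
  have h7 : (2 * ‖p.1 - diracPoint a‖ + ‖p.1 - diracPoint a‖ ^ 2 + ‖p.2 - z₀‖) * √(weight a m) ≤
      c / 2 * weight a m :=
    mul_le_mul hp.le h6 (Real.sqrt_nonneg _) (by positivity)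
  linarith

theorem den_ne_zero_of_le {k : Plane} {z : ℂ} {c : ℝ} (hc : 0 < c)
    (h : ∀ m, c * weight a m ≤ ‖den a k z m‖) (m : ℤ × ℤ) : den a k z m ≠ 0 :=
  norm_pos_iff.1 ((mul_pos hc (weight_pos a m)).trans_le (h m))

theorem den_ne_zero_of_im {k : Plane} {z : ℂ} (hz : z.im ≠ 0) (m : ℤ × ℤ) : den a k z m ≠ 0 := by
  intro h
  have := congrArg Complex.im h
  simp [den] at this
  exact hz this

/-- The absolutely convergent renormalized sums `∑ c_m ((|ξ_m + k|² - z)⁻¹ - w_m⁻¹)`. -/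
def latticeSum (a : ℝ) (c : ℤ × ℤ → ℂ) (k : Plane) (z : ℂ) : ℂ :=
  ∑' m, c m * ((den a k z m)⁻¹ - (weight a m : ℂ)⁻¹)

/-- With `p = √w`, an error of order `w^{1/2}` divided by two factors of order `w` leaves the
summable order `w^{-3/2}`. -/
theorem norm_inv_sub_inv_le {x y : ℂ} {c c' B w p : ℝ} (hw : 0 < w) (hp : 0 < p) (hpp : p * p = w)
    (hc : 0 < c) (hc' : 0 < c') (hx : c * w ≤ ‖x‖) (hy : c' * w ≤ ‖y‖) (hB : ‖x - y‖ ≤ B * p) :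
    ‖x⁻¹ - y⁻¹‖ ≤ B / (c * c') * (w * p)⁻¹ := by
  have hx0 : 0 < ‖x‖ := (mul_pos hc hw).trans_le hx
  have hy0 : 0 < ‖y‖ := (mul_pos hc' hw).trans_le hy
  have hB0 : 0 ≤ B := nonneg_of_mul_nonneg_left ((norm_nonneg _).trans hB) hp
  rw [inv_sub_inv (norm_pos_iff.1 hx0) (norm_pos_iff.1 hy0), norm_div, norm_mul, norm_sub_rev]
  calc ‖x - y‖ / (‖x‖ * ‖y‖) ≤ (B * p) / ((c * w) * (c' * w)) := by gcongr
    _ = B / (c * c') * (w * p)⁻¹ := by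
      rw [← hpp]; field_simp

theorem norm_inv_den_sub_inv_weight_le (a : ℝ) {k : Plane} {z : ℂ} {c : ℝ} (hc : 0 < c)
    (h : ∀ m, c * weight a m ≤ ‖den a k z m‖) (m : ℤ × ℤ) :
    ‖(den a k z m)⁻¹ - (weight a m : ℂ)⁻¹‖ ≤
      (2 * ‖k - diracPoint a‖ + ‖k - diracPoint a‖ ^ 2 + ‖z + 1‖) / (c * 1) *
        (weight a m * √(weight a m))⁻¹ := by
  refine norm_inv_sub_inv_le (weight_pos a m) (by linarith [one_le_sqrt_weight a m])
    (sqrt_weight_mul_self a m) hc one_pos (h m) ?_ (norm_den_sub_weight_le a k z m)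
  rw [Complex.norm_real, Real.norm_of_nonneg (weight_pos a m).le, one_mul]

theorem summable_latticeSum (ha : 0 < a) {c : ℤ × ℤ → ℂ} (hc : ∀ m, ‖c m‖ = 1) {k : Plane} {z : ℂ}
    (h : ∀ m, den a k z m ≠ 0) :
    Summable fun m => c m * ((den a k z m)⁻¹ - (weight a m : ℂ)⁻¹) := by
  obtain ⟨c₀, hc₀, h'⟩ := exists_mul_weight_le_norm_den ha h
  refine Summable.of_norm_bounded ((summable_weight ha).mul_left
    ((2 * ‖k - diracPoint a‖ + ‖k - diracPoint a‖ ^ 2 + ‖z + 1‖) / (c₀ * 1))) fun m => ?_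
  rw [norm_mul, hc, one_mul]
  exact norm_inv_den_sub_inv_weight_le a hc₀ h' m

theorem latticeSum_sub (ha : 0 < a) {c : ℤ × ℤ → ℂ} (hc : ∀ m, ‖c m‖ = 1) {k k' : Plane} {z z' : ℂ}
    (h : ∀ m, den a k z m ≠ 0) (h' : ∀ m, den a k' z' m ≠ 0) :
    Summable (fun m => c m * ((den a k z m)⁻¹ - (den a k' z' m)⁻¹)) ∧
    latticeSum a c k z - latticeSum a c k' z' =
      ∑' m, c m * ((den a k z m)⁻¹ - (den a k' z' m)⁻¹) := by
  have s1 := summable_latticeSum ha hc h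
  have s2 := summable_latticeSum ha hc h'
  have e : ∀ m, c m * ((den a k z m)⁻¹ - (weight a m : ℂ)⁻¹) -
      c m * ((den a k' z' m)⁻¹ - (weight a m : ℂ)⁻¹) =
      c m * ((den a k z m)⁻¹ - (den a k' z' m)⁻¹) := fun m => by ring
  refine ⟨(s1.sub s2).congr e, ?_⟩
  rw [latticeSum, latticeSum, ← s1.tsum_sub s2]
  exact tsum_congr e

/-- The resolvent identity; it exhibits the derivative in the energy. -/
theorem latticeSum_sub_same (ha : 0 < a) {c : ℤ × ℤ → ℂ} (hc : ∀ m, ‖c m‖ = 1) {k : Plane}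
    {z z' : ℂ} (h : ∀ m, den a k z m ≠ 0) (h' : ∀ m, den a k z' m ≠ 0) :
    latticeSum a c k z - latticeSum a c k z' =
      (z - z') * ∑' m, c m * (den a k z m * den a k z' m)⁻¹ := by
  rw [(latticeSum_sub ha hc h h').2, ← tsum_mul_left]
  refine tsum_congr fun m => ?_
  rw [inv_sub_inv (h m) (h' m), mul_inv, div_eq_mul_inv, mul_inv]
  unfold den
  ring

theorem summable_inv_den_mul_inv_den (ha : 0 < a) {c : ℤ × ℤ → ℂ} (hc : ∀ m, ‖c m‖ = 1)
    {k k' : Plane} {z z' : ℂ} (h : ∀ m, den a k z m ≠ 0) (h' : ∀ m, den a k' z' m ≠ 0) :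
    Summable fun m => c m * (den a k z m * den a k' z' m)⁻¹ := by
  obtain ⟨c₁, hc₁, h1⟩ := exists_mul_weight_le_norm_den ha h
  obtain ⟨c₂, hc₂, h2⟩ := exists_mul_weight_le_norm_den ha h'
  refine Summable.of_norm_bounded ((summable_inv_weight_sq ha).mul_left (c₁ * c₂)⁻¹) fun m => ?_
  have hw := weight_pos a m
  rw [norm_mul, hc, one_mul, norm_inv, norm_mul, ← mul_inv]
  refine inv_anti₀ (by positivity) ?_
  calc c₁ * c₂ * weight a m ^ 2 = (c₁ * weight a m) * (c₂ * weight a m) := by ring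
    _ ≤ _ := mul_le_mul (h1 m) (h2 m) (by positivity) (norm_nonneg _)

end ResolventSums

/-! ### Green functions as lattice sums -/

section Green

variable {a : ℝ}

/-- The constant term in the asymptotics of the logarithmically divergent lattice sum. -/
def logConst (ha : 0 < a) : ℝ := (exists_tendsto_sum_disc_sub_log ha).choose

theorem tendsto_logConst (ha : 0 < a) :
    Tendsto (fun r => ∑ m ∈ disc ha (diracPoint a) r, (weight a m)⁻¹ -
      2 * Real.pi / areaDual a * Real.log r) atTop (𝓝 (logConst ha)) :=
  (exists_tendsto_sum_disc_sub_log ha).choose_spec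

/-- Discs centred at `K` are invariant under the rotation. The reference part of the off-diagonal
Green function thus vanishes at every cutoff, and its conditional convergence needs no further
argument. -/
theorem sum_disc_hexPhase (ha : 0 < a) (r : ℝ) :
    ∑ m ∈ disc ha (diracPoint a) r, hexPhase m * (weight a m : ℂ)⁻¹ = 0 := by
  apply eq_zero_of_eq_cubeRoot_mul
  rw [Finset.mul_sum]
  have hinv : ∀ m, rot m ∈ disc ha (diracPoint a) r ↔ m ∈ disc ha (diracPoint a) r := fun m => by
    have h := free_dirac_rot ha m
    unfold free at h
    rw [mem_disc, mem_disc, (pow_left_inj₀ (norm_nonneg _) (norm_nonneg _) two_ne_zero).1 h]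
  symm
  refine Finset.sum_equiv rot (fun m => (hinv m).symm) fun m _ => ?_
  rw [hexPhase_rot, weight, weight, free_dirac_rot ha, mul_assoc]

theorem sum_disc_conj_hexPhase (ha : 0 < a) (r : ℝ) :
    ∑ m ∈ disc ha (diracPoint a) r, (starRingEnd ℂ) (hexPhase m) * (weight a m : ℂ)⁻¹ = 0 := by
  have h := congrArg (starRingEnd ℂ) (sum_disc_hexPhase ha r)
  simpa [map_sum] using h

/-- The terms split into the reference sum, moved to discs about `K`, and an absolutely convergent
rest. The subtraction `ψ` is the logarithm on the diagonal and zero off it. -/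
theorem tendsto_sum_disc_den (ha : 0 < a) {c : ℤ × ℤ → ℂ} (hc : ∀ m, ‖c m‖ = 1) {k : Plane} {z : ℂ}
    (h : ∀ m, den a k z m ≠ 0) {ψ : ℝ → ℂ} {L : ℂ}
    (hψ : Tendsto (fun r => ∑ m ∈ disc ha (diracPoint a) r, c m * (weight a m : ℂ)⁻¹ - ψ r)
      atTop (𝓝 L)) :
    Tendsto (fun r => ∑ m ∈ disc ha k r, c m * (den a k z m)⁻¹ - ψ r) atTop
      (𝓝 (L + latticeSum a c k z)) := by
  have h1 := tendsto_sum_disc ha k (summable_latticeSum ha hc h)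
  have h2 := tendsto_sum_disc_sub ha k (f := fun m => c m * (weight a m : ℂ)⁻¹) (B := 1)
    (fun m => by
      rw [norm_mul, hc, norm_inv, Complex.norm_real, Real.norm_of_nonneg (weight_pos a m).le,
        one_mul, one_div])
  have h3 := (hψ.add h1).add h2
  rw [add_zero] at h3
  refine h3.congr fun r => ?_
  simp only [mul_sub, Finset.sum_sub_distrib]
  ring

theorem finsum_disc (ha : 0 < a) (k : Plane) (r : ℝ) (f : ℤ × ℤ → ℂ) :
    ∑ᶠ m ∈ {m : ℤ × ℤ | ‖ξ a m + k‖ ≤ r}, f m = ∑ m ∈ disc ha k r, f m :=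
  finsum_mem_eq_finite_toFinset_sum f (finite_disc ha k r)

theorem green_zero (ha : 0 < a) {k : Plane} {z : ℂ} (h : ∀ m, den a k z m ≠ 0) :
    green a z 0 k = (areaCell a : ℂ)⁻¹ * (logConst ha + latticeSum a 1 k z) := by
  rw [green, if_pos (zero_mem_lattice a)]
  congr 1
  apply Tendsto.limUnder_eq
  have h1 := (Complex.continuous_ofReal.tendsto _).comp (tendsto_logConst ha)
  have h2 := tendsto_sum_disc_den (c := 1) ha (fun m => by simp) h
    (ψ := fun r => ((2 * Real.pi / areaDual a * Real.log r : ℝ) : ℂ)) (L := logConst ha)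
    (h1.congr fun r => by simp)
  refine h2.congr fun r => ?_
  rw [finsum_disc ha]
  simp [den, free]

theorem green_x₀ (ha : 0 < a) {k : Plane} {z : ℂ} (h : ∀ m, den a k z m ≠ 0) :
    green a z (x₀ a) k = (areaCell a : ℂ)⁻¹ * (blochPhase a k * latticeSum a hexPhase k z) := by
  rw [green, if_neg (x₀_not_mem_lattice ha)]
  congr 1
  apply Tendsto.limUnder_eq
  have h2 := tendsto_sum_disc_den (c := hexPhase) ha norm_hexPhase h
    (ψ := fun _ => 0) (L := 0) (by simp [sum_disc_hexPhase])
  have h3 := h2.const_mul (blochPhase a k)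
  rw [zero_add] at h3
  refine h3.congr fun r => ?_
  rw [finsum_disc ha, sub_zero, Finset.mul_sum]
  refine Finset.sum_congr rfl fun m _ => ?_
  rw [phase_x₀ ha, den, free, div_eq_mul_inv, mul_assoc]

theorem green_neg_x₀ (ha : 0 < a) {k : Plane} {z : ℂ} (h : ∀ m, den a k z m ≠ 0) :
    green a z (-x₀ a) k = (areaCell a : ℂ)⁻¹ * ((starRingEnd ℂ) (blochPhase a k) *
      latticeSum a (fun m => (starRingEnd ℂ) (hexPhase m)) k z) := by
  rw [green, if_neg (neg_x₀_not_mem_lattice ha)]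
  congr 1
  apply Tendsto.limUnder_eq
  have h2 := tendsto_sum_disc_den (c := fun m => (starRingEnd ℂ) (hexPhase m)) ha
    (fun m => by rw [RCLike.norm_conj, norm_hexPhase]) h
    (ψ := fun _ => 0) (L := 0) (by simp [sum_disc_conj_hexPhase])
  have h3 := h2.const_mul ((starRingEnd ℂ) (blochPhase a k))
  rw [zero_add] at h3
  refine h3.congr fun r => ?_
  rw [finsum_disc ha, sub_zero, Finset.mul_sum]
  refine Finset.sum_congr rfl fun m _ => ?_
  rw [phase_neg_x₀ ha, den, free, div_eq_mul_inv, mul_assoc]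

end Green

/-! ### Diagonal operators on `ℓ²` -/

section SequenceOperators

variable {ι : Type*}

/-- The Hilbert space `ℓ²(ι)`. -/
abbrev SeqSpace (ι : Type*) : Type _ := lp (fun _ : ι => ℂ) 2

theorem norm_apply_le (f : SeqSpace ι) (i : ι) : ‖f i‖ ≤ ‖f‖ :=
  lp.norm_apply_le_norm two_ne_zero f i

theorem memℓp_mul (f u : SeqSpace ι) : Memℓp (fun i => f i * u i) 2 := by
  refine Memℓp.mono' (lp.memℓp ((‖f‖ : ℂ) • u)) fun i => ?_
  rw [lp.coeFn_smul, Pi.smul_apply, norm_smul, norm_mul, Complex.norm_real, norm_norm]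
  exact mul_le_mul_of_nonneg_right (norm_apply_le f i) (norm_nonneg _)

/-- Pointwise multiplication `ℓ² × ℓ² → ℓ²`; as a function of the second argument this is the
diagonal operator with the first argument as its diagonal. -/
def seqMul : SeqSpace ι →L[ℂ] SeqSpace ι →L[ℂ] SeqSpace ι :=
  LinearMap.mkContinuous₂
    (LinearMap.mk₂ ℂ (fun f u => (⟨fun i => f i * u i, memℓp_mul f u⟩ : SeqSpace ι))
      (fun f g u => by ext i; exact add_mul _ _ _)
      (fun c f u => by ext i; simp [mul_assoc])
      (fun f u v => by ext i; exact mul_add _ _ _)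
      (fun c f u => by ext i; simp [mul_left_comm])) 1
    (fun f u => by
      rw [one_mul]
      have h : ‖(⟨fun i => f i * u i, memℓp_mul f u⟩ : SeqSpace ι)‖ ≤ ‖(‖f‖ : ℂ) • u‖ := by
        refine lp.norm_mono two_ne_zero fun i => ?_
        rw [lp.coeFn_smul, Pi.smul_apply, norm_smul, Complex.norm_real, norm_norm]
        simp only [norm_mul]
        exact mul_le_mul_of_nonneg_right (norm_apply_le f i) (norm_nonneg _)
      rw [norm_smul, Complex.norm_real, norm_norm] at h
      exact h)

@[simp] theorem seqMul_apply (f u : SeqSpace ι) (i : ι) : seqMul f u i = f i * u i := rfl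

theorem memℓp_unit_mul {c : ι → ℂ} (hc : ∀ i, ‖c i‖ = 1) (u : SeqSpace ι) :
    Memℓp (fun i => c i * u i) 2 :=
  Memℓp.mono' (lp.memℓp u) fun i => by rw [norm_mul, hc, one_mul]

/-- Multiplication of a sequence by unimodular factors. -/
def unitMul (c : ι → ℂ) (hc : ∀ i, ‖c i‖ = 1) : SeqSpace ι →L[ℂ] SeqSpace ι :=
  LinearMap.mkContinuous
    { toFun := fun u => (⟨fun i => c i * u i, memℓp_unit_mul hc u⟩ : SeqSpace ι)
      map_add' := fun u v => by ext i; exact mul_add _ _ _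
      map_smul' := fun r u => by ext i; simp [mul_left_comm] } 1
    (fun u => by
      rw [one_mul]
      exact lp.norm_mono two_ne_zero fun i => by simp [hc])

@[simp] theorem unitMul_apply {c : ι → ℂ} (hc : ∀ i, ‖c i‖ = 1) (u : SeqSpace ι) (i : ι) :
    unitMul c hc u i = c i * u i := rfl

theorem isCompactOperator_rankOne (x y : SeqSpace ι) :
    IsCompactOperator (InnerProductSpace.rankOne ℂ x y) := by
  rw [InnerProductSpace.rankOne_def']
  exact (isCompactOperator_of_locallyCompactSpace_rng
    (ContinuousLinearMap.toSpanSingleton ℂ x)).comp_clm (innerSL ℂ y)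

/-- A diagonal in `ℓ²` is the `ℓ²` limit of its finite truncations, and the operator depends
continuously on its diagonal. -/
theorem isCompactOperator_seqMul (f : SeqSpace ι) : IsCompactOperator (seqMul f) := by
  classical
  have h := (lp.hasSum_single ENNReal.ofNat_ne_top f).mapL (seqMul (ι := ι))
  refine isClosed_setOfPred_isCompactOperator.mem_of_tendsto h (Eventually.of_forall fun s => ?_)
  change (∑ i ∈ s, seqMul (lp.single 2 i (f i))) ∈
    compactOperator (RingHom.id ℂ) (SeqSpace ι) (SeqSpace ι)
  refine Submodule.sum_mem _ fun i _ => ?_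
  have e : seqMul (lp.single 2 i (f i)) =
      f i • InnerProductSpace.rankOne ℂ (lp.single 2 i (1 : ℂ)) (lp.single 2 i (1 : ℂ)) := by
    ext u j
    simp only [seqMul_apply, lp.coeFn_single, _root_.smul_apply, lp.coeFn_smul,
      Pi.smul_apply, InnerProductSpace.rankOne_apply, smul_eq_mul, lp.inner_single_left]
    by_cases hij : j = i
    · subst hij; simp
    · simp [Pi.single_eq_of_ne hij]
  rw [e]
  exact Submodule.smul_mem _ _ (isCompactOperator_rankOne _ _)

theorem not_finiteDimensional_seqSpace [Infinite ι] : ¬ FiniteDimensional ℂ (SeqSpace ι) := by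
  classical
  intro h
  have hli : LinearIndependent ℂ fun i : ι => (lp.single 2 i (1 : ℂ) : SeqSpace ι) := by
    refine Orthonormal.linearIndependent (orthonormal_iff_ite.2 fun i j => ?_)
    rw [lp.inner_single_left, lp.coeFn_single]
    by_cases hij : i = j
    · subst hij; simp
    · simp [hij]
  have := hli.finite
  exact not_finite ι

theorem hasSum_inner_seq (f u : SeqSpace ι) :
    HasSum (fun i => u i * (starRingEnd ℂ) (f i)) (inner ℂ f u) := lp.hasSum_inner f u

end SequenceOperators

/-! ### Rank-two perturbations of diagonal operators -/

section KreinOperator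

variable {ι : Type*}

/-- The diagonal operator with positive diagonal `ρ`, plus the rank-two perturbation of Krein's
formula with matrix `[[b, -ḡ], [-g, b]]`. -/
def kreinOp (U : SeqSpace ι →L[ℂ] SeqSpace ι) (ρ : SeqSpace ι) (b : ℝ) (g : ℂ) :
    SeqSpace ι →L[ℂ] SeqSpace ι :=
  seqMul ρ + ((b ^ 2 - ‖g‖ ^ 2 : ℝ) : ℂ)⁻¹ •
    ((b : ℂ) • InnerProductSpace.rankOne ℂ ρ ρ +
      (b : ℂ) • InnerProductSpace.rankOne ℂ (U ρ) (U ρ) +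
      (starRingEnd ℂ) g • InnerProductSpace.rankOne ℂ ρ (U ρ) +
      g • InnerProductSpace.rankOne ℂ (U ρ) ρ)

theorem tendsto_kreinOp {X : Type*} {l : Filter X} (U : SeqSpace ι →L[ℂ] SeqSpace ι)
    {ρ : X → SeqSpace ι} {b : X → ℝ} {g : X → ℂ} {ρ₀ : SeqSpace ι} {b₀ : ℝ} {g₀ : ℂ}
    (hρ : Tendsto ρ l (𝓝 ρ₀)) (hb : Tendsto b l (𝓝 b₀)) (hg : Tendsto g l (𝓝 g₀))
    (hd : b₀ ^ 2 - ‖g₀‖ ^ 2 ≠ 0) :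
    Tendsto (fun x => kreinOp U (ρ x) (b x) (g x)) l (𝓝 (kreinOp U ρ₀ b₀ g₀)) := by
  have hb' : Tendsto (fun x => (b x : ℂ)) l (𝓝 (b₀ : ℂ)) :=
    (Complex.continuous_ofReal.tendsto _).comp hb
  have hgc : Tendsto (fun x => (starRingEnd ℂ) (g x)) l (𝓝 ((starRingEnd ℂ) g₀)) :=
    (Complex.continuous_conj.tendsto _).comp hg
  have hUρ : Tendsto (fun x => U (ρ x)) l (𝓝 (U ρ₀)) := (U.continuous.tendsto _).comp hρ
  have hr : ∀ {x y : X → SeqSpace ι} {x₀ y₀ : SeqSpace ι}, Tendsto x l (𝓝 x₀) →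
      Tendsto y l (𝓝 y₀) → Tendsto (fun t => InnerProductSpace.rankOne ℂ (x t) (y t)) l
        (𝓝 (InnerProductSpace.rankOne ℂ x₀ y₀)) := fun hx hy =>
    ((isBoundedBilinearMap_apply (𝕜 := ℂ)).continuous.tendsto _).comp
      ((((ContinuousLinearMap.smulRightL ℂ (SeqSpace ι) (SeqSpace ι)).continuous.tendsto _).comp
        (((innerSL ℂ).continuous.tendsto _).comp hy)).prodMk_nhds hx)
  have hdet : Tendsto (fun x => ((b x ^ 2 - ‖g x‖ ^ 2 : ℝ) : ℂ)⁻¹) l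
      (𝓝 ((b₀ ^ 2 - ‖g₀‖ ^ 2 : ℝ) : ℂ)⁻¹) :=
    ((Complex.continuous_ofReal.tendsto _).comp ((hb.pow 2).sub (hg.norm.pow 2))).inv₀
      (by exact_mod_cast hd)
  exact ((seqMul.continuous.tendsto _).comp hρ).add (hdet.smul
    ((((hb'.smul (hr hρ hρ)).add (hb'.smul (hr hUρ hUρ))).add (hgc.smul (hr hρ hUρ))).add
      (hg.smul (hr hUρ hρ))))

theorem isCompactOperator_kreinOp (U : SeqSpace ι →L[ℂ] SeqSpace ι) (ρ : SeqSpace ι) (b : ℝ)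
    (g : ℂ) : IsCompactOperator (kreinOp U ρ b g) := by
  change kreinOp U ρ b g ∈ compactOperator (RingHom.id ℂ) (SeqSpace ι) (SeqSpace ι)
  have h := fun x y : SeqSpace ι => (show InnerProductSpace.rankOne ℂ x y ∈
    compactOperator (RingHom.id ℂ) (SeqSpace ι) (SeqSpace ι) from isCompactOperator_rankOne x y)
  exact Submodule.add_mem _ (isCompactOperator_seqMul ρ) (Submodule.smul_mem _ _
    (Submodule.add_mem _ (Submodule.add_mem _ (Submodule.add_mem _
      (Submodule.smul_mem _ _ (h _ _)) (Submodule.smul_mem _ _ (h _ _)))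
      (Submodule.smul_mem _ _ (h _ _))) (Submodule.smul_mem _ _ (h _ _))))

theorem inner_kreinOp (U : SeqSpace ι →L[ℂ] SeqSpace ι) (ρ : SeqSpace ι) (b : ℝ) (g : ℂ)
    (u v : SeqSpace ι) : inner ℂ u (kreinOp U ρ b g v) = inner ℂ u (seqMul ρ v) +
      ((b ^ 2 - ‖g‖ ^ 2 : ℝ) : ℂ)⁻¹ *
      (b * (inner ℂ ρ v * inner ℂ u ρ) + b * (inner ℂ (U ρ) v * inner ℂ u (U ρ)) +
        (starRingEnd ℂ) g * (inner ℂ (U ρ) v * inner ℂ u ρ) +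
        g * (inner ℂ ρ v * inner ℂ u (U ρ))) := by
  simp only [kreinOp, _root_.add_apply, _root_.smul_apply, inner_add_right,
    inner_smul_right, InnerProductSpace.rankOne_apply]

theorem isSymmetric_kreinOp (U : SeqSpace ι →L[ℂ] SeqSpace ι) {ρ : SeqSpace ι}
    (hρ : ∀ i, (starRingEnd ℂ) (ρ i) = ρ i) (b : ℝ) (g : ℂ) :
    (kreinOp U ρ b g : SeqSpace ι →ₗ[ℂ] SeqSpace ι).IsSymmetric := by
  intro u v
  simp only [ContinuousLinearMap.coe_coe]
  rw [← inner_conj_symm, inner_kreinOp, inner_kreinOp]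
  have h1 : (starRingEnd ℂ) (inner ℂ v (seqMul ρ u)) = inner ℂ u (seqMul ρ v) := by
    rw [inner_conj_symm, lp.inner_eq_tsum, lp.inner_eq_tsum]
    refine tsum_congr fun i => ?_
    simp only [seqMul_apply, RCLike.inner_apply, map_mul, hρ]
    ring
  simp only [map_add, map_mul, h1, map_inv₀, Complex.conj_ofReal, inner_conj_symm,
    Complex.conj_conj]
  ring

/-- `‖g‖ < b` says that the `2×2` matrix is positive definite; then so is its inverse, and the
perturbation is nonnegative. -/
theorem kreinOp_pos (U : SeqSpace ι →L[ℂ] SeqSpace ι) {ρ : SeqSpace ι} {r : ι → ℝ}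
    (hr : ∀ i, 0 < r i) (hρ : ∀ i, ρ i = r i) {b : ℝ} {g : ℂ} (hbg : ‖g‖ < b) {u : SeqSpace ι}
    (hu : u ≠ 0) : 0 < (inner ℂ u (kreinOp U ρ b g u)).re := by
  have hdet : 0 < b ^ 2 - ‖g‖ ^ 2 := by nlinarith [norm_nonneg g]
  rw [inner_kreinOp, Complex.add_re]
  have hs : HasSum (fun i => r i * ‖u i‖ ^ 2) (inner ℂ u (seqMul ρ u)).re := by
    have h := Complex.hasSum_re (hasSum_inner_seq u (seqMul ρ u))
    refine h.congr_fun fun i => ?_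
    rw [seqMul_apply, hρ, mul_assoc, Complex.mul_conj, Complex.normSq_eq_norm_sq,
      ← Complex.ofReal_mul, Complex.ofReal_re]
  have hpos : 0 < (inner ℂ u (seqMul ρ u)).re := by
    obtain ⟨i, hi⟩ : ∃ i, u i ≠ 0 := by
      by_contra hcon
      push Not at hcon
      exact hu (by ext i; exact hcon i)
    have h1 : 0 < r i * ‖u i‖ ^ 2 := mul_pos (hr i) (pow_pos (norm_pos_iff.2 hi) 2)
    exact h1.trans_le (le_hasSum hs i fun j _ => mul_nonneg (hr j).le (sq_nonneg _))
  refine add_pos_of_pos_of_nonneg hpos ?_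
  set p := inner ℂ ρ u
  set q := inner ℂ (U ρ) u
  have hp : inner ℂ u ρ = (starRingEnd ℂ) p := (inner_conj_symm _ _).symm
  have hq : inner ℂ u (U ρ) = (starRingEnd ℂ) q := (inner_conj_symm _ _).symm
  rw [hp, hq, ← Complex.ofReal_inv, Complex.re_ofReal_mul]
  refine mul_nonneg (inv_nonneg.2 hdet.le) ?_
  have e : ((b : ℂ) * (p * (starRingEnd ℂ) p) + b * (q * (starRingEnd ℂ) q) +
      (starRingEnd ℂ) g * (q * (starRingEnd ℂ) p) + g * (p * (starRingEnd ℂ) q)).re =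
      b * ‖p‖ ^ 2 + b * ‖q‖ ^ 2 + 2 * (g * (p * (starRingEnd ℂ) q)).re := by
    have h1 : (starRingEnd ℂ) g * (q * (starRingEnd ℂ) p) =
        (starRingEnd ℂ) (g * (p * (starRingEnd ℂ) q)) := by
      simp only [map_mul, Complex.conj_conj]; ring
    rw [h1, Complex.mul_conj, Complex.mul_conj, Complex.normSq_eq_norm_sq,
      Complex.normSq_eq_norm_sq]
    simp only [Complex.add_re, Complex.conj_re, ← Complex.ofReal_mul, Complex.ofReal_re]
    ring
  rw [e]
  have h2 : -(‖g‖ * (‖p‖ * ‖q‖)) ≤ (g * (p * (starRingEnd ℂ) q)).re := by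
    have := (abs_le.1 (Complex.abs_re_le_norm (g * (p * (starRingEnd ℂ) q)))).1
    rwa [norm_mul, norm_mul, RCLike.norm_conj] at this
  have h3 : ‖g‖ * (‖p‖ * ‖q‖) ≤ b * (‖p‖ * ‖q‖) := by gcongr
  have h4 : 0 ≤ b * (‖p‖ - ‖q‖) ^ 2 := mul_nonneg ((norm_nonneg g).trans hbg.le) (sq_nonneg _)
  nlinarith

/-- Eigenvectors of the Krein operator solve the secular system. -/
theorem eq_smul_kreinOp_iff {c : ι → ℂ} (hc : ∀ i, ‖c i‖ = 1) (ρ : SeqSpace ι) {b : ℝ} {g : ℂ}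
    (hbg : ‖g‖ < b) (t : ℂ) (u : SeqSpace ι) :
    u = t • kreinOp (unitMul c hc) ρ b g u ↔ ∃ Q₀ Q₁ : ℂ,
      (∀ i, u i = t * (ρ i * u i) + ρ i * (Q₀ + Q₁ * c i)) ∧
      b * Q₀ - (starRingEnd ℂ) g * Q₁ = t * inner ℂ ρ u ∧
      -g * Q₀ + b * Q₁ = t * inner ℂ (unitMul c hc ρ) u := by
  have hdet : 0 < b ^ 2 - ‖g‖ ^ 2 := by nlinarith [norm_nonneg g]
  have hdet' : ((b ^ 2 - ‖g‖ ^ 2 : ℝ) : ℂ) ≠ 0 := by exact_mod_cast hdet.ne'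
  have hgg : g * (starRingEnd ℂ) g = ((‖g‖ ^ 2 : ℝ) : ℂ) := by
    rw [Complex.mul_conj, Complex.normSq_eq_norm_sq]
  have hdetg : ((b ^ 2 - ‖g‖ ^ 2 : ℝ) : ℂ) = b ^ 2 - g * (starRingEnd ℂ) g := by
    rw [hgg]; push_cast; ring
  set p := inner ℂ ρ u
  set q := inner ℂ (unitMul c hc ρ) u
  have happ : ∀ i, (t • kreinOp (unitMul c hc) ρ b g u) i = t * (ρ i * u i) +
      ρ i * (t * (((b ^ 2 - ‖g‖ ^ 2 : ℝ) : ℂ)⁻¹ * (b * p + (starRingEnd ℂ) g * q)) +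
        t * (((b ^ 2 - ‖g‖ ^ 2 : ℝ) : ℂ)⁻¹ * (g * p + b * q)) * c i) := fun i => by
    simp only [kreinOp, _root_.add_apply, _root_.smul_apply,
      InnerProductSpace.rankOne_apply, lp.coeFn_smul, lp.coeFn_add, Pi.add_apply, Pi.smul_apply,
      smul_eq_mul, seqMul_apply, unitMul_apply]
    ring
  constructor
  · intro h
    -- Cramer's rule: the inverse matrix applied to `(t p, t q)`.
    refine ⟨t * (((b ^ 2 - ‖g‖ ^ 2 : ℝ) : ℂ)⁻¹ * (b * p + (starRingEnd ℂ) g * q)),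
      t * (((b ^ 2 - ‖g‖ ^ 2 : ℝ) : ℂ)⁻¹ * (g * p + b * q)), fun i => ?_, ?_, ?_⟩
    · rw [← happ, ← h]
    · rw [hdetg] at hdet' ⊢
      field_simp
      ring
    · rw [hdetg] at hdet' ⊢
      field_simp
      ring
  · rintro ⟨Q₀, Q₁, hi, h0, h1⟩
    have e0 : Q₀ = t * (((b ^ 2 - ‖g‖ ^ 2 : ℝ) : ℂ)⁻¹ * (b * p + (starRingEnd ℂ) g * q)) := by
      rw [hdetg] at hdet' ⊢
      field_simp
      linear_combination (b : ℂ) * h0 + (starRingEnd ℂ) g * h1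
    have e1 : Q₁ = t * (((b ^ 2 - ‖g‖ ^ 2 : ℝ) : ℂ)⁻¹ * (g * p + b * q)) := by
      rw [hdetg] at hdet' ⊢
      field_simp
      linear_combination g * h0 + (b : ℂ) * h1
    ext i
    rw [happ, ← e0, ← e1]
    exact hi i

end KreinOperator

/-! ### From Krein's formula to singular amplitudes -/

section BoundStates

variable {a : ℝ}

/-- The conjugate phases `e^{-i ξ_m·x₀}`. -/
def conjPhase (m : ℤ × ℤ) : ℂ := (starRingEnd ℂ) (hexPhase m)

theorem norm_conjPhase (m : ℤ × ℤ) : ‖conjPhase m‖ = 1 := by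
  rw [conjPhase, RCLike.norm_conj, norm_hexPhase]

theorem hexPhase_mul_conjPhase (m : ℤ × ℤ) : hexPhase m * conjPhase m = 1 := hexPhase_mul_conj m

theorem conjPhase_mul_hexPhase (m : ℤ × ℤ) : conjPhase m * hexPhase m = 1 := conj_mul_hexPhase m

theorem conj_latticeSum (a : ℝ) (c : ℤ × ℤ → ℂ) (k : Plane) (z : ℂ) :
    (starRingEnd ℂ) (latticeSum a c k z) =
      latticeSum a (fun m => (starRingEnd ℂ) (c m)) k ((starRingEnd ℂ) z) := by
  rw [latticeSum, latticeSum, Complex.conj_tsum]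
  refine tsum_congr fun m => ?_
  simp [den]

theorem latticeSum_conjPhase_ofReal (a : ℝ) (k : Plane) (μ : ℝ) :
    latticeSum a conjPhase k μ = (starRingEnd ℂ) (latticeSum a hexPhase k μ) := by
  rw [conj_latticeSum, Complex.conj_ofReal]
  rfl

/-- The effective coupling `α·area(Γ) - γ`. -/
def coupling (ha : 0 < a) (α : ℝ) : ℝ := α * areaCell a - logConst ha

/-- The singular amplitude `Q₀ + Q₁ e^{-i ξ_m·x₀}` of two point sources. -/
def amplitude (Q₀ Q₁ : ℂ) (m : ℤ × ℤ) : ℂ := Q₀ + Q₁ * conjPhase m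

/-- The phase takes different values at `m` and `rot m`, so two such values determine both
amplitudes. -/
theorem amplitude_eq_zero {Q₀ Q₁ : ℂ} {m : ℤ × ℤ} (h1 : amplitude Q₀ Q₁ m = 0)
    (h2 : amplitude Q₀ Q₁ (rot m) = 0) : Q₀ = 0 ∧ Q₁ = 0 := by
  have hc : (starRingEnd ℂ) cubeRoot ≠ 1 := fun h =>
    cubeRoot_ne_one (by simpa using congrArg (starRingEnd ℂ) h)
  have hm : conjPhase m ≠ 0 := norm_pos_iff.1 (by rw [norm_conjPhase]; exact one_pos)
  have e : conjPhase (rot m) = (starRingEnd ℂ) cubeRoot * conjPhase m := by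
    rw [conjPhase, hexPhase_rot, map_mul]; rfl
  rw [amplitude] at h1 h2
  rw [e] at h2
  have h3 : Q₁ * (conjPhase m * (1 - (starRingEnd ℂ) cubeRoot)) = 0 := by
    linear_combination h1 - h2
  have hQ1 : Q₁ = 0 := (mul_eq_zero.1 h3).resolve_right
    (mul_ne_zero hm (sub_ne_zero.2 hc.symm))
  rw [hQ1] at h1
  exact ⟨by simpa using h1, hQ1⟩

/-- A sequence of Fourier coefficients solves the eigenvalue equation, with singular amplitudes
`Q₀`, `Q₁` at the scatterers and the corresponding boundary conditions. -/
def IsBoundState (ha : 0 < a) (α : ℝ) (k : Plane) (μ : ℝ) (u : ℤ × ℤ → ℂ) (Q₀ Q₁ : ℂ) : Prop :=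
  (∀ m, ((free a k m : ℂ) - μ) * u m = amplitude Q₀ Q₁ m) ∧
  ∑' m, (u m - amplitude Q₀ Q₁ m * (weight a m : ℂ)⁻¹) = coupling ha α * Q₀ ∧
  ∑' m, hexPhase m * (u m - amplitude Q₀ Q₁ m * (weight a m : ℂ)⁻¹) = coupling ha α * Q₁

theorem memℓp_inv_den (ha : 0 < a) {k : Plane} {z : ℂ} (h : ∀ m, den a k z m ≠ 0) :
    Memℓp (fun m => (den a k z m)⁻¹) 2 := by
  obtain ⟨c, hc, h'⟩ := exists_mul_weight_le_norm_den ha h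
  refine memℓp_gen ?_
  refine Summable.of_nonneg_of_le (fun m => by positivity) (fun m => ?_)
    ((summable_inv_weight_sq ha).mul_left (c ^ 2)⁻¹)
  have hw := weight_pos a m
  rw [ENNReal.toReal_ofNat, Real.rpow_two, norm_inv, inv_pow, ← mul_inv, ← mul_pow]
  exact inv_anti₀ (by positivity) (pow_le_pow_left₀ (by positivity) (h' m) 2)

theorem summable_mul_mul_inv_den (ha : 0 < a) {k : Plane} {z : ℂ} (h : ∀ m, den a k z m ≠ 0)
    {c : ℤ × ℤ → ℂ} (hc : ∀ m, ‖c m‖ = 1) (u : SeqSpace (ℤ × ℤ)) :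
    Summable fun m => c m * (u m * (den a k z m)⁻¹) := by
  have h1 := lp.summable_inner (𝕜 := ℂ) (unitMul c hc u) (⟨_, memℓp_inv_den ha h⟩ : SeqSpace (ℤ × ℤ))
  refine Summable.of_norm (h1.norm.congr fun m => ?_)
  simp [hc, mul_comm]

/-- The boundary values of a solution of the eigenvalue equation, expressed at any resolvent
point. -/
theorem boundary_identity (ha : 0 < a) {k : Plane} {μ : ℝ} {z : ℂ} (h : ∀ m, den a k z m ≠ 0)
    {u : SeqSpace (ℤ × ℤ)} {Q₀ Q₁ : ℂ}
    (hu : ∀ m, ((free a k m : ℂ) - μ) * u m = amplitude Q₀ Q₁ m) :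
    ∑' m, (u m - amplitude Q₀ Q₁ m * (weight a m : ℂ)⁻¹) =
      (μ - z) * (∑' m, u m * (den a k z m)⁻¹) + latticeSum a 1 k z * Q₀ +
        latticeSum a conjPhase k z * Q₁ ∧
    ∑' m, hexPhase m * (u m - amplitude Q₀ Q₁ m * (weight a m : ℂ)⁻¹) =
      (μ - z) * (∑' m, hexPhase m * (u m * (den a k z m)⁻¹)) + latticeSum a hexPhase k z * Q₀ +
        latticeSum a 1 k z * Q₁ := by
  have s0 := summable_latticeSum ha (c := 1) (fun m => by simp) h
  have s1 := summable_latticeSum ha norm_hexPhase h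
  have s2 := summable_latticeSum ha norm_conjPhase h
  have t0 := summable_mul_mul_inv_den ha h (c := 1) (fun m => by simp) u
  have t1 := summable_mul_mul_inv_den ha h norm_hexPhase u
  simp only [Pi.one_apply, one_mul] at t0
  -- Since `free - μ = den - (μ - z)`, `u` is `(μ - z)u/den` plus `amplitude/den`. The first part is
  -- a product of `ℓ²` sequences, and the second is renormalized by the weight.
  have key : ∀ m, u m - amplitude Q₀ Q₁ m * (weight a m : ℂ)⁻¹ =
      (μ - z) * (u m * (den a k z m)⁻¹) +
        ((den a k z m)⁻¹ - (weight a m : ℂ)⁻¹) * amplitude Q₀ Q₁ m := fun m => by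
    rw [← hu m]
    have := h m
    have hd : (free a k m : ℂ) - μ = den a k z m - (μ - z) := by unfold den; ring
    rw [hd]
    field_simp
    ring
  constructor
  · rw [latticeSum, latticeSum, ← tsum_mul_left, ← tsum_mul_right, ← tsum_mul_right,
      ← (t0.mul_left _).tsum_add (s0.mul_right _),
      ← ((t0.mul_left _).add (s0.mul_right _)).tsum_add (s2.mul_right _)]
    refine tsum_congr fun m => ?_
    rw [key, amplitude, Pi.one_apply]
    ring
  · rw [latticeSum, latticeSum, ← tsum_mul_left, ← tsum_mul_right, ← tsum_mul_right,
      ← (t1.mul_left _).tsum_add (s1.mul_right _),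
      ← ((t1.mul_left _).add (s1.mul_right _)).tsum_add (s0.mul_right _)]
    refine tsum_congr fun m => ?_
    rw [key, amplitude, Pi.one_apply]
    linear_combination (Q₁ * ((den a k z m)⁻¹ - (weight a m : ℂ)⁻¹)) * hexPhase_mul_conjPhase m

/-- The quadratic form of the secular matrix. -/
theorem quadratic_form_identity (ha : 0 < a) {k : Plane} {z : ℂ} (h : ∀ m, den a k z m ≠ 0)
    (Q₀ Q₁ : ℂ) :
    HasSum (fun m => ((‖amplitude Q₀ Q₁ m‖ ^ 2 : ℝ) : ℂ) *
        ((den a k z m)⁻¹ - (weight a m : ℂ)⁻¹))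
      ((starRingEnd ℂ) Q₀ * (latticeSum a 1 k z * Q₀ + latticeSum a conjPhase k z * Q₁) +
      (starRingEnd ℂ) Q₁ * (latticeSum a hexPhase k z * Q₀ + latticeSum a 1 k z * Q₁)) := by
  have s0 := (summable_latticeSum ha (c := 1) (fun m => by simp) h).hasSum
  have s1 := (summable_latticeSum ha norm_hexPhase h).hasSum
  have s2 := (summable_latticeSum ha norm_conjPhase h).hasSum
  have h1 := (((s0.mul_right Q₀).add (s2.mul_right Q₁)).mul_left ((starRingEnd ℂ) Q₀)).add
    (((s1.mul_right Q₀).add (s0.mul_right Q₁)).mul_left ((starRingEnd ℂ) Q₁))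
  refine h1.congr_fun fun m => ?_
  have e : ((‖amplitude Q₀ Q₁ m‖ ^ 2 : ℝ) : ℂ) =
      amplitude Q₀ Q₁ m * (starRingEnd ℂ) (amplitude Q₀ Q₁ m) := by
    rw [Complex.mul_conj, Complex.normSq_eq_norm_sq]
  have e2 : (starRingEnd ℂ) (conjPhase m) = hexPhase m := by simp [conjPhase]
  rw [e]
  simp only [amplitude, map_add, map_mul, e2, Pi.one_apply]
  linear_combination (Q₁ * (starRingEnd ℂ) Q₁ * ((den a k z m)⁻¹ - (weight a m : ℂ)⁻¹)) *
    conjPhase_mul_hexPhase m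

/-- For a kernel vector `Q` the quadratic form is real, while its imaginary part is `Im z · ∑
|amplitude|²/|den|²`. All amplitudes then vanish, hence `Q = 0`. This makes the matrix inverse in
Krein's formula a genuine inverse. -/
theorem secular_det_ne_zero (ha : 0 < a) (α : ℝ) (k : Plane) {z : ℂ} (hz : z.im ≠ 0) :
    (coupling ha α - latticeSum a 1 k z) ^ 2 -
      latticeSum a hexPhase k z * latticeSum a conjPhase k z ≠ 0 := by
  intro hdet
  have h : ∀ m, den a k z m ≠ 0 := den_ne_zero_of_im hz
  set G0 := latticeSum a 1 k z
  set G1 := latticeSum a hexPhase k z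
  set G2 := latticeSum a conjPhase k z
  set B : ℂ := coupling ha α - G0 with hB
  have hM : Matrix.det !![B, -G2; -G1, B] = 0 := by
    rw [Matrix.det_fin_two_of]
    linear_combination hdet
  obtain ⟨Q, hQ0, hQ⟩ := Matrix.exists_mulVec_eq_zero_iff.2 hM
  have r0 : B * Q 0 - G2 * Q 1 = 0 := by
    have := congrFun hQ 0
    simp [Matrix.mulVec, dotProduct, Fin.sum_univ_two] at this
    linear_combination this
  have r1 : -G1 * Q 0 + B * Q 1 = 0 := by
    have := congrFun hQ 1
    simp [Matrix.mulVec, dotProduct, Fin.sum_univ_two] at this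
    linear_combination this
  have hq := quadratic_form_identity ha h (Q 0) (Q 1)
  have e : (starRingEnd ℂ) (Q 0) * (G0 * Q 0 + G2 * Q 1) +
      (starRingEnd ℂ) (Q 1) * (G1 * Q 0 + G0 * Q 1) =
      ((coupling ha α * (‖Q 0‖ ^ 2 + ‖Q 1‖ ^ 2) : ℝ) : ℂ) := by
    have e0 : (starRingEnd ℂ) (Q 0) * Q 0 = ((‖Q 0‖ ^ 2 : ℝ) : ℂ) := by
      rw [mul_comm, Complex.mul_conj, Complex.normSq_eq_norm_sq]
    have e1 : (starRingEnd ℂ) (Q 1) * Q 1 = ((‖Q 1‖ ^ 2 : ℝ) : ℂ) := by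
      rw [mul_comm, Complex.mul_conj, Complex.normSq_eq_norm_sq]
    rw [Complex.ofReal_mul, Complex.ofReal_add, ← e0, ← e1]
    linear_combination (-(starRingEnd ℂ) (Q 0)) * r0 - (starRingEnd ℂ) (Q 1) * r1
  rw [e] at hq
  have him := Complex.hasSum_im hq
  rw [Complex.ofReal_im] at him
  have hterm : ∀ m, (((‖amplitude (Q 0) (Q 1) m‖ ^ 2 : ℝ) : ℂ) *
      ((den a k z m)⁻¹ - (weight a m : ℂ)⁻¹)).im =
      z.im * (‖amplitude (Q 0) (Q 1) m‖ ^ 2 / ‖den a k z m‖ ^ 2) := fun m => by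
    rw [Complex.im_ofReal_mul, Complex.sub_im, Complex.inv_im, ← Complex.ofReal_inv,
      Complex.ofReal_im, Complex.normSq_eq_norm_sq]
    simp only [den, Complex.sub_im, Complex.ofReal_im]
    ring
  simp only [hterm] at him
  have him2 := him.mul_left (z.im)⁻¹
  simp only [← mul_assoc, inv_mul_cancel₀ hz, one_mul, mul_zero] at him2
  have hz0 := (hasSum_zero_iff_of_nonneg (fun m => by positivity)).1 him2
  have hT : ∀ m, amplitude (Q 0) (Q 1) m = 0 := fun m => by
    have h1 := congrFun hz0 m
    have h2 : ‖den a k z m‖ ^ 2 ≠ 0 := pow_ne_zero 2 (norm_ne_zero_iff.2 (h m))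
    simp only [Pi.zero_apply] at h1
    rcases div_eq_zero_iff.1 h1 with h3 | h3
    · exact norm_eq_zero.1 (pow_eq_zero_iff two_ne_zero |>.1 h3)
    · exact absurd h3 h2
  obtain ⟨q0, q1⟩ := amplitude_eq_zero (hT 0) (hT _)
  exact hQ0 (by ext i; fin_cases i <;> simp [q0, q1])

/-- The Bloch phases enter only as conjugation by a unitary diagonal matrix, which is later absorbed
into `Q₁`. -/
theorem gammaMatrix_eq (ha : 0 < a) (α : ℝ) {k : Plane} {z : ℂ} (h : ∀ m, den a k z m ≠ 0) :
    gammaMatrix a α z k = (areaCell a : ℂ)⁻¹ •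
      !![coupling ha α - latticeSum a 1 k z, -(blochPhase a k * latticeSum a hexPhase k z);
        -((starRingEnd ℂ) (blochPhase a k) * latticeSum a conjPhase k z),
        coupling ha α - latticeSum a 1 k z] := by
  have hA : (areaCell a : ℂ) ≠ 0 := by exact_mod_cast (areaCell_pos ha).ne'
  have h1 := green_zero ha h
  have h2 := green_x₀ ha h
  have h3 : green a z (-x₀ a) k = (areaCell a : ℂ)⁻¹ *
      ((starRingEnd ℂ) (blochPhase a k) * latticeSum a conjPhase k z) := green_neg_x₀ ha h
  ext i j
  fin_cases i <;> fin_cases j <;>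
    simp [gammaMatrix, scatterer, h1, h2, h3, coupling] <;> (try field_simp) <;> ring

theorem isUnit_det_gammaMatrix (ha : 0 < a) (α : ℝ) (k : Plane) {z : ℂ} (hz : z.im ≠ 0) :
    IsUnit (gammaMatrix a α z k).det := by
  have hA : (areaCell a : ℂ) ≠ 0 := by exact_mod_cast (areaCell_pos ha).ne'
  rw [gammaMatrix_eq ha α (den_ne_zero_of_im hz), Matrix.det_smul, Matrix.det_fin_two_of,
    isUnit_iff_ne_zero]
  refine mul_ne_zero (pow_ne_zero _ (inv_ne_zero hA)) ?_
  have := secular_det_ne_zero ha α k hz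
  intro h
  apply this
  linear_combination h + (latticeSum a hexPhase k z * latticeSum a conjPhase k z) *
    blochPhase_mul_conj a k

theorem coeff_sub_smul (a : ℝ) (k : Plane) (m : ℤ × ℤ) (x y : ℂ) (u : L2Cell a) :
    coeff a k m (x • u - y • u) = (x - y) * coeff a k m u := by
  simp only [coeff, inner_sub_right, inner_smul_right]
  ring

/-- Multiplied by its denominator, the resolvent equation at `z` is the bound state equation with
amplitudes `w Γ⁻¹`, and inverting `Γ` yields the boundary conditions. By `boundary_identity` these
do not depend on `z`, so one non-real energy implies all others. -/
theorem mem_eigenspace_iff (ha : 0 < a) (α : ℝ) (k : Plane) (μ : ℝ) (u : L2Cell a) :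
    u ∈ eigenspace a α k μ ↔ ∃ Q₀ Q₁, IsBoundState ha α k μ (coeffEquiv ha k u) Q₀ Q₁ := by
  have hA : (areaCell a : ℂ) ≠ 0 := by exact_mod_cast (areaCell_pos ha).ne'
  have hmem : u ∈ eigenspace a α k μ ↔
      ∀ z : ℂ, z.im ≠ 0 → IsResolvent a α k z ((μ : ℂ) • u - z • u) u := Iff.rfl
  rw [hmem]
  set b := blochPhase a k with hb
  have hbb : b * (starRingEnd ℂ) b = 1 := blochPhase_mul_conj a k
  have hsum : ∀ z : ℂ, z.im ≠ 0 →
      HasSum (fun m => phase a k m (scatterer a 0) / (((‖ξ a m + k‖ ^ 2 : ℝ) : ℂ) - z) *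
        coeff a k m ((μ : ℂ) • u - z • u))
        ((μ - z) * ∑' m, coeffEquiv ha k u m * (den a k z m)⁻¹) ∧
      HasSum (fun m => phase a k m (scatterer a 1) / (((‖ξ a m + k‖ ^ 2 : ℝ) : ℂ) - z) *
        coeff a k m ((μ : ℂ) • u - z • u))
        (b * ((μ - z) * ∑' m, hexPhase m * (coeffEquiv ha k u m * (den a k z m)⁻¹))) := by
    intro z hz
    have t0 := summable_mul_mul_inv_den ha (den_ne_zero_of_im (k := k) (a := a) hz) (c := 1)
      (fun m => by simp) (coeffEquiv ha k u)
    have t1 := summable_mul_mul_inv_den ha (den_ne_zero_of_im (k := k) (a := a) hz) norm_hexPhase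
      (coeffEquiv ha k u)
    simp only [Pi.one_apply, one_mul] at t0
    constructor
    · refine (t0.hasSum.mul_left (μ - z)).congr_fun fun m => ?_
      rw [coeff_sub_smul, coeffEquiv_apply]
      simp only [scatterer, Matrix.cons_val_zero, phase_zero, den, free]
      ring
    · refine ((t1.hasSum.mul_left (μ - z)).mul_left b).congr_fun fun m => ?_
      rw [coeff_sub_smul, coeffEquiv_apply]
      have hs : scatterer a 1 = x₀ a := rfl
      rw [hs, phase_x₀ ha]
      simp only [den, free, hb]
      ring
  constructor
  · intro hres
    have step : ∀ z : ℂ, z.im ≠ 0 → ∃ Q₀ Q₁ : ℂ,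
        (∀ m, ((free a k m : ℂ) - μ) * coeffEquiv ha k u m = amplitude Q₀ Q₁ m) ∧
        (μ - z) * (∑' m, coeffEquiv ha k u m * (den a k z m)⁻¹) =
          (coupling ha α - latticeSum a 1 k z) * Q₀ - latticeSum a conjPhase k z * Q₁ ∧
        (μ - z) * (∑' m, hexPhase m * (coeffEquiv ha k u m * (den a k z m)⁻¹)) =
          -latticeSum a hexPhase k z * Q₀ + (coupling ha α - latticeSum a 1 k z) * Q₁ := by
      intro z hz
      obtain ⟨w, hw, hcoef⟩ := hres z hz
      have hw0 := (hw 0).unique (hsum z hz).1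
      have hw1 := (hw 1).unique (hsum z hz).2
      set q := Matrix.vecMul w (gammaMatrix a α z k)⁻¹ with hq
      have hqw : Matrix.vecMul q (gammaMatrix a α z k) = w := by
        rw [hq, Matrix.vecMul_vecMul, Matrix.nonsing_inv_mul _ (isUnit_det_gammaMatrix ha α k hz),
          Matrix.vecMul_one]
      have hq' : ∀ j', q j' = w 0 * (gammaMatrix a α z k)⁻¹ 0 j' +
          w 1 * (gammaMatrix a α z k)⁻¹ 1 j' := fun j' => by
        simp [hq, Matrix.vecMul, dotProduct, Fin.sum_univ_two]
      have e0 := congrFun hqw 0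
      have e1 := congrFun hqw 1
      rw [gammaMatrix_eq ha α (den_ne_zero_of_im hz)] at e0 e1
      simp [Matrix.vecMul, dotProduct, Fin.sum_univ_two] at e0 e1
      -- The plane wave at `-x₀` carries the conjugate Bloch phase; `amplitude` contains only the
      -- lattice phase.
      refine ⟨(areaCell a : ℂ)⁻¹ * q 0, (areaCell a : ℂ)⁻¹ * (q 1 * (starRingEnd ℂ) b),
        fun m => ?_, ?_, ?_⟩
      · have hm := hcoef m
        have hd := den_ne_zero_of_im (k := k) (a := a) hz m
        rw [coeff_sub_smul] at hm
        rw [coeffEquiv_apply]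
        have hd' : (((‖ξ a m + k‖ ^ 2 : ℝ) : ℂ) - z) = den a k z m := rfl
        simp only [Fin.sum_univ_two, scatterer, Matrix.cons_val_zero, Matrix.cons_val_one,
          neg_zero, phase_zero, phase_neg_x₀ ha, hd'] at hm
        have hm2 : den a k z m * coeff a k m u = (μ - z) * coeff a k m u +
            (areaCell a : ℂ)⁻¹ * (q 0 + q 1 * ((starRingEnd ℂ) b * conjPhase m)) := by
          conv_lhs => rw [hm]
          rw [hq', hq', conjPhase]
          field_simp
          ring
        have hd2 : (free a k m : ℂ) - μ = den a k z m - (μ - z) := by unfold den; ring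
        rw [hd2, sub_mul, hm2, amplitude]
        ring
      · rw [← hw0, ← e0]
        ring
      · have hbne : b ≠ 0 := fun h0 => by rw [h0, zero_mul] at hbb; exact zero_ne_one hbb
        apply mul_left_cancel₀ hbne
        rw [← hw1, ← e1]
        linear_combination (-(areaCell a : ℂ)⁻¹ * (coupling ha α - latticeSum a 1 k z) * q 1) * hbb
    -- Any non-real energy would do.
    obtain ⟨Q₀, Q₁, hT, h0, h1⟩ := step Complex.I (by simp)
    refine ⟨Q₀, Q₁, hT, ?_, ?_⟩
    · rw [(boundary_identity ha (z := Complex.I) (den_ne_zero_of_im (by simp)) hT).1, h0]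
      ring
    · rw [(boundary_identity ha (z := Complex.I) (den_ne_zero_of_im (by simp)) hT).2, h1]
      ring
  · rintro ⟨Q₀, Q₁, hT, h0, h1⟩ z hz
    have hbi := boundary_identity ha (k := k) (z := z) (den_ne_zero_of_im hz) hT
    rw [h0, h1] at hbi
    obtain ⟨hb0, hb1⟩ := hbi
    set q : Fin 2 → ℂ := ![areaCell a * Q₀, areaCell a * (b * Q₁)] with hq
    set w := Matrix.vecMul q (gammaMatrix a α z k) with hw
    have hwq : Matrix.vecMul w (gammaMatrix a α z k)⁻¹ = q := by
      rw [hw, Matrix.vecMul_vecMul, Matrix.mul_nonsing_inv _ (isUnit_det_gammaMatrix ha α k hz),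
        Matrix.vecMul_one]
    have hq' : ∀ j', w 0 * (gammaMatrix a α z k)⁻¹ 0 j' +
          w 1 * (gammaMatrix a α z k)⁻¹ 1 j' = q j' := fun j' => by
        rw [← hwq]; simp [Matrix.vecMul, dotProduct, Fin.sum_univ_two]
    have ew0 : w 0 = (μ - z) * ∑' m, coeffEquiv ha k u m * (den a k z m)⁻¹ := by
      rw [hw, gammaMatrix_eq ha α (den_ne_zero_of_im hz)]
      simp [Matrix.vecMul, dotProduct, Fin.sum_univ_two, hq]
      generalize (∑' m, coeffEquiv ha k u m * (den a k z m)⁻¹) = S at hb0 ⊢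
      field_simp
      linear_combination hb0 - latticeSum a conjPhase k z * Q₁ * hbb
    have ew1 : w 1 = b * ((μ - z) * ∑' m, hexPhase m * (coeffEquiv ha k u m *
        (den a k z m)⁻¹)) := by
      rw [hw, gammaMatrix_eq ha α (den_ne_zero_of_im hz)]
      simp [Matrix.vecMul, dotProduct, Fin.sum_univ_two, hq]
      generalize (∑' m, hexPhase m * (coeffEquiv ha k u m * (den a k z m)⁻¹)) = S at hb1 ⊢
      field_simp
      linear_combination b * hb1
    refine ⟨w, fun j => ?_, fun m => ?_⟩
    · fin_cases j
      · have := (hsum z hz).1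
        rw [← ew0] at this
        exact this
      · have := (hsum z hz).2
        rw [← ew1] at this
        exact this
    · have hd := den_ne_zero_of_im (k := k) (a := a) hz m
      have hd' : (((‖ξ a m + k‖ ^ 2 : ℝ) : ℂ) - z) = den a k z m := rfl
      have hTm := hT m
      rw [coeffEquiv_apply] at hTm
      rw [coeff_sub_smul]
      simp only [Fin.sum_univ_two, scatterer, Matrix.cons_val_zero, Matrix.cons_val_one,
          neg_zero, phase_zero, phase_neg_x₀ ha, hd']
      have e0 := hq' 0
      have e1 := hq' 1
      simp only [hq, Matrix.cons_val_zero, Matrix.cons_val_one] at e0 e1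
      have hd2 : (free a k m : ℂ) - μ = den a k z m - (μ - z) := by unfold den; ring
      rw [hd2, amplitude, conjPhase] at hTm
      field_simp
      linear_combination (areaCell a : ℂ) * hTm - e0 -
        (starRingEnd ℂ) b * (starRingEnd ℂ) (hexPhase m) * e1 -
        (areaCell a : ℂ) * Q₁ * (starRingEnd ℂ) (hexPhase m) * hbb

end BoundStates

/-! ### Eigenvalue sequences and their continuity at the Dirac point -/

section EigenvalueSequences

variable {a : ℝ}

theorem den_neg_ofReal (a : ℝ) (k : Plane) (s : ℝ) (m : ℤ × ℤ) :
    den a k ((-s : ℝ) : ℂ) m = ((free a k m + s : ℝ) : ℂ) := by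
  unfold den; push_cast; ring

theorem den_neg_ne_zero {s : ℝ} (hs : 0 < s) (k : Plane) (m : ℤ × ℤ) :
    den a k ((-s : ℝ) : ℂ) m ≠ 0 := by
  rw [den_neg_ofReal]
  exact_mod_cast (add_pos_of_nonneg_of_pos (free_nonneg a k m) hs).ne'

/-- The sequence `(|ξ_m + k|² + s)⁻¹`. -/
def resolventSeq (ha : 0 < a) {s : ℝ} (hs : 0 < s) (k : Plane) : SeqSpace (ℤ × ℤ) :=
  ⟨_, memℓp_inv_den ha (den_neg_ne_zero hs k)⟩

theorem resolventSeq_apply (ha : 0 < a) {s : ℝ} (hs : 0 < s) (k : Plane) (m : ℤ × ℤ) :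
    resolventSeq ha hs k m = (den a k ((-s : ℝ) : ℂ) m)⁻¹ := rfl

theorem resolventSeq_apply' (ha : 0 < a) {s : ℝ} (hs : 0 < s) (k : Plane) (m : ℤ × ℤ) :
    resolventSeq ha hs k m = (((free a k m + s)⁻¹ : ℝ) : ℂ) := by
  rw [resolventSeq_apply, den_neg_ofReal, Complex.ofReal_inv]

theorem conj_resolventSeq (ha : 0 < a) {s : ℝ} (hs : 0 < s) (k : Plane) (m : ℤ × ℤ) :
    (starRingEnd ℂ) (resolventSeq ha hs k m) = resolventSeq ha hs k m := by
  rw [resolventSeq_apply', Complex.conj_ofReal]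

/-- The diagonal part of the secular function, at real energies. -/
def diagSum (a : ℝ) (k : Plane) (μ : ℝ) : ℝ :=
  ∑' m, ((free a k m - μ)⁻¹ - (weight a m)⁻¹)

theorem latticeSum_one_ofReal (a : ℝ) (k : Plane) (μ : ℝ) :
    latticeSum a 1 k μ = (diagSum a k μ : ℂ) := by
  rw [latticeSum, diagSum, Complex.ofReal_tsum]
  refine tsum_congr fun m => ?_
  rw [Pi.one_apply, one_mul, den]
  push_cast
  rfl

/-- The resolvent at `-s`, in Fourier coefficients. -/
def resolventOp (ha : 0 < a) (α : ℝ) {s : ℝ} (hs : 0 < s) (k : Plane) :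
    SeqSpace (ℤ × ℤ) →L[ℂ] SeqSpace (ℤ × ℤ) :=
  kreinOp (unitMul conjPhase norm_conjPhase) (resolventSeq ha hs k)
    (coupling ha α - diagSum a k (-s)) (latticeSum a hexPhase k ((-s : ℝ) : ℂ))

/-- The energy `-s` lies below the spectrum. -/
def IsBelow (ha : 0 < a) (α s : ℝ) (k : Plane) : Prop :=
  ‖latticeSum a hexPhase k ((-s : ℝ) : ℂ)‖ < coupling ha α - diagSum a k (-s)

/-- `boundary_identity` at `z = -s` turns the boundary conditions into the secular system of the
Krein operator with `t = μ + s`. -/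
theorem exists_isBoundState_iff (ha : 0 < a) {α s : ℝ} (hs : 0 < s) {k : Plane}
    (h : IsBelow ha α s k) (μ : ℝ) (u : SeqSpace (ℤ × ℤ)) :
    (∃ Q₀ Q₁, IsBoundState ha α k μ u Q₀ Q₁) ↔
      u = ((μ + s : ℝ) : ℂ) • resolventOp ha α hs k u := by
  have hd := den_neg_ne_zero (a := a) hs k
  rw [resolventOp, eq_smul_kreinOp_iff norm_conjPhase _ h]
  refine exists_congr fun Q₀ => exists_congr fun Q₁ => ?_
  have i0 : inner ℂ (resolventSeq ha hs k) u = ∑' m, u m * (den a k ((-s : ℝ) : ℂ) m)⁻¹ := by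
    rw [← (hasSum_inner_seq _ _).tsum_eq]
    refine tsum_congr fun m => ?_
    rw [conj_resolventSeq, resolventSeq_apply]
  have i1 : inner ℂ (unitMul conjPhase norm_conjPhase (resolventSeq ha hs k)) u =
      ∑' m, hexPhase m * (u m * (den a k ((-s : ℝ) : ℂ) m)⁻¹) := by
    rw [← (hasSum_inner_seq _ _).tsum_eq]
    refine tsum_congr fun m => ?_
    rw [unitMul_apply, map_mul, conj_resolventSeq, resolventSeq_apply, conjPhase,
      Complex.conj_conj]
    ring
  have hiff : (∀ m, ((free a k m : ℂ) - μ) * u m = amplitude Q₀ Q₁ m) ↔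
      ∀ m, u m = ((μ + s : ℝ) : ℂ) * (resolventSeq ha hs k m * u m) +
        resolventSeq ha hs k m * (Q₀ + Q₁ * conjPhase m) := by
    refine forall_congr' fun m => ?_
    have hm := hd m
    have e : (free a k m : ℂ) - μ = den a k ((-s : ℝ) : ℂ) m - ((μ + s : ℝ) : ℂ) := by
      unfold den; push_cast; ring
    rw [resolventSeq_apply, e, amplitude]
    constructor
    · intro hh
      field_simp
      linear_combination hh
    · intro hh
      field_simp at hh
      linear_combination hh
  rw [IsBoundState, ← hiff]
  refine and_congr_right fun hT => ?_
  have hb := boundary_identity ha hd hT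
  rw [hb.1, hb.2, latticeSum_conjPhase_ofReal, latticeSum_one_ofReal, i0, i1]
  refine and_congr ?_ ?_
  · constructor <;> intro hh <;> push_cast at hh ⊢ <;> linear_combination -hh
  · constructor <;> intro hh <;> push_cast at hh ⊢ <;> linear_combination -hh

/-- The eigenvalues as the reciprocals of the approximation numbers of the resolvent. -/
def levels (ha : 0 < a) (α : ℝ) {s : ℝ} (hs : 0 < s) (k : Plane) (j : ℕ+) : ℝ :=
  (approxNumber (resolventOp ha α hs k) j.natPred)⁻¹ - s

theorem resolventOp_pos (ha : 0 < a) {α s : ℝ} (hs : 0 < s) {k : Plane}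
    (h : IsBelow ha α s k) {u : SeqSpace (ℤ × ℤ)} (hu : u ≠ 0) :
    0 < (inner ℂ u (resolventOp ha α hs k u)).re :=
  kreinOp_pos _ (fun m => inv_pos.2 (add_pos_of_nonneg_of_pos (free_nonneg a k m) hs))
    (resolventSeq_apply' ha hs k) h hu

theorem isCompactOperator_resolventOp (ha : 0 < a) (α : ℝ) {s : ℝ} (hs : 0 < s) (k : Plane) :
    IsCompactOperator (resolventOp ha α hs k) := isCompactOperator_kreinOp _ _ _ _

theorem isSymmetric_resolventOp (ha : 0 < a) (α : ℝ) {s : ℝ} (hs : 0 < s) (k : Plane) :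
    (resolventOp ha α hs k : SeqSpace (ℤ × ℤ) →ₗ[ℂ] SeqSpace (ℤ × ℤ)).IsSymmetric :=
  isSymmetric_kreinOp _ (conj_resolventSeq ha hs k) _ _

theorem approxNumber_resolventOp_pos (ha : 0 < a) {α s : ℝ} (hs : 0 < s) {k : Plane}
    (h : IsBelow ha α s k) (n : ℕ) : 0 < approxNumber (resolventOp ha α hs k) n :=
  (approxNumber_pos_and_encard (not_finiteDimensional_seqSpace (ι := ℤ × ℤ))
    (isCompactOperator_resolventOp ha α hs k) (isSymmetric_resolventOp ha α hs k)
    (fun _ hu => resolventOp_pos ha hs h hu)).1 n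

/-- Eigenvectors at `μ` are eigenvectors of the resolvent at `(μ + s)⁻¹`, so multiplicities are
counted by its approximation numbers. -/
theorem isEigenvalueSeq_levels (ha : 0 < a) {α s : ℝ} (hs : 0 < s) {k : Plane}
    (h : IsBelow ha α s k) : IsEigenvalueSeq a α k (levels ha α hs k) := by
  set R := resolventOp ha α hs k with hR
  have hc : IsCompactOperator R := isCompactOperator_resolventOp ha α hs k
  obtain ⟨hpos, hcard⟩ := approxNumber_pos_and_encard
    (not_finiteDimensional_seqSpace (ι := ℤ × ℤ)) hc (isSymmetric_resolventOp ha α hs k) (fun u hu => resolventOp_pos ha hs h hu)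
  have hmem : ∀ μ u, u ∈ eigenspace a α k μ ↔
      coeffEquiv ha k u = ((μ + s : ℝ) : ℂ) • R (coeffEquiv ha k u) := fun μ u => by
    rw [mem_eigenspace_iff ha, exists_isBoundState_iff ha hs h]
  refine ⟨fun i j hij => ?_, fun μ => ?_⟩
  · exact sub_le_sub_right (inv_anti₀ (hpos _) (approxNumber_antitone R
      (Nat.pred_le_pred (PNat.coe_le_coe _ _ |>.2 hij)))) _
  -- At or below `-s`, positivity of the resolvent excludes eigenvectors, and no level is that low.
  rcases le_or_gt (μ + s) 0 with hμ | hμ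
  · have hbot : eigenspace a α k μ = ⊥ := by
      rw [eq_bot_iff]
      intro u hu
      rw [hmem] at hu
      rw [Submodule.mem_bot]
      by_contra hne
      have hne' : coeffEquiv ha k u ≠ 0 := fun h0 => hne ((coeffEquiv ha k).map_eq_zero_iff.1 h0)
      have h1 := resolventOp_pos ha hs h hne'
      have h2 : ‖coeffEquiv ha k u‖ ^ 2 =
          (μ + s) * (inner ℂ (coeffEquiv ha k u) (R (coeffEquiv ha k u))).re := by
        rw [← Complex.re_ofReal_mul, ← inner_smul_right, ← hu]
        exact (inner_self_eq_norm_sq (𝕜 := ℂ) _).symm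
      have h3 : 0 < ‖coeffEquiv ha k u‖ ^ 2 := pow_pos (norm_pos_iff.2 hne') 2
      have h4 := mul_nonpos_of_nonpos_of_nonneg hμ h1.le
      rw [← hR] at h4
      linarith
    rw [hbot]
    refine ⟨inferInstance, ?_⟩
    have : {j : ℕ+ | levels ha α hs k j = μ} = ∅ := by
      ext j
      simp only [Set.mem_ofPred_eq, Set.mem_empty_iff_false, iff_false, levels]
      intro hj
      have := inv_pos.2 (hpos j.natPred)
      linarith
    rw [this]
    simp
  · set ν := (μ + s)⁻¹ with hν
    have hν0 : 0 < ν := inv_pos.2 hμ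
    have hνc : (ν : ℂ) ≠ 0 := by exact_mod_cast hν0.ne'
    have heq : eigenspace a α k μ =
        (Module.End.eigenspace (R : SeqSpace (ℤ × ℤ) →ₗ[ℂ] SeqSpace (ℤ × ℤ)) (ν : ℂ)).comap
          (coeffEquiv ha k : L2Cell a →ₗ[ℂ] SeqSpace (ℤ × ℤ)) := by
      ext u
      rw [hmem, Submodule.mem_comap, Module.End.mem_eigenspace_iff]
      have e : ((μ + s : ℝ) : ℂ) = (ν : ℂ)⁻¹ := by rw [hν]; push_cast; rw [inv_inv]
      rw [e]
      exact eq_inv_smul_iff₀ hνc |>.trans eq_comm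
    have E := (coeffEquiv ha k).ofSubmodule'
      (Module.End.eigenspace (R : SeqSpace (ℤ × ℤ) →ₗ[ℂ] SeqSpace (ℤ × ℤ)) (ν : ℂ))
    rw [heq]
    have hfin := ContinuousLinearMap.finite_dimensional_eigenspace hc (ν : ℂ) hνc
    refine ⟨Module.Finite.equiv E.symm, ?_⟩
    rw [E.finrank_eq, ← hcard ν hν0]
    -- `natPred` matches levels counted from 1 with approximation numbers counted from 0.
    have hinj : Function.Injective (fun j : ℕ+ => j.natPred) := PNat.natPred_injective
    rw [← hinj.encard_image]
    congr 1
    ext n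
    simp only [Set.mem_image, Set.mem_ofPred_eq, levels]
    constructor
    · rintro ⟨j, hj, rfl⟩
      rw [hν, ← hj, sub_add_cancel, inv_inv]
    · intro hn
      refine ⟨n.succPNat, ?_, Nat.natPred_succPNat n⟩
      rw [Nat.natPred_succPNat, hn, hν, inv_inv, add_sub_cancel_right]

/-- The sums over discs grow like a positive multiple of `log r`. -/
theorem not_summable_inv_weight (ha : 0 < a) : ¬ Summable fun m => (weight a m)⁻¹ := by
  intro hs
  obtain ⟨γ, hγ⟩ := exists_tendsto_sum_disc_sub_log ha
  have hc : 0 < 2 * Real.pi / areaDual a := div_pos (by positivity) (areaDual_pos ha)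
  have h1 : Tendsto (fun r : ℝ => 2 * Real.pi / areaDual a * Real.log r) atTop atTop :=
    Real.tendsto_log_atTop.const_mul_atTop hc
  have h2 := hγ.add_atTop h1
  obtain ⟨r, hr⟩ := (h2.eventually (eventually_gt_atTop (∑' m, (weight a m)⁻¹))).exists
  rw [sub_add_cancel] at hr
  exact absurd (hs.sum_le_tsum (disc ha (diracPoint a) r)
    fun m _ => inv_nonneg.2 (weight_pos a m).le) (not_le.2 hr)

/-- For `s ≥ 1` all terms are nonpositive, so a finite partial sum bounds the series above.
Divergence of `∑ w⁻¹` makes it as negative as desired. -/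
theorem exists_diagSum_dirac_lt (ha : 0 < a) (B : ℝ) :
    ∃ s : ℝ, 1 ≤ s ∧ diagSum a (diracPoint a) (-s) < B := by
  have h1 : ∃ F : Finset (ℤ × ℤ), 1 - B < ∑ m ∈ F, (weight a m)⁻¹ := by
    by_contra hcon
    push Not at hcon
    exact not_summable_inv_weight ha (summable_of_sum_le
      (fun m => inv_nonneg.2 (weight_pos a m).le) hcon)
  obtain ⟨F, hF⟩ := h1
  -- With `s ≥ F.card` the terms `(free + s)⁻¹` over `F` add up to at most 1.
  refine ⟨max 1 F.card, le_max_left _ _, ?_⟩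
  set s : ℝ := max 1 F.card with hs
  have hs1 : 1 ≤ s := le_max_left _ _
  have hs0 : 0 < s := by linarith
  have hsum : Summable fun m => (free a (diracPoint a) m - -s)⁻¹ - (weight a m)⁻¹ := by
    have h := summable_latticeSum ha (c := 1) (fun m => by simp)
      (den_neg_ne_zero (a := a) hs0 (diracPoint a))
    rw [← Complex.summable_ofReal]
    refine h.congr fun m => ?_
    rw [Pi.one_apply, one_mul, den]
    push_cast
    rfl
  have hnp : ∀ m, (free a (diracPoint a) m - -s)⁻¹ - (weight a m)⁻¹ ≤ 0 := fun m => by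
    have hw := weight_pos a m
    rw [sub_nonpos]
    refine inv_anti₀ hw ?_
    unfold weight; linarith
  have h2 : diagSum a (diracPoint a) (-s) ≤
      ∑ m ∈ F, ((free a (diracPoint a) m - -s)⁻¹ - (weight a m)⁻¹) := by
    have := hsum.neg.sum_le_tsum F fun m _ => neg_nonneg.2 (hnp m)
    rw [tsum_neg, Finset.sum_neg_distrib] at this
    exact neg_le_neg_iff.1 this
  rw [Finset.sum_sub_distrib] at h2
  have h3 : ∑ m ∈ F, (free a (diracPoint a) m - -s)⁻¹ ≤ 1 := by
    calc ∑ m ∈ F, (free a (diracPoint a) m - -s)⁻¹ ≤ ∑ m ∈ F, s⁻¹ :=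
          Finset.sum_le_sum fun m _ => inv_anti₀ hs0 (by
            linarith [free_nonneg a (diracPoint a) m])
      _ = F.card * s⁻¹ := by rw [Finset.sum_const, nsmul_eq_mul]
      _ ≤ s * s⁻¹ := by
          gcongr
          exact le_max_right _ _
      _ = 1 := mul_inv_cancel₀ hs0.ne'
  linarith

/-- The cost of moving from `K` to `k` is uniform in `s ≥ 1`, because the denominators at `-s`
dominate those at `-1`. -/
theorem exists_norm_latticeSum_sub_le (ha : 0 < a) (k : Plane) :
    ∃ M : ℝ, ∀ c : ℤ × ℤ → ℂ, (∀ m, ‖c m‖ = 1) → ∀ s : ℝ, 1 ≤ s →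
      ‖latticeSum a c k ((-s : ℝ) : ℂ) - latticeSum a c (diracPoint a) ((-s : ℝ) : ℂ)‖ ≤ M := by
  obtain ⟨c₀, hc₀, h0⟩ := exists_mul_weight_le_norm_den ha
    (den_neg_ne_zero (a := a) one_pos k)
  set D := 2 * ‖k - diracPoint a‖ + ‖k - diracPoint a‖ ^ 2 with hD
  refine ⟨∑' m, D / (c₀ * 1) * (weight a m * √(weight a m))⁻¹, fun c hc s hs => ?_⟩
  have hs0 : 0 < s := by linarith
  rw [(latticeSum_sub ha hc (den_neg_ne_zero hs0 k) (den_neg_ne_zero hs0 _)).2]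
  refine tsum_of_norm_bounded ((summable_weight ha).mul_left _).hasSum fun m => ?_
  rw [norm_mul, hc, one_mul]
  refine norm_inv_sub_inv_le (weight_pos a m) (by linarith [one_le_sqrt_weight a m])
    (sqrt_weight_mul_self a m) hc₀ one_pos ((h0 m).trans ?_) ?_ ?_
  · rw [den_neg_ofReal, den_neg_ofReal, Complex.norm_real, Complex.norm_real,
      Real.norm_of_nonneg (by linarith [free_nonneg a k m]),
      Real.norm_of_nonneg (by linarith [free_nonneg a k m])]
    linarith
  · rw [den_neg_ofReal, Complex.norm_real, one_mul,
      Real.norm_of_nonneg (by linarith [free_nonneg a (diracPoint a) m]), weight]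
    linarith
  · have := norm_den_sub_le a k ((-s : ℝ) : ℂ) ((-s : ℝ) : ℂ) m
    rwa [sub_self, norm_zero, add_zero] at this

/-- Rotation symmetry kills the off-diagonal secular entry at `K` for every energy. -/
theorem latticeSum_hexPhase_dirac (ha : 0 < a) (z : ℂ) :
    latticeSum a hexPhase (diracPoint a) z = 0 := by
  have h := tsum_hexPhase_mul ha fun x => ((x : ℂ) - z)⁻¹ - (((x + 1 : ℝ)) : ℂ)⁻¹
  exact h

theorem exists_isBelow (ha : 0 < a) (α : ℝ) (k : Plane) : ∃ s : ℝ, 1 ≤ s ∧ IsBelow ha α s k := by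
  obtain ⟨M, hM⟩ := exists_norm_latticeSum_sub_le ha k
  -- One `M` covers the off-diagonal sum, which is zero at `K`; the other covers the shift of the
  -- diagonal sum.
  obtain ⟨s, hs, h⟩ := exists_diagSum_dirac_lt ha (coupling ha α - 2 * M)
  refine ⟨s, hs, ?_⟩
  have h1 := hM hexPhase norm_hexPhase s hs
  have h2 := hM 1 (fun m => by simp) s hs
  rw [latticeSum_hexPhase_dirac ha, sub_zero] at h1
  rw [latticeSum_one_ofReal, latticeSum_one_ofReal, ← Complex.ofReal_sub, Complex.norm_real] at h2
  have h3 := (abs_le.1 h2).2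
  unfold IsBelow
  linarith

/-- The lattice sums are continuous at the Dirac point. -/
theorem tendsto_latticeSum (ha : 0 < a) {c : ℤ × ℤ → ℂ} (hc : ∀ m, ‖c m‖ = 1) {z₀ : ℂ}
    (h : ∀ m, den a (diracPoint a) z₀ m ≠ 0) :
    Tendsto (fun p : Plane × ℂ => latticeSum a c p.1 p.2) (𝓝 (diracPoint a, z₀))
      (𝓝 (latticeSum a c (diracPoint a) z₀)) := by
  obtain ⟨c₀, hc₀, h0⟩ := eventually_mul_weight_le_norm_den ha h
  have hK := h0.self_of_nhds
  rw [tendsto_iff_norm_sub_tendsto_zero]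
  have hlim : Tendsto (fun p : Plane × ℂ => (2 * ‖p.1 - diracPoint a‖ + ‖p.1 - diracPoint a‖ ^ 2 +
      ‖p.2 - z₀‖) / (c₀ * c₀) * ∑' m, (weight a m * √(weight a m))⁻¹)
      (𝓝 (diracPoint a, z₀)) (𝓝 0) := by
    have hcont : Continuous fun p : Plane × ℂ => (2 * ‖p.1 - diracPoint a‖ +
      ‖p.1 - diracPoint a‖ ^ 2 + ‖p.2 - z₀‖) / (c₀ * c₀) *
        ∑' m, (weight a m * √(weight a m))⁻¹ := by fun_prop
    have := hcont.tendsto (diracPoint a, z₀)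
    simpa using this
  refine squeeze_zero' (Eventually.of_forall fun p => norm_nonneg _) ?_ hlim
  filter_upwards [h0] with p hp
  rw [(latticeSum_sub ha hc (den_ne_zero_of_le hc₀ hp) h).2, ← tsum_mul_left]
  refine tsum_of_norm_bounded ((summable_weight ha).mul_left _).hasSum fun m => ?_
  rw [norm_mul, hc, one_mul]
  exact norm_inv_sub_inv_le (weight_pos a m) (by linarith [one_le_sqrt_weight a m])
    (sqrt_weight_mul_self a m) hc₀ hc₀ (hp m) (hK m) (norm_den_sub_le a p.1 p.2 z₀ m)

theorem tendsto_diagSum (ha : 0 < a) {μ₀ : ℝ}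
    (h : ∀ m, den a (diracPoint a) (μ₀ : ℂ) m ≠ 0) :
    Tendsto (fun p : Plane × ℝ => diagSum a p.1 p.2) (𝓝 (diracPoint a, μ₀))
      (𝓝 (diagSum a (diracPoint a) μ₀)) := by
  have h1 := tendsto_latticeSum ha (c := 1) (fun m => by simp) h
  have h2 : Tendsto (fun p : Plane × ℝ => (p.1, (p.2 : ℂ))) (𝓝 (diracPoint a, μ₀))
      (𝓝 (diracPoint a, (μ₀ : ℂ))) := by
    have : Continuous fun p : Plane × ℝ => (p.1, (p.2 : ℂ)) := by fun_prop
    exact this.tendsto (diracPoint a, μ₀)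
  have h3 := (Complex.continuous_re.tendsto _).comp (h1.comp h2)
  rw [latticeSum_one_ofReal, Complex.ofReal_re] at h3
  refine h3.congr fun p => ?_
  simp only [Function.comp_apply, latticeSum_one_ofReal, Complex.ofReal_re]

theorem tendsto_latticeSum_left (ha : 0 < a) {c : ℤ × ℤ → ℂ} (hc : ∀ m, ‖c m‖ = 1) {z₀ : ℂ}
    (h : ∀ m, den a (diracPoint a) z₀ m ≠ 0) :
    Tendsto (fun k => latticeSum a c k z₀) (𝓝 (diracPoint a))
      (𝓝 (latticeSum a c (diracPoint a) z₀)) := by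
  have h1 : Tendsto (fun k : Plane => (k, z₀)) (𝓝 (diracPoint a)) (𝓝 (diracPoint a, z₀)) :=
    tendsto_id.prodMk_nhds tendsto_const_nhds
  simpa only [Function.comp_def] using (tendsto_latticeSum ha hc h).comp h1

theorem tendsto_diagSum_left (ha : 0 < a) {μ₀ : ℝ}
    (h : ∀ m, den a (diracPoint a) (μ₀ : ℂ) m ≠ 0) :
    Tendsto (fun k => diagSum a k μ₀) (𝓝 (diracPoint a)) (𝓝 (diagSum a (diracPoint a) μ₀)) := by
  have h1 : Tendsto (fun k : Plane => (k, μ₀)) (𝓝 (diracPoint a)) (𝓝 (diracPoint a, μ₀)) :=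
    tendsto_id.prodMk_nhds tendsto_const_nhds
  simpa only [Function.comp_def] using (tendsto_diagSum ha h).comp h1

theorem tendsto_resolventSeq (ha : 0 < a) {s : ℝ} (hs : 0 < s) :
    Tendsto (fun k => resolventSeq ha hs k) (𝓝 (diracPoint a))
      (𝓝 (resolventSeq ha hs (diracPoint a))) := by
  obtain ⟨c₀, hc₀, h0⟩ := eventually_mul_weight_le_norm_den ha
    (den_neg_ne_zero (a := a) hs (diracPoint a))
  have hK := h0.self_of_nhds
  have hsec : Tendsto (fun k : Plane => (k, ((-s : ℝ) : ℂ))) (𝓝 (diracPoint a))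
      (𝓝 (diracPoint a, ((-s : ℝ) : ℂ))) := by
    have : Continuous fun k : Plane => (k, ((-s : ℝ) : ℂ)) := by fun_prop
    exact this.tendsto (diracPoint a)
  set h : SeqSpace (ℤ × ℤ) := resolventSeq ha one_pos (diracPoint a) with hh
  rw [tendsto_iff_norm_sub_tendsto_zero]
  have hlim : Tendsto (fun k : Plane => (2 * ‖k - diracPoint a‖ + ‖k - diracPoint a‖ ^ 2) /
      (c₀ * c₀) * ‖h‖) (𝓝 (diracPoint a)) (𝓝 0) := by
    have hcont : Continuous fun k : Plane => (2 * ‖k - diracPoint a‖ + ‖k - diracPoint a‖ ^ 2) /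
      (c₀ * c₀) * ‖h‖ := by fun_prop
    have := hcont.tendsto (diracPoint a)
    simpa using this
  refine squeeze_zero' (Eventually.of_forall fun p => norm_nonneg _) ?_ hlim
  filter_upwards [hsec.eventually h0] with k hk
  set D := (2 * ‖k - diracPoint a‖ + ‖k - diracPoint a‖ ^ 2) / (c₀ * c₀) with hD
  have hD0 : 0 ≤ D := by positivity
  have hle : ‖resolventSeq ha hs k - resolventSeq ha hs (diracPoint a)‖ ≤ ‖(D : ℂ) • h‖ := by
    refine lp.norm_mono two_ne_zero fun m => ?_
    have hw := weight_pos a m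
    rw [lp.coeFn_sub, Pi.sub_apply, resolventSeq_apply, resolventSeq_apply, lp.coeFn_smul,
      Pi.smul_apply, norm_smul, hh, resolventSeq_apply', Complex.norm_real, Complex.norm_real,
      Real.norm_of_nonneg hD0,
      Real.norm_of_nonneg (show 0 ≤ (free a (diracPoint a) m + 1)⁻¹ from inv_nonneg.2 hw.le)]
    refine (norm_inv_sub_inv_le (B := 2 * ‖k - diracPoint a‖ + ‖k - diracPoint a‖ ^ 2)
      hw (by linarith [one_le_sqrt_weight a m])
      (sqrt_weight_mul_self a m) hc₀ hc₀ (hk m) (hK m) ?_).trans ?_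
    · have := norm_den_sub_le a k ((-s : ℝ) : ℂ) ((-s : ℝ) : ℂ) m
      rwa [sub_self, norm_zero, add_zero] at this
    · refine mul_le_mul_of_nonneg_left (inv_anti₀ hw ?_) hD0
      exact le_mul_of_one_le_right hw.le (one_le_sqrt_weight a m)
  rwa [norm_smul, Complex.norm_real, Real.norm_of_nonneg hD0] at hle

theorem eventually_isBelow (ha : 0 < a) {α s : ℝ} (hs : 0 < s)
    (h : IsBelow ha α s (diracPoint a)) : ∀ᶠ k in 𝓝 (diracPoint a), IsBelow ha α s k := by
  have hd := den_neg_ne_zero (a := a) hs (diracPoint a)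
  exact ((tendsto_latticeSum_left ha norm_hexPhase hd).norm).eventually_lt
    ((tendsto_diagSum_left ha hd).const_sub _) h

theorem tendsto_resolventOp (ha : 0 < a) {α s : ℝ} (hs : 0 < s)
    (h : IsBelow ha α s (diracPoint a)) :
    Tendsto (fun k => resolventOp ha α hs k) (𝓝 (diracPoint a))
      (𝓝 (resolventOp ha α hs (diracPoint a))) := by
  have hd := den_neg_ne_zero (a := a) hs (diracPoint a)
  have hb : Tendsto (fun k => coupling ha α - diagSum a k (-s)) (𝓝 (diracPoint a))
      (𝓝 (coupling ha α - diagSum a (diracPoint a) (-s))) :=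
    (tendsto_diagSum_left ha hd).const_sub _
  have hg : Tendsto (fun k => latticeSum a hexPhase k ((-s : ℝ) : ℂ)) (𝓝 (diracPoint a))
      (𝓝 (latticeSum a hexPhase (diracPoint a) ((-s : ℝ) : ℂ))) :=
    tendsto_latticeSum_left ha norm_hexPhase hd
  have hdet : (coupling ha α - diagSum a (diracPoint a) (-s)) ^ 2 -
      ‖latticeSum a hexPhase (diracPoint a) ((-s : ℝ) : ℂ)‖ ^ 2 ≠ 0 := by
    have h' := h
    unfold IsBelow at h'
    have := norm_nonneg (latticeSum a hexPhase (diracPoint a) ((-s : ℝ) : ℂ))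
    exact (sub_pos.2 (pow_lt_pow_left₀ h' this two_ne_zero)).ne'
  exact tendsto_kreinOp _ (tendsto_resolventSeq ha hs) hb hg hdet

theorem tendsto_levels (ha : 0 < a) {α s : ℝ} (hs : 0 < s)
    (h : IsBelow ha α s (diracPoint a)) (j : ℕ+) :
    Tendsto (fun k => levels ha α hs k j) (𝓝 (diracPoint a))
      (𝓝 (levels ha α hs (diracPoint a) j)) := by
  have hN : Tendsto (fun k => approxNumber (resolventOp ha α hs k) j.natPred) (𝓝 (diracPoint a))
      (𝓝 (approxNumber (resolventOp ha α hs (diracPoint a)) j.natPred)) :=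
    ((continuous_approxNumber j.natPred).tendsto _).comp (tendsto_resolventOp ha hs h)
  exact (hN.inv₀ (approxNumber_resolventOp_pos ha hs h _).ne').sub_const s

/-- Eigenvalue sequences at all quasi-momenta, continuous at the Dirac point. -/
theorem exists_eigenvalueSeq (ha : 0 < a) (α : ℝ) : ∃ lam : Plane → ℕ+ → ℝ,
    (∀ k, IsEigenvalueSeq a α k (lam k)) ∧
    ∀ j, Tendsto (fun k => lam k j) (𝓝 (diracPoint a)) (𝓝 (lam (diracPoint a) j)) := by
  classical
  choose s hs hbelow using exists_isBelow ha α
  have hs0 : ∀ k, 0 < s k := fun k => lt_of_lt_of_le one_pos (hs k)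
  -- Near `K` the shift `s` is frozen at its value for `K`, so that continuity concerns a single
  -- family of operators.
  refine ⟨fun k => if IsBelow ha α (s (diracPoint a)) k then
    levels ha α (hs0 (diracPoint a)) k else levels ha α (hs0 k) k, fun k => ?_, fun j => ?_⟩
  · by_cases hk : IsBelow ha α (s (diracPoint a)) k
    · simp only [if_pos hk]
      exact isEigenvalueSeq_levels ha _ hk
    · simp only [if_neg hk]
      exact isEigenvalueSeq_levels ha _ (hbelow k)
  · simp only [if_pos (hbelow (diracPoint a))]
    refine (tendsto_levels ha (hs0 (diracPoint a)) (hbelow _) j).congr' ?_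
    filter_upwards [eventually_isBelow ha (hs0 (diracPoint a)) (hbelow _)] with k hk
    rw [if_pos hk]

end EigenvalueSequences

/-! ### The secular matrix off the free spectrum -/

section SecularEquation

variable {a : ℝ}

/-- The secular matrix, whose kernel consists of the singular amplitudes of bound states. -/
def secularMatrix (ha : 0 < a) (α : ℝ) (k : Plane) (μ : ℝ) : Matrix (Fin 2) (Fin 2) ℂ :=
  !![((coupling ha α - diagSum a k μ : ℝ) : ℂ), -(starRingEnd ℂ) (latticeSum a hexPhase k μ);
    -latticeSum a hexPhase k μ, ((coupling ha α - diagSum a k μ : ℝ) : ℂ)]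

theorem mem_ker_secularMatrix (ha : 0 < a) (α : ℝ) (k : Plane) (μ : ℝ) (Q : Fin 2 → ℂ) :
    Q ∈ LinearMap.ker (secularMatrix ha α k μ).mulVecLin ↔
      (coupling ha α - diagSum a k μ) * Q 0 - (starRingEnd ℂ) (latticeSum a hexPhase k μ) * Q 1 = 0 ∧
      -latticeSum a hexPhase k μ * Q 0 + (coupling ha α - diagSum a k μ) * Q 1 = 0 := by
  rw [LinearMap.mem_ker, Matrix.mulVecLin_apply, funext_iff, Fin.forall_fin_two]
  simp [secularMatrix, Matrix.mulVec, dotProduct, Fin.sum_univ_two, sub_eq_add_neg]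

/-- The bound state with given singular amplitudes. -/
def boundState (ha : 0 < a) {k : Plane} {μ : ℝ} (h : ∀ m, den a k (μ : ℂ) m ≠ 0) :
    (Fin 2 → ℂ) →ₗ[ℂ] SeqSpace (ℤ × ℤ) :=
  (LinearMap.toSpanSingleton ℂ _ (⟨_, memℓp_inv_den ha h⟩ : SeqSpace (ℤ × ℤ))).comp
      (LinearMap.proj 0) +
    (LinearMap.toSpanSingleton ℂ _ (unitMul conjPhase norm_conjPhase
      (⟨_, memℓp_inv_den ha h⟩ : SeqSpace (ℤ × ℤ)))).comp (LinearMap.proj 1)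

theorem boundState_apply (ha : 0 < a) {k : Plane} {μ : ℝ} (h : ∀ m, den a k (μ : ℂ) m ≠ 0)
    (Q : Fin 2 → ℂ) (m : ℤ × ℤ) :
    boundState ha h Q m = amplitude (Q 0) (Q 1) m * (den a k (μ : ℂ) m)⁻¹ := by
  have e : boundState ha h Q m = Q 0 * (den a k (μ : ℂ) m)⁻¹ +
      Q 1 * (conjPhase m * (den a k (μ : ℂ) m)⁻¹) := rfl
  rw [e, amplitude]
  ring

theorem boundState_injective (ha : 0 < a) {k : Plane} {μ : ℝ} (h : ∀ m, den a k (μ : ℂ) m ≠ 0) :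
    Function.Injective (boundState ha h) := by
  rw [← LinearMap.ker_eq_bot, LinearMap.ker_eq_bot']
  intro Q hQ
  have hT : ∀ m, amplitude (Q 0) (Q 1) m = 0 := fun m => by
    have h1 := boundState_apply ha h Q m
    rw [hQ] at h1
    exact (mul_eq_zero.1 h1.symm).resolve_right (inv_ne_zero (h m))
  obtain ⟨q0, q1⟩ := amplitude_eq_zero (hT 0) (hT _)
  ext i
  fin_cases i
  · exact q0
  · exact q1

/-- Off the free spectrum the amplitudes determine `u`, and `boundary_identity` may be used at `z =
μ` itself. The term with `μ - z` drops out and leaves the secular system. -/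
theorem eigenspace_eq_comap (ha : 0 < a) (α : ℝ) {k : Plane} {μ : ℝ}
    (h : ∀ m, den a k (μ : ℂ) m ≠ 0) : eigenspace a α k μ =
      ((LinearMap.ker (secularMatrix ha α k μ).mulVecLin).map (boundState ha h)).comap
        (coeffEquiv ha k : L2Cell a →ₗ[ℂ] SeqSpace (ℤ × ℤ)) := by
  ext u
  rw [mem_eigenspace_iff ha, Submodule.mem_comap, Submodule.mem_map]
  set v := coeffEquiv ha k u with hv
  have key : ∀ Q : Fin 2 → ℂ, IsBoundState ha α k μ v (Q 0) (Q 1) ↔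
      Q ∈ LinearMap.ker (secularMatrix ha α k μ).mulVecLin ∧ boundState ha h Q = v := fun Q => by
    have e : (∀ m, ((free a k m : ℂ) - μ) * v m = amplitude (Q 0) (Q 1) m) ↔
        boundState ha h Q = v := by
      rw [lp.ext_iff, funext_iff]
      refine forall_congr' fun m => ?_
      rw [boundState_apply, ← div_eq_mul_inv, div_eq_iff (h m), mul_comm, eq_comm]
      rfl
    rw [mem_ker_secularMatrix, IsBoundState, ← e, and_comm]
    refine and_congr_left fun hT => ?_
    have hb := boundary_identity ha h hT
    rw [hb.1, hb.2, latticeSum_conjPhase_ofReal, latticeSum_one_ofReal, sub_self, zero_mul,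
      zero_mul, zero_add, zero_add]
    refine and_congr ?_ ?_
    · constructor <;> intro hh <;> linear_combination -hh
    · constructor <;> intro hh <;> linear_combination -hh
  constructor
  · rintro ⟨Q₀, Q₁, hQ⟩
    exact ⟨![Q₀, Q₁], (key ![Q₀, Q₁]).1 hQ⟩
  · rintro ⟨Q, hQ⟩
    exact ⟨Q 0, Q 1, (key Q).2 hQ⟩

theorem finrank_eigenspace (ha : 0 < a) (α : ℝ) {k : Plane} {μ : ℝ}
    (h : ∀ m, den a k (μ : ℂ) m ≠ 0) : Module.finrank ℂ (eigenspace a α k μ) =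
      Module.finrank ℂ (LinearMap.ker (secularMatrix ha α k μ).mulVecLin) := by
  rw [eigenspace_eq_comap ha α h, ((coeffEquiv ha k).ofSubmodule' _).finrank_eq]
  exact (Submodule.equivMapOfInjective _ (boundState_injective ha h) _).finrank_eq.symm

/-- A nonzero kernel vector forces the determinant `(β - D)² - |G|²` to vanish. -/
theorem secular_of_finrank_pos (ha : 0 < a) {α : ℝ} {k : Plane} {μ : ℝ}
    (h : ∀ m, den a k (μ : ℂ) m ≠ 0) (hpos : 0 < Module.finrank ℂ (eigenspace a α k μ)) :
    |coupling ha α - diagSum a k μ| = ‖latticeSum a hexPhase k μ‖ := by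
  rw [finrank_eigenspace ha α h, Module.finrank_pos_iff,
    Submodule.nontrivial_iff_ne_bot, Submodule.ne_bot_iff] at hpos
  obtain ⟨Q, hQ, hQ0⟩ := hpos
  rw [mem_ker_secularMatrix] at hQ
  set B := coupling ha α - diagSum a k μ with hB
  set g := latticeSum a hexPhase k μ
  obtain ⟨h0, h1⟩ := hQ
  have hBc : (coupling ha α : ℂ) - diagSum a k μ = (B : ℂ) := by rw [hB]; push_cast; rfl
  rw [hBc] at h0 h1
  have hgg : g * (starRingEnd ℂ) g = ((‖g‖ ^ 2 : ℝ) : ℂ) := by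
    rw [Complex.mul_conj, Complex.normSq_eq_norm_sq]
  have hdet : ((B ^ 2 - ‖g‖ ^ 2 : ℝ) : ℂ) = (B : ℂ) ^ 2 - g * (starRingEnd ℂ) g := by
    rw [hgg]; push_cast; ring
  have e0 : ((B ^ 2 - ‖g‖ ^ 2 : ℝ) : ℂ) * Q 0 = 0 := by
    rw [hdet]
    linear_combination (B : ℂ) * h0 + (starRingEnd ℂ) g * h1
  have e1 : ((B ^ 2 - ‖g‖ ^ 2 : ℝ) : ℂ) * Q 1 = 0 := by
    rw [hdet]
    linear_combination g * h0 + (B : ℂ) * h1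
  have hz : B ^ 2 - ‖g‖ ^ 2 = 0 := by
    by_contra hne
    have hne' : ((B ^ 2 - ‖g‖ ^ 2 : ℝ) : ℂ) ≠ 0 := by exact_mod_cast hne
    apply hQ0
    ext i
    fin_cases i
    · exact (mul_eq_zero.1 e0).resolve_left hne'
    · exact (mul_eq_zero.1 e1).resolve_left hne'
  rw [← abs_norm g, ← sq_eq_sq_iff_abs_eq_abs]
  linarith

/-- A `2×2` matrix with two-dimensional kernel is zero. This detects coinciding branches later. -/
theorem secular_of_two_le_finrank (ha : 0 < a) {α : ℝ} {k : Plane} {μ : ℝ}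
    (h : ∀ m, den a k (μ : ℂ) m ≠ 0) (htwo : 2 ≤ Module.finrank ℂ (eigenspace a α k μ)) :
    latticeSum a hexPhase k μ = 0 ∧ diagSum a k μ = coupling ha α := by
  rw [finrank_eigenspace ha α h] at htwo
  have htop : LinearMap.ker (secularMatrix ha α k μ).mulVecLin = ⊤ := by
    apply Submodule.eq_top_of_finrank_eq
    refine le_antisymm (Submodule.finrank_le _) ?_
    rw [Module.finrank_fin_fun]
    exact htwo
  have h1 : (![1, 0] : Fin 2 → ℂ) ∈ LinearMap.ker (secularMatrix ha α k μ).mulVecLin := by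
    rw [htop]; trivial
  rw [mem_ker_secularMatrix] at h1
  simp only [Matrix.cons_val_zero, Matrix.cons_val_one, mul_one, mul_zero, sub_zero, add_zero]
    at h1
  refine ⟨neg_eq_zero.1 h1.2, ?_⟩
  have := h1.1
  rw [← Complex.ofReal_sub, Complex.ofReal_eq_zero] at this
  linarith

theorem finrank_eigenspace_dirac (ha : 0 < a) (α : ℝ) {μ : ℝ}
    (h : ∀ m, den a (diracPoint a) (μ : ℂ) m ≠ 0) (hμ : diagSum a (diracPoint a) μ = coupling ha α) :
    Module.finrank ℂ (eigenspace a α (diracPoint a) μ) = 2 := by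
  rw [finrank_eigenspace ha α h]
  have htop : LinearMap.ker (secularMatrix ha α (diracPoint a) μ).mulVecLin = ⊤ := by
    rw [eq_top_iff]
    intro Q _
    rw [mem_ker_secularMatrix, latticeSum_hexPhase_dirac ha, hμ]
    simp
  rw [htop, finrank_top, Module.finrank_fin_fun]

theorem finrank_eigenspace_dirac_eq_zero (ha : 0 < a) (α : ℝ) {μ : ℝ}
    (h : ∀ m, den a (diracPoint a) (μ : ℂ) m ≠ 0) (hμ : diagSum a (diracPoint a) μ ≠ coupling ha α) :
    Module.finrank ℂ (eigenspace a α (diracPoint a) μ) = 0 := by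
  by_contra hne
  have := secular_of_finrank_pos ha h (Nat.pos_of_ne_zero hne)
  rw [latticeSum_hexPhase_dirac ha, norm_zero, abs_eq_zero] at this
  exact hμ (by linarith)

end SecularEquation

/-! ### The five lowest levels at the Dirac point -/

section DiracSpectrum

variable {a : ℝ}

theorem hexForm_eq_zero_iff (m : ℤ × ℤ) :
    hexForm m = 0 ↔ m = (0, 0) ∨ m = rot (0, 0) ∨ m = rot (rot (0, 0)) := by
  obtain ⟨p, q⟩ := m
  constructor
  · intro h
    simp only [hexForm] at h
    have h1 : p ≤ 0 := by nlinarith [sq_nonneg (2 * q - p), sq_nonneg p]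
    have h2 : -1 ≤ p := by nlinarith [sq_nonneg (2 * q - p), sq_nonneg p]
    obtain rfl | rfl : p = 0 ∨ p = -1 := by omega
    · have : q = 0 := by nlinarith
      subst this
      exact Or.inl rfl
    · have h3 : q * (q + 1) = 0 := by linarith
      rcases mul_eq_zero.1 h3 with h4 | h4
      · subst h4
        exact Or.inr (Or.inl (by simp [rot]))
      · obtain rfl : q = -1 := by omega
        exact Or.inr (Or.inr (by simp [rot]))
  · rintro (h | h | h) <;> rw [h] <;> simp [hexForm, rot]

theorem free_dirac_gap (ha : 0 < a) (m : ℤ × ℤ) :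
    free a (diracPoint a) m = groundEnergy a ∨ 4 * groundEnergy a ≤ free a (diracPoint a) m := by
  have hκ := groundEnergy_pos ha
  rw [free_dirac ha]
  rcases (hexForm_nonneg m).eq_or_lt with h | h
  · left; rw [← h]; simp
  · right
    have : (1 : ℝ) ≤ hexForm m := by exact_mod_cast h
    nlinarith

theorem free_dirac_eq_iff (ha : 0 < a) (m : ℤ × ℤ) :
    free a (diracPoint a) m = groundEnergy a ↔
      m = (0, 0) ∨ m = rot (0, 0) ∨ m = rot (rot (0, 0)) := by
  have hκ := groundEnergy_pos ha
  rw [← hexForm_eq_zero_iff, free_dirac ha]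
  constructor
  · intro h
    have : groundEnergy a * (3 * (hexForm m : ℝ)) = 0 := by linarith
    rcases mul_eq_zero.1 this with h1 | h1
    · exact absurd h1 hκ.ne'
    · have : (hexForm m : ℝ) = 0 := by linarith
      exact_mod_cast this
  · intro h; rw [h]; simp

theorem cubeRoot_cubed : cubeRoot ^ 3 = 1 := by
  linear_combination (cubeRoot - 1) * cubeRoot_sq_add

/-- At `κ` the left side of the bound state equation vanishes on the three ground labels, so both
amplitudes are zero and `u` lives there. With `ω = cubeRoot`, the boundary conditions become `v₀ +
v₁ + v₂ = 0` and `v₀ + ωv₁ + ω²v₂ = 0`, solved exactly by the multiples of `(1, ω, ω²)`. -/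
theorem finrank_eigenspace_groundEnergy (ha : 0 < a) (α : ℝ) :
    Module.finrank ℂ (eigenspace a α (diracPoint a) (groundEnergy a)) = 1 := by
  classical
  set K := diracPoint a
  set κ := groundEnergy a
  set m₀ : ℤ × ℤ := (0, 0) with hm₀
  set m₁ := rot m₀ with hm₁
  set m₂ := rot m₁ with hm₂
  have h01 : m₀ ≠ m₁ := by rw [hm₁, hm₀]; simp [rot]
  have h02 : m₀ ≠ m₂ := by rw [hm₂, hm₁, hm₀]; simp [rot]
  have h12 : m₁ ≠ m₂ := fun h => h01 (rot.injective h)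
  have p0 : hexPhase m₀ = 1 := hexPhase_zero
  have p1 : hexPhase m₁ = cubeRoot := hexPhase_rot_zero
  have p2 : hexPhase m₂ = cubeRoot ^ 2 := hexPhase_rot_rot_zero
  have hfree : ∀ m, free a K m = κ ↔ m = m₀ ∨ m = m₁ ∨ m = m₂ := free_dirac_eq_iff ha
  set w : SeqSpace (ℤ × ℤ) := lp.single 2 m₀ (1 : ℂ) + lp.single 2 m₁ cubeRoot +
    lp.single 2 m₂ (cubeRoot ^ 2) with hw
  have hwapp : ∀ m, w m = if m = m₀ then 1 else if m = m₁ then cubeRoot else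
      if m = m₂ then cubeRoot ^ 2 else 0 := fun m => by
    simp only [hw, lp.coeFn_add, Pi.add_apply, lp.coeFn_single, Pi.single_apply]
    split_ifs <;> simp_all
  have w0 : w m₀ = 1 := by rw [hwapp, if_pos rfl]
  have w1 : w m₁ = cubeRoot := by rw [hwapp, if_neg h01.symm, if_pos rfl]
  have w2 : w m₂ = cubeRoot ^ 2 := by rw [hwapp, if_neg h02.symm, if_neg h12.symm, if_pos rfl]
  have hw' : ∀ m, ¬ (m = m₀ ∨ m = m₁ ∨ m = m₂) → w m = 0 := fun m hm => by
    push Not at hm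
    rw [hwapp, if_neg hm.1, if_neg hm.2.1, if_neg hm.2.2]
  have hsum : ∀ f : ℤ × ℤ → ℂ, (∀ m, ¬ (m = m₀ ∨ m = m₁ ∨ m = m₂) → f m = 0) →
      ∑' m, f m = f m₀ + f m₁ + f m₂ := fun f hf => by
    rw [tsum_eq_sum (s := {m₀, m₁, m₂}) fun m hm => hf m (by simpa using hm),
      Finset.sum_insert (by simp [h01, h02]), Finset.sum_insert (by simp [h12]),
      Finset.sum_singleton]
    ring
  have hbs : ∀ (v : SeqSpace (ℤ × ℤ)), (∃ Q₀ Q₁, IsBoundState ha α K κ v Q₀ Q₁) ↔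
      v ∈ Submodule.span ℂ {w} := fun v => by
    rw [Submodule.mem_span_singleton]
    constructor
    · rintro ⟨Q₀, Q₁, hT, h0, h1⟩
      have hz : ∀ m, m = m₀ ∨ m = m₁ ∨ m = m₂ → amplitude Q₀ Q₁ m = 0 := fun m hm => by
        rw [← hT, (hfree m).2 hm, sub_self, zero_mul]
      obtain ⟨q0, q1⟩ := amplitude_eq_zero (hz m₀ (by simp)) (hz m₁ (by simp))
      subst q0 q1
      have hv' : ∀ m, ¬ (m = m₀ ∨ m = m₁ ∨ m = m₂) → v m = 0 := fun m hm => by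
        have h2 := hT m
        rw [amplitude, zero_mul, add_zero] at h2
        refine (mul_eq_zero.1 h2).resolve_left fun h3 => hm ((hfree m).1 ?_)
        rw [← Complex.ofReal_sub, Complex.ofReal_eq_zero] at h3
        linarith
      simp only [amplitude, zero_mul, add_zero, sub_zero, mul_zero] at h0 h1
      rw [hsum _ hv'] at h0
      rw [hsum _ (fun m hm => by rw [hv' m hm, mul_zero]), p0, p1, p2] at h1
      have hne : cubeRoot - 1 ≠ 0 := sub_ne_zero.2 cubeRoot_ne_one
      have e1 : v m₁ = cubeRoot ^ 2 * v m₂ := by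
        apply mul_left_cancel₀ hne
        linear_combination h1 - h0 - (cubeRoot - 1) * v m₂ * cubeRoot_sq_add
      have e0 : v m₀ = cubeRoot * v m₂ := by
        linear_combination h0 - e1 - v m₂ * cubeRoot_sq_add
      refine ⟨v m₀, ?_⟩
      ext m
      rw [lp.coeFn_smul, Pi.smul_apply, smul_eq_mul]
      by_cases hm : m = m₀ ∨ m = m₁ ∨ m = m₂
      · rcases hm with rfl | rfl | rfl
        · rw [w0, mul_one]
        · rw [w1, e1, e0]; ring
        · rw [w2, e0]; linear_combination v m₂ * cubeRoot_cubed
      · rw [hw' m hm, hv' m hm, mul_zero]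
    · rintro ⟨c, rfl⟩
      refine ⟨0, 0, fun m => ?_, ?_, ?_⟩
      · rw [amplitude, zero_mul, add_zero, lp.coeFn_smul, Pi.smul_apply, smul_eq_mul]
        by_cases hm : m = m₀ ∨ m = m₁ ∨ m = m₂
        · rw [(hfree m).2 hm, sub_self, zero_mul]
        · rw [hw' m hm, mul_zero, mul_zero]
      · simp only [amplitude, zero_mul, add_zero, sub_zero, mul_zero, lp.coeFn_smul, Pi.smul_apply,
          smul_eq_mul]
        rw [hsum _ (fun m hm => by rw [hw' m hm, mul_zero]), w0, w1, w2]
        linear_combination c * cubeRoot_sq_add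
      · simp only [amplitude, zero_mul, add_zero, sub_zero, mul_zero, lp.coeFn_smul, Pi.smul_apply,
          smul_eq_mul]
        rw [hsum _ (fun m hm => by rw [hw' m hm, mul_zero, mul_zero]), w0, w1, w2, p0, p1, p2]
        linear_combination c * cubeRoot_sq_add + c * cubeRoot * cubeRoot_cubed
  have heq : eigenspace a α K κ = (Submodule.span ℂ {w}).comap
      (coeffEquiv ha K : L2Cell a →ₗ[ℂ] SeqSpace (ℤ × ℤ)) := by
    ext u
    rw [mem_eigenspace_iff ha, hbs, Submodule.mem_comap]
    rfl
  have hwne : w ≠ 0 := fun h => by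
    have := w0
    rw [h] at this
    exact zero_ne_one this
  rw [heq, ((coeffEquiv ha K).ofSubmodule' _).finrank_eq, finrank_span_singleton hwne]

/-- The diagonal sum at two energies. -/
theorem diagSum_sub (ha : 0 < a) {k : Plane} {μ μ' : ℝ} (h : ∀ m, den a k (μ : ℂ) m ≠ 0)
    (h' : ∀ m, den a k (μ' : ℂ) m ≠ 0) :
    Summable (fun m => ((free a k m - μ) * (free a k m - μ'))⁻¹) ∧
    diagSum a k μ - diagSum a k μ' =
      (μ - μ') * ∑' m, ((free a k m - μ) * (free a k m - μ'))⁻¹ := by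
  have e : ∀ m, (1 : ℤ × ℤ → ℂ) m * (den a k (μ : ℂ) m * den a k (μ' : ℂ) m)⁻¹ =
      ((((free a k m - μ) * (free a k m - μ'))⁻¹ : ℝ) : ℂ) := fun m => by
    rw [Pi.one_apply, one_mul, den, den]; push_cast; rfl
  have hs := summable_inv_den_mul_inv_den ha (c := 1) (fun m => by simp) h h'
  have hd := latticeSum_sub_same ha (c := 1) (fun m => by simp) h h'
  simp only [e] at hs hd
  refine ⟨Complex.summable_ofReal.1 hs, ?_⟩
  rw [latticeSum_one_ofReal, latticeSum_one_ofReal, ← Complex.ofReal_tsum] at hd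
  exact_mod_cast hd

/-- `(lo, hi)` contains no free eigenvalue at the Dirac point. -/
def IsGap (a lo hi : ℝ) : Prop :=
  ∀ m, free a (diracPoint a) m ≤ lo ∨ hi ≤ free a (diracPoint a) m

theorem IsGap.den_ne_zero {lo hi μ : ℝ} (hg : IsGap a lo hi) (hμ : μ ∈ Set.Ioo lo hi) (m : ℤ × ℤ) :
    den a (diracPoint a) (μ : ℂ) m ≠ 0 := by
  rw [den, ← Complex.ofReal_sub, Ne, Complex.ofReal_eq_zero]
  intro h
  rcases hg m with h1 | h1
  · linarith [hμ.1]
  · linarith [hμ.2]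

/-- Inside a gap every term of the difference is positive, so a single term bounds it below. Any
term gives monotonicity, and the term of an endpoint gives the pole there. -/
theorem IsGap.diagSum_sub_ge (ha : 0 < a) {lo hi μ μ' : ℝ} (hg : IsGap a lo hi)
    (hμ : μ ∈ Set.Ioo lo hi) (hμ' : μ' ∈ Set.Ioo lo hi) (h : μ < μ') (m : ℤ × ℤ) :
    0 < ((free a (diracPoint a) m - μ') * (free a (diracPoint a) m - μ))⁻¹ ∧
    (μ' - μ) * ((free a (diracPoint a) m - μ') * (free a (diracPoint a) m - μ))⁻¹ ≤
      diagSum a (diracPoint a) μ' - diagSum a (diracPoint a) μ := by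
  have hpos : ∀ m, 0 < ((free a (diracPoint a) m - μ') * (free a (diracPoint a) m - μ))⁻¹ :=
      fun m => by
    rw [inv_pos]
    rcases hg m with h1 | h1
    · exact mul_pos_of_neg_of_neg (by linarith [hμ'.1]) (by linarith [hμ.1])
    · exact mul_pos (by linarith [hμ'.2]) (by linarith [hμ.2])
  obtain ⟨hs, hd⟩ := diagSum_sub ha (hg.den_ne_zero hμ') (hg.den_ne_zero hμ)
  refine ⟨hpos m, ?_⟩
  rw [hd]
  exact mul_le_mul_of_nonneg_left (hs.le_tsum m fun j _ => (hpos j).le) (by linarith)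

theorem IsGap.strictMonoOn (ha : 0 < a) {lo hi : ℝ} (hg : IsGap a lo hi) :
    StrictMonoOn (diagSum a (diracPoint a)) (Set.Ioo lo hi) := by
  intro μ hμ μ' hμ' h
  obtain ⟨h1, h2⟩ := hg.diagSum_sub_ge ha hμ hμ' h 0
  have := mul_pos (sub_pos.2 h) h1
  linarith

theorem IsGap.continuousOn (ha : 0 < a) {lo hi : ℝ} (hg : IsGap a lo hi) :
    ContinuousOn (diagSum a (diracPoint a)) (Set.Ioo lo hi) := by
  intro μ hμ
  apply ContinuousAt.continuousWithinAt
  have h1 : Tendsto (fun t : ℝ => (diracPoint a, t)) (𝓝 μ) (𝓝 (diracPoint a, μ)) :=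
    tendsto_const_nhds.prodMk_nhds tendsto_id
  have h2 := (tendsto_diagSum ha (hg.den_ne_zero hμ)).comp h1
  unfold ContinuousAt
  simpa only [Function.comp_def] using h2

/-- `(d - ε)/(εd) = 1/ε - 1/d` is the increment that a pole contributes between the distances `d`
and `ε`. -/
theorem exists_small {d B : ℝ} (hd : 0 < d) :
    ∃ ε : ℝ, 0 < ε ∧ ε < d ∧ B < (d - ε) * (ε * d)⁻¹ := by
  refine ⟨(|B| + 1 + d⁻¹)⁻¹, by positivity, ?_, ?_⟩
  · rw [inv_lt_comm₀ (by positivity) hd]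
    linarith [abs_nonneg B]
  · set t := |B| + 1 + d⁻¹ with ht
    have ht0 : 0 < t := by positivity
    have e : (d - t⁻¹) * (t⁻¹ * d)⁻¹ = t - d⁻¹ := by field_simp
    rw [e]
    linarith [le_abs_self B]

theorem IsGap.exists_lt_diagSum (ha : 0 < a) {lo hi : ℝ} (hg : IsGap a lo hi) (hlh : lo < hi)
    {m : ℤ × ℤ} (hm : free a (diracPoint a) m = hi) (B : ℝ) :
    ∃ μ ∈ Set.Ioo lo hi, B < diagSum a (diracPoint a) μ := by
  set d := (hi - lo) / 2 with hd
  have hd0 : 0 < d := by linarith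
  have hmid : hi - d ∈ Set.Ioo lo hi := ⟨by linarith, by linarith⟩
  obtain ⟨ε, he, hed, hB⟩ := exists_small (B := B - diagSum a (diracPoint a) (hi - d)) hd0
  have hμ : hi - ε ∈ Set.Ioo lo hi := ⟨by linarith, by linarith⟩
  refine ⟨hi - ε, hμ, ?_⟩
  have h := (hg.diagSum_sub_ge ha hmid hμ (by linarith) m).2
  rw [hm, sub_sub_cancel, sub_sub_cancel, sub_sub_sub_cancel_left] at h
  linarith

theorem IsGap.exists_diagSum_lt (ha : 0 < a) {lo hi : ℝ} (hg : IsGap a lo hi) (hlh : lo < hi)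
    {m : ℤ × ℤ} (hm : free a (diracPoint a) m = lo) (B : ℝ) :
    ∃ μ ∈ Set.Ioo lo hi, diagSum a (diracPoint a) μ < B := by
  set d := (hi - lo) / 2 with hd
  have hd0 : 0 < d := by linarith
  have hmid : lo + d ∈ Set.Ioo lo hi := ⟨by linarith, by linarith⟩
  obtain ⟨ε, he, hed, hB⟩ := exists_small (B := diagSum a (diracPoint a) (lo + d) - B) hd0
  have hμ : lo + ε ∈ Set.Ioo lo hi := ⟨by linarith, by linarith⟩
  refine ⟨lo + ε, hμ, ?_⟩
  have h := (hg.diagSum_sub_ge ha hμ hmid (by linarith) m).2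
  have e : (lo - (lo + d)) * (lo - (lo + ε)) = ε * d := by ring
  rw [hm, e, add_sub_add_left_eq_sub] at h
  linarith

theorem IsGap.exists_diagSum_eq (ha : 0 < a) {lo hi B : ℝ} (hg : IsGap a lo hi)
    (h1 : ∃ μ ∈ Set.Ioo lo hi, diagSum a (diracPoint a) μ < B)
    (h2 : ∃ μ ∈ Set.Ioo lo hi, B < diagSum a (diracPoint a) μ) :
    ∃ μ ∈ Set.Ioo lo hi, diagSum a (diracPoint a) μ = B := by
  obtain ⟨x, hx, hx'⟩ := h1
  obtain ⟨y, hy, hy'⟩ := h2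
  have hc := (hg.continuousOn ha).mono ((Set.ordConnected_Ioo.uIcc_subset hx hy))
  obtain ⟨μ, hμ, h⟩ := intermediate_value_uIcc hc (Set.mem_uIcc_of_le hx'.le hy'.le)
  exact ⟨μ, Set.ordConnected_Ioo.uIcc_subset hx hy hμ, h⟩

/-- The first five terms of a monotone sequence with prescribed multiplicities. -/
theorem first_five_eq {f : ℕ+ → ℝ} (hf : Monotone f) {x y z : ℝ} (hxy : x < y) (hyz : y < z)
    (hx : {j | f j = x}.encard = 2) (hy : {j | f j = y}.encard = 1)
    (hz : {j | f j = z}.encard = 2) (hne : ∀ j, f j < z → f j = x ∨ f j = y) :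
    f 1 = x ∧ f 2 = x ∧ f 4 = z ∧ f 5 = z := by
  have p12 : (1 : ℕ+) < 2 := by decide
  have p23 : (2 : ℕ+) < 3 := by decide
  have p34 : (3 : ℕ+) < 4 := by decide
  have p45 : (4 : ℕ+) < 5 := by decide
  have hge : ∀ j, x ≤ f j := fun j => by
    rcases lt_or_ge (f j) z with h | h
    · rcases hne j h with h' | h' <;> linarith
    · linarith
  obtain ⟨i, j, hij, hS⟩ := Set.encard_eq_two.1 hx
  obtain ⟨l, hl⟩ := Set.encard_eq_one.1 hy
  obtain ⟨i', j', hij', hS'⟩ := Set.encard_eq_two.1 hz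
  have mx : ∀ t, f t = x ↔ t = i ∨ t = j := fun t => by
    have : t ∈ {j | f j = x} ↔ t ∈ ({i, j} : Set ℕ+) := by rw [hS]
    simpa using this
  have my : ∀ t, f t = y ↔ t = l := fun t => by
    have : t ∈ {j | f j = y} ↔ t ∈ ({l} : Set ℕ+) := by rw [hl]
    simpa using this
  have mz : ∀ t, f t = z ↔ t = i' ∨ t = j' := fun t => by
    have : t ∈ {j | f j = z} ↔ t ∈ ({i', j'} : Set ℕ+) := by rw [hS']
    simpa using this
  have fi := (mx i).2 (Or.inl rfl)
  have fj := (mx j).2 (Or.inr rfl)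
  have fl := (my l).2 rfl
  have fi' := (mz i').2 (Or.inl rfl)
  have fj' := (mz j').2 (Or.inr rfl)
  have f1 : f 1 = x := le_antisymm ((hf one_le).trans fi.le) (hge 1)
  have f2 : f 2 = x := by
    -- Two distinct indices cannot both be 1; the larger one bounds `f 2` from above.
    have h2 : (2 : ℕ+) ≤ i ∨ (2 : ℕ+) ≤ j := by
      by_contra hcon
      push Not at hcon
      have hi : i = 1 := le_antisymm (PNat.lt_add_one_iff.1 hcon.1) one_le
      have hj : j = 1 := le_antisymm (PNat.lt_add_one_iff.1 hcon.2) one_le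
      exact hij (hi.trans hj.symm)
    rcases h2 with h2 | h2
    · exact le_antisymm ((hf h2).trans fi.le) (hge 2)
    · exact le_antisymm ((hf h2).trans fj.le) (hge 2)
  have f3x : f 3 ≠ x := fun f3 => by
    have h1 := (mx 1).1 f1
    have h2 := (mx 2).1 f2
    have h3 := (mx 3).1 f3
    rcases h1 with h1 | h1 <;> rcases h2 with h2 | h2 <;> rcases h3 with h3 | h3 <;>
      first
        | exact p12.ne (h1.trans h2.symm)
        | exact p23.ne (h2.trans h3.symm)
        | exact (p12.trans p23).ne (h1.trans h3.symm)
  have lt_of : ∀ {t s : ℕ+}, f t < f s → t < s := fun h => hf.reflect_lt h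
  have l3 : 3 ≤ l := by
    have : (2 : ℕ+) < l := lt_of (by rw [f2, fl]; exact hxy)
    exact PNat.add_one_le_iff.2 this
  have f3 : f 3 = y := (hne 3 (((hf l3).trans fl.le).trans_lt hyz)).resolve_left f3x
  have f4y : f 4 ≠ y := fun f4 => p34.ne (((my 3).1 f3).trans ((my 4).1 f4).symm)
  have f4z : z ≤ f 4 := by
    by_contra hcon
    push Not at hcon
    rcases hne 4 hcon with h | h
    · have := hf p34.le
      linarith
    · exact f4y h
  have g4 : ∀ t, f t = z → 4 ≤ t := fun t ht => by
    have : (3 : ℕ+) < t := lt_of (by rw [f3, ht]; exact hyz)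
    exact PNat.add_one_le_iff.2 this
  have hi4 := g4 i' fi'
  have hj4 := g4 j' fj'
  have f4 : f 4 = z := le_antisymm ((hf hi4).trans fi'.le) f4z
  have f5z : z ≤ f 5 := f4z.trans (hf p45.le)
  refine ⟨f1, f2, f4, le_antisymm ?_ f5z⟩
  rcases hi4.eq_or_lt with h | h
  · have h' : 4 < j' := lt_of_le_of_ne hj4 (fun hh => hij' (h.symm.trans hh))
    exact (hf (PNat.add_one_le_iff.2 h')).trans fj'.le
  · exact (hf (PNat.add_one_le_iff.2 h)).trans fi'.le

/-- The two lowest doubly degenerate levels at the Dirac point. -/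
theorem dirac_levels (ha : 0 < a) {α : ℝ} {lam : ℕ+ → ℝ}
    (h : IsEigenvalueSeq a α (diracPoint a) lam) :
    lam 1 = lam 2 ∧ lam 4 = lam 5 ∧
      (∀ m, den a (diracPoint a) (lam 1 : ℂ) m ≠ 0) ∧
      diagSum a (diracPoint a) (lam 1) = coupling ha α ∧
      (∀ m, den a (diracPoint a) (lam 4 : ℂ) m ≠ 0) ∧
      diagSum a (diracPoint a) (lam 4) = coupling ha α := by
  set κ := groundEnergy a with hκ
  have hκ0 : 0 < κ := groundEnergy_pos ha
  have g0 : ∀ lo, IsGap a lo κ := fun lo m => Or.inr (groundEnergy_le_free ha m)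
  have g1 : IsGap a κ (4 * κ) := fun m => (free_dirac_gap ha m).imp_left fun h => h.le
  have e0 : free a (diracPoint a) (0, 0) = κ := (free_dirac_eq_iff ha _).2 (Or.inl rfl)
  -- The label `(0, 1)` has `hexForm` equal to 1, so the upper end of the gap is a pole.
  have e1 : free a (diracPoint a) (0, 1) = 4 * κ := by
    rw [free_dirac ha]; simp [hexForm]; ring
  obtain ⟨s, hs, hslt⟩ := exists_diagSum_dirac_lt ha (coupling ha α)
  obtain ⟨x, hx, hxe⟩ := (g0 (-s - 1)).exists_diagSum_eq ha
    ⟨-s, ⟨by linarith, by linarith⟩, hslt⟩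
    ((g0 (-s - 1)).exists_lt_diagSum ha (by linarith) e0 (coupling ha α))
  obtain ⟨z, hz, hze⟩ := g1.exists_diagSum_eq ha (B := coupling ha α)
    (g1.exists_diagSum_lt ha (by linarith) e0 _) (g1.exists_lt_diagSum ha (by linarith) e1 _)
  have dx := (g0 (-s - 1)).den_ne_zero hx
  have dz := g1.den_ne_zero hz
  have hcard : ∀ μ, {j | lam j = μ}.encard =
      (Module.finrank ℂ (eigenspace a α (diracPoint a) μ) : ℕ∞) := fun μ => (h.2 μ).2
  obtain ⟨f1, f2, f4, f5⟩ := first_five_eq h.1 hx.2 hz.1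
    (by rw [hcard, finrank_eigenspace_dirac ha α dx hxe]; rfl)
    (by rw [hcard, finrank_eigenspace_groundEnergy ha]; rfl)
    (by rw [hcard, finrank_eigenspace_dirac ha α dz hze]; rfl)
    (fun j hj => by
      by_contra hcon
      push Not at hcon
      have hfin : Module.finrank ℂ (eigenspace a α (diracPoint a) (lam j)) = 0 := by
        rcases lt_or_gt_of_ne hcon.2 with hlt | hgt
        -- There is no free energy below `κ`, so the gap may be extended downwards until it contains
        -- both `lam j` and `x`.
        · have hlo : lam j ∈ Set.Ioo (min (-s - 1) (lam j - 1)) κ :=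
            ⟨(min_le_right _ _).trans_lt (by linarith), hlt⟩
          have hx' : x ∈ Set.Ioo (min (-s - 1) (lam j - 1)) κ :=
            ⟨(min_le_left _ _).trans_lt hx.1, hx.2⟩
          refine finrank_eigenspace_dirac_eq_zero ha α ((g0 _).den_ne_zero hlo) fun he => hcon.1 ?_
          exact ((g0 _).strictMonoOn ha).injOn hlo hx' (he.trans hxe.symm)
        · have hlo : lam j ∈ Set.Ioo κ (4 * κ) := ⟨hgt, hj.trans hz.2⟩
          refine finrank_eigenspace_dirac_eq_zero ha α (g1.den_ne_zero hlo) fun he => hj.ne ?_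
          exact (g1.strictMonoOn ha).injOn hlo hz (he.trans hze.symm)
      have hemp := hcard (lam j)
      rw [hfin, Nat.cast_zero, Set.encard_eq_zero] at hemp
      have hjm : j ∈ {i | lam i = lam j} := rfl
      rw [hemp] at hjm
      exact hjm)
  rw [f1, f2, f4, f5]
  exact ⟨rfl, rfl, dx, hxe, dz, hze⟩

end DiracSpectrum

/-! ### First-order expansions at the Dirac point -/

section Expansion

variable {a : ℝ}

/-- The weights `(|ξ_m + K|² - z)⁻²`. -/
def invSq (a : ℝ) (z : ℂ) (m : ℤ × ℤ) : ℂ := (den a (diracPoint a) z m ^ 2)⁻¹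

theorem invSq_rot (ha : 0 < a) (z : ℂ) (m : ℤ × ℤ) : invSq a z (rot m) = invSq a z m := by
  rw [invSq, invSq, den, den, free_dirac_rot ha]

theorem summable_mul_invSq (ha : 0 < a) {z : ℂ} (h : ∀ m, den a (diracPoint a) z m ≠ 0)
    {q : ℤ × ℤ → ℂ} {C : ℝ} (hq : ∀ m, ‖q m‖ ≤ C * √(weight a m)) :
    Summable fun m => q m * invSq a z m := by
  obtain ⟨c, hc, h'⟩ := exists_mul_weight_le_norm_den ha h
  refine Summable.of_norm_bounded ((summable_weight ha).mul_left (C / c ^ 2)) fun m => ?_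
  have hw := weight_pos a m
  have hs : 0 < √(weight a m) := Real.sqrt_pos.2 hw
  have h1 : ‖invSq a z m‖ ≤ (c ^ 2 * weight a m ^ 2)⁻¹ := by
    rw [invSq, norm_inv, norm_pow, ← mul_pow]
    exact inv_anti₀ (by positivity) (pow_le_pow_left₀ (by positivity) (h' m) 2)
  have h2 : C * √(weight a m) * (c ^ 2 * weight a m ^ 2)⁻¹ =
      C / c ^ 2 * (weight a m * √(weight a m))⁻¹ := by
    have e : weight a m ^ 2 = weight a m * √(weight a m) * √(weight a m) := by
      rw [mul_assoc, sqrt_weight_mul_self, sq]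
    rw [e]
    field_simp
  rw [norm_mul, ← h2]
  exact mul_le_mul (hq m) h1 (norm_nonneg _) ((norm_nonneg _).trans (hq m))

/-- The coordinates of `ξ_m + K` with respect to the dual basis. -/
def dualCoord (m : ℤ × ℤ) : ℂ × ℂ := (m.1 + 2 / 3, m.2 + 1 / 3)

theorem dualCoord_rot (m : ℤ × ℤ) :
    (dualCoord (rot m)).1 = -(dualCoord m).2 ∧
      (dualCoord (rot m)).2 = (dualCoord m).1 - (dualCoord m).2 := by
  simp only [dualCoord, rot, Equiv.coe_fn_mk]
  push_cast
  constructor <;> ring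

theorem exists_norm_dualCoord_le (ha : 0 < a) : ∃ C : ℝ, ∀ m : ℤ × ℤ,
    ‖(m.1 : ℂ)‖ ≤ C * √(weight a m) ∧ ‖(dualCoord m).1‖ ≤ C * √(weight a m) ∧
      ‖(dualCoord m).2‖ ≤ C * √(weight a m) := by
  obtain ⟨C, hC, h⟩ := norm_le_sqrt_weight ha
  refine ⟨C + 1, fun m => ?_⟩
  have hs := one_le_sqrt_weight a m
  have h1 : ‖(m.1 : ℂ)‖ ≤ C * √(weight a m) := by
    rw [Complex.norm_intCast, ← Int.norm_eq_abs]
    exact (norm_fst_le m).trans (h m)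
  have h2 : ‖(m.2 : ℂ)‖ ≤ C * √(weight a m) := by
    rw [Complex.norm_intCast, ← Int.norm_eq_abs]
    exact (norm_snd_le m).trans (h m)
  have e1 : ‖(2 / 3 : ℂ)‖ ≤ 1 := by norm_num
  have e2 : ‖(1 / 3 : ℂ)‖ ≤ 1 := by norm_num
  refine ⟨by linarith, ?_, ?_⟩
  · have := norm_add_le (m.1 : ℂ) (2 / 3)
    simp only [dualCoord]
    linarith
  · have := norm_add_le (m.2 : ℂ) (1 / 3)
    simp only [dualCoord]
    linarith

theorem summable_dualCoord (ha : 0 < a) {z : ℂ} (h : ∀ m, den a (diracPoint a) z m ≠ 0)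
    {c : ℤ × ℤ → ℂ} (hc : ∀ m, ‖c m‖ = 1) :
    Summable (fun m => c m * (dualCoord m).1 * invSq a z m) ∧
      Summable (fun m => c m * (dualCoord m).2 * invSq a z m) := by
  obtain ⟨C, hC⟩ := exists_norm_dualCoord_le ha
  exact ⟨summable_mul_invSq ha h fun m => by rw [norm_mul, hc, one_mul]; exact (hC m).2.1,
    summable_mul_invSq ha h fun m => by rw [norm_mul, hc, one_mul]; exact (hC m).2.2⟩

/-- The vector of the two sums is fixed by the rotation, which acts on coordinates without the
eigenvalue 1. -/
theorem tsum_dualCoord (ha : 0 < a) {z : ℂ} (h : ∀ m, den a (diracPoint a) z m ≠ 0) :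
    ∑' m, (1 : ℤ × ℤ → ℂ) m * (dualCoord m).1 * invSq a z m = 0 ∧
      ∑' m, (1 : ℤ × ℤ → ℂ) m * (dualCoord m).2 * invSq a z m = 0 := by
  obtain ⟨s1, s2⟩ := summable_dualCoord ha h (c := 1) (fun m => by simp)
  set X := ∑' m, (1 : ℤ × ℤ → ℂ) m * (dualCoord m).1 * invSq a z m with hX
  set Y := ∑' m, (1 : ℤ × ℤ → ℂ) m * (dualCoord m).2 * invSq a z m with hY
  have e1 : X = -Y := by
    rw [hX, ← rot.tsum_eq, hY, ← tsum_neg]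
    refine tsum_congr fun m => ?_
    rw [(dualCoord_rot m).1, invSq_rot ha, Pi.one_apply, Pi.one_apply]
    ring
  have e2 : Y = X - Y := by
    conv_lhs => rw [hY, ← rot.tsum_eq]
    rw [hX, hY, ← s1.tsum_sub s2]
    refine tsum_congr fun m => ?_
    rw [(dualCoord_rot m).2, invSq_rot ha, Pi.one_apply, Pi.one_apply]
    ring
  constructor
  · linear_combination (2 / 3 : ℂ) * e1 - (1 / 3 : ℂ) * e2
  · linear_combination (1 / 3 : ℂ) * e1 + (1 / 3 : ℂ) * e2

/-- With the phase inserted, the vector of sums is an eigenvector of the rotation, so one sum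
determines the other. -/
theorem tsum_hexPhase_dualCoord (ha : 0 < a) (z : ℂ) :
    ∑' m, hexPhase m * (dualCoord m).2 * invSq a z m =
      -cubeRoot ^ 2 * ∑' m, hexPhase m * (dualCoord m).1 * invSq a z m := by
  set X := ∑' m, hexPhase m * (dualCoord m).1 * invSq a z m with hX
  set Y := ∑' m, hexPhase m * (dualCoord m).2 * invSq a z m with hY
  have e1 : X = -cubeRoot * Y := by
    rw [hX, ← rot.tsum_eq, hY, ← tsum_mul_left]
    refine tsum_congr fun m => ?_
    rw [(dualCoord_rot m).1, invSq_rot ha, hexPhase_rot]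
    ring
  rw [e1]
  linear_combination -Y * cubeRoot_cubed

/-- The shift by `2/3` multiplies a radial sum with phase, which is zero. This is why the slope
contains `m₁` alone. -/
theorem tsum_hexPhase_dualCoord_fst (ha : 0 < a) {z : ℂ}
    (h : ∀ m, den a (diracPoint a) z m ≠ 0) :
    ∑' m, hexPhase m * (dualCoord m).1 * invSq a z m =
      ∑' m : ℤ × ℤ, (m.1 : ℂ) * hexPhase m * invSq a z m := by
  obtain ⟨C, hC⟩ := exists_norm_dualCoord_le ha
  have s1 : Summable fun m : ℤ × ℤ => (m.1 : ℂ) * hexPhase m * invSq a z m :=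
    summable_mul_invSq ha h fun m => by rw [norm_mul, norm_hexPhase, mul_one]; exact (hC m).1
  have s2 : Summable fun m : ℤ × ℤ => hexPhase m * invSq a z m :=
    summable_mul_invSq ha h (C := 1) fun m => by
      rw [norm_hexPhase, one_mul]; exact one_le_sqrt_weight a m
  have hz : ∑' m : ℤ × ℤ, hexPhase m * invSq a z m = 0 :=
    tsum_hexPhase_mul ha fun x => (((x : ℂ) - z) ^ 2)⁻¹
  have e : ∀ m : ℤ × ℤ, hexPhase m * (dualCoord m).1 * invSq a z m =
      (m.1 : ℂ) * hexPhase m * invSq a z m + 2 / 3 * (hexPhase m * invSq a z m) := fun m => by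
    rw [dualCoord]; ring
  rw [tsum_congr e, s1.tsum_add (s2.mul_left _), tsum_mul_left, hz, mul_zero, add_zero]

/-- The derivative of a lattice sum with respect to the quasi-momentum at the Dirac point. -/
def linearPart (a : ℝ) (c : ℤ × ℤ → ℂ) (z : ℂ) (d : Plane) : ℂ :=
  (inner ℝ (k₁ a) d : ℝ) * (∑' m, c m * (dualCoord m).1 * invSq a z m) +
    (inner ℝ (k₂ a) d : ℝ) * ∑' m, c m * (dualCoord m).2 * invSq a z m

theorem hasSum_linearPart (ha : 0 < a) {z : ℂ} (h : ∀ m, den a (diracPoint a) z m ≠ 0)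
    {c : ℤ × ℤ → ℂ} (hc : ∀ m, ‖c m‖ = 1) (d : Plane) :
    HasSum (fun m => c m * ((inner ℝ (ξ a m + diracPoint a) d : ℝ) * invSq a z m))
      (linearPart a c z d) := by
  obtain ⟨s1, s2⟩ := summable_dualCoord ha h hc
  refine ((s1.hasSum.mul_left _).add (s2.hasSum.mul_left _)).congr_fun fun m => ?_
  rw [inner_add_dirac, dualCoord]
  push_cast
  ring

theorem inner_dual_sq (ha : 0 < a) (d : Plane) :
    (inner ℝ (k₁ a) d) ^ 2 + (inner ℝ (k₂ a) d) ^ 2 + inner ℝ (k₁ a) d * inner ℝ (k₂ a) d =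
      (2 * Real.pi / a * ‖d‖) ^ 2 := by
  have h3 : √3 ^ 2 = 3 := Real.sq_sqrt (by norm_num)
  have hs : √3 ≠ 0 := by positivity
  have hn : ‖d‖ ^ 2 = d 0 ^ 2 + d 1 ^ 2 := by
    rw [← real_inner_self_eq_norm_sq, inner_plane]; ring
  rw [mul_pow, hn, inner_plane, inner_plane]
  simp only [k₁, k₂, PiLp.toLp_apply, Matrix.cons_val_zero, Matrix.cons_val_one]
  field_simp
  rw [h3]
  ring_nf
  rw [h3]
  ring

/-- The linear part is the sum times `p - ω²r`, with `p = k₁·d`, `r = k₂·d` and `ω = cubeRoot`. Its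
squared modulus `p² + pr + r²` is isotropic by `inner_dual_sq`, hence the slope does not depend on
direction. -/
theorem norm_linearPart_hexPhase (ha : 0 < a) {z : ℂ} (h : ∀ m, den a (diracPoint a) z m ≠ 0)
    (d : Plane) : ‖linearPart a hexPhase z d‖ =
      2 * Real.pi / a * ‖∑' m : ℤ × ℤ, (m.1 : ℂ) * hexPhase m * invSq a z m‖ * ‖d‖ := by
  rw [linearPart, tsum_hexPhase_dualCoord ha, tsum_hexPhase_dualCoord_fst ha h]
  set X := ∑' m : ℤ × ℤ, (m.1 : ℂ) * hexPhase m * invSq a z m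
  set p : ℝ := inner ℝ (k₁ a) d with hp
  set r : ℝ := inner ℝ (k₂ a) d with hr
  have e : (p : ℂ) * X + r * (-cubeRoot ^ 2 * X) = X * (p - r * cubeRoot ^ 2) := by ring
  have h3 : √3 ^ 2 = 3 := Real.sq_sqrt (by norm_num)
  have e2 : ((p : ℂ) - r * cubeRoot ^ 2) = ((p + r / 2 : ℝ) : ℂ) + ((r * √3 / 2 : ℝ) : ℂ) *
      Complex.I := by
    have h1 : cubeRoot ^ 2 = -1 - cubeRoot := by linear_combination cubeRoot_sq_add
    rw [h1, cubeRoot_eq]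
    push_cast
    ring
  have hnorm : ‖(p : ℂ) - r * cubeRoot ^ 2‖ = 2 * Real.pi / a * ‖d‖ := by
    rw [← sq_eq_sq₀ (norm_nonneg _) (by positivity), ← inner_dual_sq ha, ← hp, ← hr, e2,
      ← Complex.normSq_eq_norm_sq, Complex.normSq_add_mul_I]
    linear_combination (r ^ 2 / 4) * h3
  rw [e, norm_mul, hnorm]
  ring

/-- No first-order term in the diagonal sum means that the cone is not tilted. -/
theorem linearPart_one (ha : 0 < a) {z : ℂ} (h : ∀ m, den a (diracPoint a) z m ≠ 0)
    (d : Plane) : linearPart a 1 z d = 0 := by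
  obtain ⟨h1, h2⟩ := tsum_dualCoord ha h
  rw [linearPart, h1, h2, mul_zero, mul_zero, add_zero]

/-- Taylor's formula for the reciprocal with exact remainder. The energy shift `t` has a part `u`
linear in `k - K` and a part `v` quadratic in it, and `v` goes into the remainder. -/
theorem inv_sub_inv_add_eq {E E' t u v : ℂ} (hE : E ≠ 0) (hE' : E' ≠ 0) (ht : E' - E = t)
    (huv : t = u + v) :
    E'⁻¹ - E⁻¹ + u * (E ^ 2)⁻¹ = t ^ 2 * (E ^ 2 * E')⁻¹ - v * (E ^ 2)⁻¹ := by
  have h1 : u = t - v := by rw [huv]; ring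
  obtain rfl : E' = E + t := by rw [← ht]; ring
  rw [h1]
  field_simp
  ring

/-- First-order expansion of the lattice sums at the Dirac point. -/
theorem latticeSum_expansion (ha : 0 < a) {z : ℂ} (h : ∀ m, den a (diracPoint a) z m ≠ 0)
    {c : ℤ × ℤ → ℂ} (hc : ∀ m, ‖c m‖ = 1) : ∃ C : ℝ, ∀ᶠ k in 𝓝 (diracPoint a),
      ‖latticeSum a c k z - latticeSum a c (diracPoint a) z +
        2 * linearPart a c z (k - diracPoint a)‖ ≤ C * ‖k - diracPoint a‖ ^ 2 := by
  obtain ⟨c₀, hc₀, h0⟩ := eventually_mul_weight_le_norm_den ha h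
  have hK := h0.self_of_nhds
  have hsec : Tendsto (fun k : Plane => (k, z)) (𝓝 (diracPoint a)) (𝓝 (diracPoint a, z)) :=
    tendsto_id.prodMk_nhds tendsto_const_nhds
  have hnear : ∀ᶠ k in 𝓝 (diracPoint a), ‖k - diracPoint a‖ < 1 := by
    have hc : Continuous fun k : Plane => ‖k - diracPoint a‖ := by fun_prop
    exact (hc.tendsto (diracPoint a)).eventually_lt_const (by simp)
  -- For `δ < 1` the shift is at most `3δ√w`, whose square gives the 9; the quadratic part `δ²`
  -- gives the second summand.
  refine ⟨(9 / c₀ ^ 3 + 1 / c₀ ^ 2) * ∑' m, (weight a m ^ 2)⁻¹, ?_⟩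
  filter_upwards [hsec.eventually h0, hnear] with k hk hδ
  set δ := ‖k - diracPoint a‖ with hδd
  have hδ0 : 0 ≤ δ := norm_nonneg _
  have hk0 := den_ne_zero_of_le hc₀ hk
  obtain ⟨hs, hd⟩ := latticeSum_sub ha hc hk0 h
  have hsum := hs.hasSum.add ((hasSum_linearPart ha h hc (k - diracPoint a)).mul_left 2)
  rw [hd, ← hsum.tsum_eq, mul_right_comm, ← tsum_mul_left]
  refine tsum_of_norm_bounded ((summable_inv_weight_sq ha).mul_left _).hasSum fun m => ?_
  have hw := weight_pos a m
  set w := weight a m with hwd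
  set E := den a (diracPoint a) z m with hE
  set E' := den a k z m with hE'
  set t := free a k m - free a (diracPoint a) m with ht
  have hEE : E' - E = (t : ℂ) := by rw [hE, hE', ht, den, den]; push_cast; ring
  have hkm : c₀ * w ≤ ‖E'‖ := hk m
  have hKm : c₀ * w ≤ ‖E‖ := hK m
  have htt : (t : ℂ) = ((2 * inner ℝ (ξ a m + diracPoint a) (k - diracPoint a) : ℝ) : ℂ) +
      ((δ ^ 2 : ℝ) : ℂ) := by
    rw [ht, free_sub_dirac, ← Complex.ofReal_add]
  have hid := inv_sub_inv_add_eq (h m) (hk0 m) hEE htt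
  have e : c m * (E'⁻¹ - E⁻¹) + 2 * (c m * ((inner ℝ (ξ a m + diracPoint a)
      (k - diracPoint a) : ℝ) * invSq a z m)) =
      c m * ((t : ℂ) ^ 2 * (E ^ 2 * E')⁻¹ - ((δ ^ 2 : ℝ) : ℂ) * (E ^ 2)⁻¹) := by
    rw [← hid, invSq]
    push_cast
    ring
  rw [e, norm_mul, hc, one_mul]
  have htb : t ^ 2 ≤ 9 * δ ^ 2 * w := by
    have h1 : |t| ≤ 3 * δ * √w := (abs_free_sub_dirac_le a k m).trans
      (mul_le_mul_of_nonneg_right (by nlinarith) (Real.sqrt_nonneg _))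
    rw [← sq_abs]
    calc |t| ^ 2 ≤ (3 * δ * √w) ^ 2 := pow_le_pow_left₀ (abs_nonneg _) h1 2
      _ = 9 * δ ^ 2 * w := by rw [mul_pow, Real.sq_sqrt hw.le]; ring
  have b1 : ‖(t : ℂ) ^ 2 * (E ^ 2 * E')⁻¹‖ ≤ 9 * δ ^ 2 * w * ((c₀ * w) ^ 2 * (c₀ * w))⁻¹ := by
    rw [norm_mul, norm_pow, Complex.norm_real, Real.norm_eq_abs, sq_abs, norm_inv, norm_mul,
      norm_pow]
    gcongr
  have b2 : ‖((δ ^ 2 : ℝ) : ℂ) * (E ^ 2)⁻¹‖ ≤ δ ^ 2 * ((c₀ * w) ^ 2)⁻¹ := by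
    rw [norm_mul, Complex.norm_real, Real.norm_of_nonneg (sq_nonneg δ), norm_inv, norm_pow]
    gcongr
  refine (norm_sub_le _ _).trans ((add_le_add b1 b2).trans (le_of_eq ?_))
  field_simp

/-- Dominated convergence for the difference quotients of the lattice sums. -/
theorem tendsto_tsum_inv_den_mul_inv_den (ha : 0 < a) {c : ℤ × ℤ → ℂ} (hc : ∀ m, ‖c m‖ = 1)
    {ν : ℝ} (h : ∀ m, den a (diracPoint a) (ν : ℂ) m ≠ 0) {y y' : Plane → ℝ}
    (hy : Tendsto y (𝓝 (diracPoint a)) (𝓝 ν)) (hy' : Tendsto y' (𝓝 (diracPoint a)) (𝓝 ν)) :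
    Tendsto (fun k => ∑' m, c m * (den a k (y k : ℂ) m * den a k (y' k : ℂ) m)⁻¹)
      (𝓝 (diracPoint a)) (𝓝 (∑' m, c m * invSq a ν m)) := by
  obtain ⟨c₀, hc₀, h0⟩ := eventually_mul_weight_le_norm_den ha h
  have hsec : ∀ {x : Plane → ℝ}, Tendsto x (𝓝 (diracPoint a)) (𝓝 ν) →
      Tendsto (fun k => (k, (x k : ℂ))) (𝓝 (diracPoint a)) (𝓝 (diracPoint a, (ν : ℂ))) :=
    fun hx => tendsto_id.prodMk_nhds ((Complex.continuous_ofReal.tendsto ν).comp hx)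
  refine tendsto_tsum_of_dominated_convergence ((summable_inv_weight_sq ha).mul_left (c₀ ^ 2)⁻¹)
    (fun m => ?_) ?_
  · have hden : ∀ {x : Plane → ℝ}, Tendsto x (𝓝 (diracPoint a)) (𝓝 ν) →
        Tendsto (fun k => den a k (x k : ℂ) m) (𝓝 (diracPoint a))
          (𝓝 (den a (diracPoint a) (ν : ℂ) m)) := fun {x} hx => by
      have hf : Continuous fun k : Plane => (free a k m : ℂ) := by
        unfold free; fun_prop
      exact (hf.tendsto (diracPoint a)).sub ((Complex.continuous_ofReal.tendsto ν).comp hx)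
    have := (((hden hy).mul (hden hy')).inv₀ (mul_ne_zero (h m) (h m))).const_mul (c m)
    rwa [← sq] at this
  · filter_upwards [(hsec hy).eventually h0, (hsec hy').eventually h0] with k h1 h2 m
    have hw := weight_pos a m
    rw [norm_mul, hc, one_mul, norm_inv, norm_mul, ← mul_inv]
    refine inv_anti₀ (by positivity) ?_
    calc c₀ ^ 2 * weight a m ^ 2 = (c₀ * weight a m) * (c₀ * weight a m) := by ring
      _ ≤ _ := mul_le_mul (h1 m) (h2 m) (by positivity) (norm_nonneg _)

/-- Differentiability in the energy in its strict form: both energies may vary with `k`, as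
comparing two branches requires. -/
theorem latticeSum_sub_isLittleO (ha : 0 < a) {c : ℤ × ℤ → ℂ} (hc : ∀ m, ‖c m‖ = 1)
    {ν : ℝ} (h : ∀ m, den a (diracPoint a) (ν : ℂ) m ≠ 0) {y y' : Plane → ℝ}
    (hy : Tendsto y (𝓝 (diracPoint a)) (𝓝 ν)) (hy' : Tendsto y' (𝓝 (diracPoint a)) (𝓝 ν)) :
    (fun k => latticeSum a c k (y k) - latticeSum a c k (y' k) -
      (∑' m, c m * invSq a ν m) * ((y k - y' k : ℝ) : ℂ)) =o[𝓝 (diracPoint a)]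
      fun k => y k - y' k := by
  obtain ⟨c₀, hc₀, h0⟩ := eventually_mul_weight_le_norm_den ha h
  have hsec : ∀ {x : Plane → ℝ}, Tendsto x (𝓝 (diracPoint a)) (𝓝 ν) →
      Tendsto (fun k => (k, (x k : ℂ))) (𝓝 (diracPoint a)) (𝓝 (diracPoint a, (ν : ℂ))) :=
    fun hx => tendsto_id.prodMk_nhds ((Complex.continuous_ofReal.tendsto ν).comp hx)
  have hlim := (tendsto_tsum_inv_den_mul_inv_den ha hc h hy hy').sub_const
    (∑' m, c m * invSq a ν m)
  rw [sub_self] at hlim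
  rw [isLittleO_iff]
  intro ε hε
  filter_upwards [(hsec hy).eventually h0, (hsec hy').eventually h0,
    (Metric.tendsto_nhds.1 hlim) ε hε] with k h1 h2 h3
  rw [dist_zero_right] at h3
  rw [latticeSum_sub_same ha hc (den_ne_zero_of_le hc₀ h1) (den_ne_zero_of_le hc₀ h2),
    ← Complex.ofReal_sub, mul_comm, ← sub_mul, norm_mul, Complex.norm_real]
  exact mul_le_mul_of_nonneg_right h3.le (norm_nonneg _)

end Expansion

/-! ### Abstract analysis of conical branches -/

section Branches

/-- The distance of a solution of `|β - D| = |G|` from the apex of a cone. -/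
theorem conical_distance {X : Type*} {l : Filter X} {δ x : X → ℝ} {D : X → ℝ → ℝ}
    {G : X → ℝ → ℂ} {β ν S ℓ : ℝ} (hS : 0 < S) (hℓ : 0 ≤ ℓ) (hδ : ∀ k, 0 ≤ δ k)
    (hD : (fun k => D k (x k) - D k ν - S * (x k - ν)) =o[l] fun k => x k - ν)
    (hG : (fun k => G k (x k) - G k ν) =o[l] fun k => x k - ν)
    (hDν : (fun k => D k ν - β) =o[l] δ) (hGν : (fun k => ‖G k ν‖ - ℓ * δ k) =o[l] δ)
    (hsec : ∀ᶠ k in l, |β - D k (x k)| = ‖G k (x k)‖) :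
    (fun k => |x k - ν| - ℓ / S * δ k) =o[l] δ := by
  rw [isLittleO_iff]
  intro η hη
  set C := 2 / S * (ℓ + S / 2) with hC
  have hC0 : 0 ≤ C := by positivity
  -- The first bound absorbs the `|y|` terms and gives the a priori estimate `|y| ≤ C δ`; the second
  -- turns that estimate into the final error `η δ`.
  set ε := min (S / 4) (η * S / (2 * (C + 1))) with hε
  have hε0 : 0 < ε := lt_min (by positivity) (by positivity)
  filter_upwards [hsec, hD.def hε0, hDν.def hε0, hGν.def hε0,
    hG.def hε0] with k e0 e1 e2 e3 e4
  simp only [Real.norm_eq_abs] at e1 e2 e3 e4 ⊢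
  set y := x k - ν with hy
  have hd0 := hδ k
  rw [abs_of_nonneg hd0] at e2 e3 ⊢
  have hεS : ε ≤ S / 4 := min_le_left _ _
  have hεη : ε * (2 * (C + 1)) ≤ η * S :=
    (le_div_iff₀ (by positivity)).1 (min_le_right _ _)
  have hy0 := abs_nonneg y
  have f1 : abs (S * |y| - |β - D k (x k)|) ≤ ε * |y| + ε * δ k := by
    have e : S * |y| = |S * y| := by rw [abs_mul, abs_of_pos hS]
    rw [e, abs_sub_comm β]
    refine (abs_abs_sub_abs_le _ _).trans ?_
    have e' : S * y - (D k (x k) - β) = -(D k (x k) - D k ν - S * y) - (D k ν - β) := by ring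
    rw [e']
    refine (abs_sub _ _).trans ?_
    rw [abs_neg]
    exact add_le_add e1 e2
  have f2 : |‖G k (x k)‖ - ℓ * δ k| ≤ ε * |y| + ε * δ k := by
    have e : ‖G k (x k)‖ - ℓ * δ k = (‖G k (x k)‖ - ‖G k ν‖) + (‖G k ν‖ - ℓ * δ k) := by ring
    rw [e]
    refine (abs_add_le _ _).trans (add_le_add ?_ e3)
    exact (abs_norm_sub_norm_le _ _).trans e4
  rw [e0] at f1
  have f3 : abs (S * |y| - ℓ * δ k) ≤ 2 * (ε * |y| + ε * δ k) := by
    have e : S * |y| - ℓ * δ k = (S * |y| - ‖G k (x k)‖) + (‖G k (x k)‖ - ℓ * δ k) := by ring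
    rw [e]
    refine (abs_add_le _ _).trans ?_
    linarith
  have f4 : |y| ≤ C * δ k := by
    have g1 := (abs_le.1 f3).2
    have g2 : ε * |y| ≤ S / 4 * |y| := mul_le_mul_of_nonneg_right hεS hy0
    have g3 : ε * δ k ≤ S / 4 * δ k := mul_le_mul_of_nonneg_right hεS hd0
    have g4 : S / 2 * |y| ≤ (ℓ + S / 2) * δ k := by linarith
    have e : C * δ k = 2 / S * ((ℓ + S / 2) * δ k) := by rw [hC]; ring
    have e' : |y| = 2 / S * (S / 2 * |y|) := by field_simp
    rw [e, e']
    exact mul_le_mul_of_nonneg_left g4 (by positivity)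
  have f5 : abs (S * |y| - ℓ * δ k) ≤ S * (η * δ k) := by
    refine f3.trans ?_
    calc 2 * (ε * |y| + ε * δ k) ≤ 2 * (ε * (C * δ k) + ε * δ k) := by gcongr
      _ = ε * (2 * (C + 1)) * δ k := by ring
      _ ≤ η * S * δ k := mul_le_mul_of_nonneg_right hεη hd0
      _ = S * (η * δ k) := by ring
  have e : |y| - ℓ / S * δ k = S⁻¹ * (S * |y| - ℓ * δ k) := by field_simp
  rw [e, abs_mul, abs_of_pos (inv_pos.2 hS), inv_mul_le_iff₀ hS]
  exact f5

/-- Two branches of solutions of `|β - D| = |G|` near a conical point. -/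
theorem conical_branches {X : Type*} {l : Filter X} {δ x₁ x₂ : X → ℝ} {D : X → ℝ → ℝ}
    {G : X → ℝ → ℂ} {β ν S ℓ : ℝ} (hS : 0 < S) (hℓ : 0 ≤ ℓ) (hδ : ∀ k, 0 ≤ δ k)
    (hD : ∀ y y' : X → ℝ, Tendsto y l (𝓝 ν) → Tendsto y' l (𝓝 ν) →
      (fun k => D k (y k) - D k (y' k) - S * (y k - y' k)) =o[l] fun k => y k - y' k)
    (hG : ∀ y y' : X → ℝ, Tendsto y l (𝓝 ν) → Tendsto y' l (𝓝 ν) →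
      (fun k => G k (y k) - G k (y' k)) =o[l] fun k => y k - y' k)
    (hDν : (fun k => D k ν - β) =o[l] δ) (hGν : (fun k => ‖G k ν‖ - ℓ * δ k) =o[l] δ)
    (hx₁ : Tendsto x₁ l (𝓝 ν)) (hx₂ : Tendsto x₂ l (𝓝 ν)) (hle : ∀ k, x₁ k ≤ x₂ k)
    (h₁ : ∀ᶠ k in l, |β - D k (x₁ k)| = ‖G k (x₁ k)‖)
    (h₂ : ∀ᶠ k in l, |β - D k (x₂ k)| = ‖G k (x₂ k)‖)
    (h₁₂ : ∀ᶠ k in l, x₁ k = x₂ k → D k (x₁ k) = β) :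
    (fun k => x₁ k - ν - -(ℓ / S) * δ k) =o[l] δ ∧ (fun k => x₂ k - ν - ℓ / S * δ k) =o[l] δ := by
  have a1 := conical_distance hS hℓ hδ (hD x₁ _ hx₁ tendsto_const_nhds)
    (hG x₁ _ hx₁ tendsto_const_nhds) hDν hGν h₁
  have a2 := conical_distance hS hℓ hδ (hD x₂ _ hx₂ tendsto_const_nhds)
    (hG x₂ _ hx₂ tendsto_const_nhds) hDν hGν h₂
  -- The distances are known, so only the signs are missing: `x₁` below `ν` and `x₂` above.
  suffices hsign : ∀ᶠ k in l, (|x₁ k - ν - -(ℓ / S) * δ k| = abs (|x₁ k - ν| - ℓ / S * δ k)) ∧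
      |x₂ k - ν - ℓ / S * δ k| = abs (|x₂ k - ν| - ℓ / S * δ k) by
    constructor
    · rw [isLittleO_iff] at a1 ⊢
      intro ε hε
      filter_upwards [a1 hε, hsign] with k h3 h4
      rw [Real.norm_eq_abs] at h3 ⊢
      rw [h4.1]
      exact h3
    · rw [isLittleO_iff] at a2 ⊢
      intro ε hε
      filter_upwards [a2 hε, hsign] with k h3 h4
      rw [Real.norm_eq_abs] at h3 ⊢
      rw [h4.2]
      exact h3
  -- For `ℓ = 0` the signs do not matter.
  rcases hℓ.eq_or_lt with hℓ0 | hℓ0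
  · refine Eventually.of_forall fun k => ?_
    rw [← hℓ0]
    simp
  set c := ℓ / S with hc
  have hc0 : 0 < c := div_pos hℓ0 hS
  -- Since `δ ≤ (2/c)|x - ν|`, the errors add up to `ε(1 + 2/c)|x - ν| = (S/4)|x - ν|`, too small to
  -- change the sign of `S(x - ν)`.
  set ε := S / 2 / (1 + 2 / c) / 2 with hε
  have hε0 : 0 < ε := by positivity
  have hεS : ε * (1 + 2 / c) < S / 2 := by
    rw [hε]
    have : S / 2 / (1 + 2 / c) / 2 * (1 + 2 / c) = S / 4 := by field_simp; norm_num
    linarith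
  have hc2 : 0 < c / 2 := by positivity
  have hS4 : 0 < S / 4 := by positivity
  filter_upwards [a1.def hc2, a2.def hc2, (hD x₁ _ hx₁ tendsto_const_nhds).def hε0,
    (hD x₂ _ hx₂ tendsto_const_nhds).def hε0, hDν.def hε0, (hD x₁ x₂ hx₁ hx₂).def hS4,
    (hG x₁ x₂ hx₁ hx₂).def hS4, h₁, h₂, h₁₂] with k b1 b2 d1 d2 dν d12 g12 q1 q2 q12
  simp only [Real.norm_eq_abs] at b1 b2 d1 d2 dν d12 g12
  have hd0 := hδ k
  rw [abs_of_nonneg hd0] at b1 b2 dν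
  have hlek := hle k
  set y₁ := x₁ k - ν with hy₁
  set y₂ := x₂ k - ν with hy₂
  have hyy : y₁ ≤ y₂ := sub_le_sub_right hlek ν
  have hlow : ∀ y : ℝ, abs (|y| - c * δ k) ≤ c / 2 * δ k → δ k ≤ 2 / c * |y| := fun y hb => by
    have := (abs_le.1 hb).1
    have h1 : c / 2 * δ k ≤ |y| := by linarith
    have e : δ k = 2 / c * (c / 2 * δ k) := by field_simp
    rw [e]
    exact mul_le_mul_of_nonneg_left h1 (by positivity)
  have l1 := hlow y₁ b1
  have l2 := hlow y₂ b2
  -- Away from `ν`, `D - β` has the sign of `x - ν`.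
  have near : ∀ x : ℝ, δ k ≤ 2 / c * |x - ν| →
      |D k x - D k ν - S * (x - ν)| ≤ ε * |x - ν| → x - ν ≠ 0 →
      |D k x - β - S * (x - ν)| < S / 2 * |x - ν| := fun x hl hd hx0 => by
    have e : D k x - β - S * (x - ν) = (D k x - D k ν - S * (x - ν)) + (D k ν - β) := by ring
    rw [e]
    refine (abs_add_le _ _).trans_lt ?_
    have hpos : 0 < |x - ν| := abs_pos.2 hx0
    calc |D k x - D k ν - S * (x - ν)| + |D k ν - β| ≤ ε * |x - ν| + ε * δ k := add_le_add hd dν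
      _ ≤ ε * |x - ν| + ε * (2 / c * |x - ν|) := by gcongr
      _ = ε * (1 + 2 / c) * |x - ν| := by ring
      _ < S / 2 * |x - ν| := mul_lt_mul_of_pos_right hεS hpos
  have hdiff : abs (|β - D k (x₁ k)| - |β - D k (x₂ k)|) ≤ S / 4 * |x₁ k - x₂ k| := by
    rw [q1, q2]
    exact (abs_norm_sub_norm_le _ _).trans g12
  -- If `D - β` has the same sign on both branches, then `|D(x₁) - D(x₂)|` equals the difference of
  -- the `|G|`, at most `(S/4)|x₁ - x₂|`. As `D` has slope nearly `S`, the branches coincide.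
  have same : abs (|β - D k (x₁ k)| - |β - D k (x₂ k)|) = |D k (x₁ k) - D k (x₂ k)| →
      D k (x₁ k) = β := fun hsame => by
    apply q12
    rw [hsame] at hdiff
    have h3 : |S * (x₁ k - x₂ k)| ≤ S / 4 * |x₁ k - x₂ k| + S / 4 * |x₁ k - x₂ k| := by
      have e : S * (x₁ k - x₂ k) = (D k (x₁ k) - D k (x₂ k)) -
        (D k (x₁ k) - D k (x₂ k) - S * (x₁ k - x₂ k)) := by ring
      rw [e]
      exact (abs_sub _ _).trans (add_le_add hdiff d12)
    rw [abs_mul, abs_of_pos hS] at h3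
    have h4 : |x₁ k - x₂ k| ≤ 0 := by
      by_contra hcon
      linarith [mul_pos hS (not_le.1 hcon)]
    exact sub_eq_zero.1 (abs_nonpos_iff.1 h4)
  have final : y₁ ≤ 0 ∧ 0 ≤ y₂ := by
    by_contra hcon
    rw [not_and_or, not_le, not_le] at hcon
    rcases hcon with hpos | hneg
    · have hpos2 : 0 < y₂ := hpos.trans_le hyy
      have n1 := near (x₁ k) l1 d1 hpos.ne'
      have n2 := near (x₂ k) l2 d2 hpos2.ne'
      rw [← hy₁, abs_of_pos hpos] at n1
      rw [← hy₂, abs_of_pos hpos2] at n2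
      have p1 : 0 < D k (x₁ k) - β := by
        have := (abs_lt.1 n1).1
        linarith [mul_pos hS hpos]
      have p2 : 0 < D k (x₂ k) - β := by
        have := (abs_lt.1 n2).1
        linarith [mul_pos hS hpos2]
      have := same (by
        rw [abs_sub_comm β, abs_sub_comm β, abs_of_pos p1, abs_of_pos p2]
        congr 1; ring)
      linarith
    · have hneg1 : y₁ < 0 := hyy.trans_lt hneg
      have n1 := near (x₁ k) l1 d1 hneg1.ne
      have n2 := near (x₂ k) l2 d2 hneg.ne
      rw [← hy₁, abs_of_neg hneg1] at n1
      rw [← hy₂, abs_of_neg hneg] at n2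
      have p1 : D k (x₁ k) - β < 0 := by
        have := (abs_lt.1 n1).2
        linarith [mul_neg_of_pos_of_neg hS hneg1]
      have p2 : D k (x₂ k) - β < 0 := by
        have := (abs_lt.1 n2).2
        linarith [mul_neg_of_pos_of_neg hS hneg]
      have := same (by
        rw [abs_of_pos (by linarith : 0 < β - D k (x₁ k)),
          abs_of_pos (by linarith : 0 < β - D k (x₂ k)), abs_sub_comm (D k (x₁ k))]
        congr 1; ring)
      linarith
  rw [abs_of_nonpos final.1, abs_of_nonneg final.2]
  refine ⟨?_, rfl⟩
  rw [← abs_neg]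
  congr 1
  ring

end Branches

/-! ### The Dirac cones -/

section DiracCones

variable {a : ℝ}

theorem card_le_finrank {α : ℝ} {k : Plane} {lam : ℕ+ → ℝ} (h : IsEigenvalueSeq a α k lam) {μ : ℝ}
    (s : Finset ℕ+) (hs : ∀ j ∈ s, lam j = μ) :
    s.card ≤ Module.finrank ℂ (eigenspace a α k μ) := by
  have h1 : (s : Set ℕ+) ⊆ {j | lam j = μ} := fun j hj => hs j hj
  have h2 := Set.encard_le_encard h1
  rw [(h.2 μ).2, Set.encard_coe_eq_coe_finsetCard] at h2
  exact_mod_cast h2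

theorem isLittleO_of_norm_le_sq {F : Plane → ℝ} {k₀ : Plane} {C : ℝ}
    (h : ∀ᶠ k in 𝓝 k₀, |F k| ≤ C * ‖k - k₀‖ ^ 2) : F =o[𝓝 k₀] fun k => ‖k - k₀‖ := by
  have h1 : F =O[𝓝 k₀] fun k => ‖k - k₀‖ ^ 2 := by
    refine IsBigO.of_bound C ?_
    filter_upwards [h] with k hk
    rwa [Real.norm_eq_abs, Real.norm_of_nonneg (sq_nonneg ‖k - k₀‖)]
  refine h1.trans_isLittleO ?_
  have hc : Tendsto (fun k : Plane => ‖k - k₀‖) (𝓝 k₀) (𝓝 0) := by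
    have : Continuous fun k : Plane => ‖k - k₀‖ := by fun_prop
    simpa using this.tendsto k₀
  exact (isLittleO_pow_id one_lt_two).comp_tendsto hc

theorem invSq_ofReal (a μ : ℝ) (m : ℤ × ℤ) :
    invSq a μ m = ((1 / (‖ξ a m + diracPoint a‖ ^ 2 - μ) ^ 2 : ℝ) : ℂ) := by
  rw [invSq, den, free]
  push_cast
  rw [one_div]

theorem slope_eq (ha : 0 < a) (μ : ℝ) : slope a μ =
    4 * Real.pi / a * ‖∑' m : ℤ × ℤ, (m.1 : ℂ) * hexPhase m * invSq a μ m‖ /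
      ∑' m : ℤ × ℤ, 1 / (‖ξ a m + diracPoint a‖ ^ 2 - μ) ^ 2 := by
  have e : ∀ m : ℤ × ℤ, (m.1 : ℂ) * phase a 0 m (x₀ a) /
      (((‖ξ a m + diracPoint a‖ ^ 2 - μ) ^ 2 : ℝ) : ℂ) = (m.1 : ℂ) * hexPhase m * invSq a μ m :=
    fun m => by
      rw [phase_zero_x₀ ha, invSq_ofReal, div_eq_mul_inv, one_div, Complex.ofReal_inv]
  rw [slope, tsum_congr e, mul_div_assoc (4 * Real.pi / a)]

/-- `conical_branches` applies with `D = diagSum` and `G` the sum with phases. Rotation symmetry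
removes the energy derivative of `G` and the linear part of `D`, and continuity keeps both levels
off the free spectrum near `K`. -/
theorem dirac_cone (ha : 0 < a) {α : ℝ} {lam : Plane → ℕ+ → ℝ}
    (hlam : ∀ k, IsEigenvalueSeq a α k (lam k))
    (hcont : ∀ j, Tendsto (fun k => lam k j) (𝓝 (diracPoint a)) (𝓝 (lam (diracPoint a) j)))
    {i j : ℕ+} (hij : i < j) {ν : ℝ} (hi : lam (diracPoint a) i = ν)
    (hj : lam (diracPoint a) j = ν) (h : ∀ m, den a (diracPoint a) (ν : ℂ) m ≠ 0)
    (hν : diagSum a (diracPoint a) ν = coupling ha α) :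
    (fun k => lam k i - ν - -slope a ν * ‖k - diracPoint a‖)
        =o[𝓝 (diracPoint a)] (fun k => ‖k - diracPoint a‖) ∧
      (fun k => lam k j - ν - slope a ν * ‖k - diracPoint a‖)
        =o[𝓝 (diracPoint a)] (fun k => ‖k - diracPoint a‖) := by
  have hone : ∀ m, ‖(1 : ℤ × ℤ → ℂ) m‖ = 1 := fun m => by simp
  have hsum : ∀ {c : ℤ × ℤ → ℂ}, (∀ m, ‖c m‖ = 1) → Summable fun m => c m * invSq a ν m :=
    fun hc => summable_mul_invSq ha h (C := 1) fun m => by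
      rw [hc, one_mul]; exact one_le_sqrt_weight a m
  set S := ∑' m : ℤ × ℤ, 1 / (‖ξ a m + diracPoint a‖ ^ 2 - ν) ^ 2 with hSdef
  have hS1 : ∑' m, (1 : ℤ × ℤ → ℂ) m * invSq a ν m = (S : ℂ) := by
    rw [hSdef, Complex.ofReal_tsum]
    exact tsum_congr fun m => by rw [invSq_ofReal, Pi.one_apply, one_mul]
  have hS : 0 < S := by
    have hs : Summable fun m : ℤ × ℤ => 1 / (‖ξ a m + diracPoint a‖ ^ 2 - ν) ^ 2 := by
      rw [← Complex.summable_ofReal]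
      exact (hsum hone).congr fun m => by rw [invSq_ofReal, Pi.one_apply, one_mul]
    refine hs.tsum_pos (fun m => by positivity) 0 ?_
    have h0 : ‖ξ a 0 + diracPoint a‖ ^ 2 - ν ≠ 0 := fun h0 => h 0 (by
      rw [den, free, ← Complex.ofReal_sub, h0, Complex.ofReal_zero])
    positivity
  have hG0 : ∑' m, hexPhase m * invSq a ν m = 0 :=
    tsum_hexPhase_mul ha fun x => (((x : ℂ) - ν) ^ 2)⁻¹
  set ℓ := 4 * Real.pi / a * ‖∑' m : ℤ × ℤ, (m.1 : ℂ) * hexPhase m * invSq a ν m‖ with hℓ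
  obtain ⟨c₀, hc₀, hden⟩ := eventually_mul_weight_le_norm_den ha h
  have hnonspec : ∀ {x : Plane → ℝ}, Tendsto x (𝓝 (diracPoint a)) (𝓝 ν) →
      ∀ᶠ k in 𝓝 (diracPoint a), ∀ m, den a k (x k : ℂ) m ≠ 0 := fun {x} hx => by
    have h1 : Tendsto (fun k => (k, (x k : ℂ))) (𝓝 (diracPoint a)) (𝓝 (diracPoint a, (ν : ℂ))) :=
      tendsto_id.prodMk_nhds ((Complex.continuous_ofReal.tendsto ν).comp hx)
    filter_upwards [h1.eventually hden] with k hk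
    exact den_ne_zero_of_le hc₀ hk
  have hti : Tendsto (fun k => lam k i) (𝓝 (diracPoint a)) (𝓝 ν) := hi ▸ hcont i
  have htj : Tendsto (fun k => lam k j) (𝓝 (diracPoint a)) (𝓝 ν) := hj ▸ hcont j
  have hsec : ∀ n : ℕ+, Tendsto (fun k => lam k n) (𝓝 (diracPoint a)) (𝓝 ν) →
      ∀ᶠ k in 𝓝 (diracPoint a), |coupling ha α - diagSum a k (lam k n)| =
        ‖latticeSum a hexPhase k (lam k n : ℂ)‖ := fun n hn => by
    filter_upwards [hnonspec hn] with k hk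
    exact secular_of_finrank_pos ha hk
      (card_le_finrank (hlam k) {n} fun m hm => by rw [Finset.mem_singleton.1 hm])
  have hslope : slope a ν = ℓ / S := slope_eq ha ν
  rw [hslope]
  refine conical_branches (D := diagSum a) (G := fun k μ => latticeSum a hexPhase k (μ : ℂ))
    (β := coupling ha α) hS (by positivity) (fun k => norm_nonneg _) ?_ ?_ ?_ ?_ hti htj
    (fun k => (hlam k).1 hij.le) (hsec i hti) (hsec j htj) ?_
  · intro y y' hy hy'
    have h1 := latticeSum_sub_isLittleO ha hone h hy hy'
    rw [hS1] at h1
    refine h1.norm_left.congr_left (fun k => ?_) |>.of_norm_left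
    rw [latticeSum_one_ofReal, latticeSum_one_ofReal, ← Complex.ofReal_sub, ← Complex.ofReal_mul,
      ← Complex.ofReal_sub, Complex.norm_real]
  · intro y y' hy hy'
    have h1 := latticeSum_sub_isLittleO ha norm_hexPhase h hy hy'
    simpa only [hG0, zero_mul, sub_zero] using h1
  · obtain ⟨C, hC⟩ := latticeSum_expansion ha h hone
    refine isLittleO_of_norm_le_sq (C := C) ?_
    filter_upwards [hC] with k hk
    rwa [linearPart_one ha h, mul_zero, add_zero, latticeSum_one_ofReal, latticeSum_one_ofReal, hν,
      ← Complex.ofReal_sub, Complex.norm_real, Real.norm_eq_abs] at hk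
  · obtain ⟨C, hC⟩ := latticeSum_expansion ha h norm_hexPhase
    refine isLittleO_of_norm_le_sq (C := C) ?_
    filter_upwards [hC] with k hk
    rw [latticeSum_hexPhase_dirac ha, sub_zero] at hk
    have e : ℓ * ‖k - diracPoint a‖ = ‖-(2 * linearPart a hexPhase ν (k - diracPoint a))‖ := by
      rw [norm_neg, norm_mul, norm_linearPart_hexPhase ha h, hℓ, Complex.norm_ofNat]
      ring
    rw [e]
    refine (abs_norm_sub_norm_le _ _).trans ?_
    rwa [sub_neg_eq_add]
  -- Coinciding levels have multiplicity at least two, which makes the secular matrix vanish.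
  · filter_upwards [hnonspec hti] with k hk heq
    refine (secular_of_two_le_finrank ha hk ?_).2
    have h2 := card_le_finrank (hlam k) (μ := lam k i) {i, j} fun m hm => by
      rcases Finset.mem_insert.1 hm with rfl | hm
      · rfl
      · rw [Finset.mem_singleton.1 hm]; exact heq.symm
    rwa [Finset.card_pair hij.ne] at h2

end DiracCones

end

end Honeycomb

/-! ### The main theorem -/

theorem theorem3 (a : ℝ) (ha : 0 < a) (α : ℝ) :
    ∃ lam : Honeycomb.Plane → ℕ+ → ℝ,
      (∀ k, Honeycomb.IsEigenvalueSeq a α k (lam k)) ∧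
      lam (Honeycomb.diracPoint a) 1 = lam (Honeycomb.diracPoint a) 2 ∧
      lam (Honeycomb.diracPoint a) 4 = lam (Honeycomb.diracPoint a) 5 ∧
      (∀ m : ℤ × ℤ,
        ‖Honeycomb.ξ a m + Honeycomb.diracPoint a‖ ^ 2 ≠ lam (Honeycomb.diracPoint a) 1 ∧
        ‖Honeycomb.ξ a m + Honeycomb.diracPoint a‖ ^ 2 ≠ lam (Honeycomb.diracPoint a) 4) ∧
      (fun k => lam k 1 - lam (Honeycomb.diracPoint a) 1
          - -Honeycomb.slope a (lam (Honeycomb.diracPoint a) 1) * ‖k - Honeycomb.diracPoint a‖)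
        =o[𝓝 (Honeycomb.diracPoint a)] (fun k => ‖k - Honeycomb.diracPoint a‖) ∧
      (fun k => lam k 2 - lam (Honeycomb.diracPoint a) 2
          - Honeycomb.slope a (lam (Honeycomb.diracPoint a) 1) * ‖k - Honeycomb.diracPoint a‖)
        =o[𝓝 (Honeycomb.diracPoint a)] (fun k => ‖k - Honeycomb.diracPoint a‖) ∧
      (fun k => lam k 4 - lam (Honeycomb.diracPoint a) 4
          - -Honeycomb.slope a (lam (Honeycomb.diracPoint a) 4) * ‖k - Honeycomb.diracPoint a‖)
        =o[𝓝 (Honeycomb.diracPoint a)] (fun k => ‖k - Honeycomb.diracPoint a‖) ∧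
      (fun k => lam k 5 - lam (Honeycomb.diracPoint a) 5
          - Honeycomb.slope a (lam (Honeycomb.diracPoint a) 4) * ‖k - Honeycomb.diracPoint a‖)
        =o[𝓝 (Honeycomb.diracPoint a)] (fun k => ‖k - Honeycomb.diracPoint a‖) := by
  obtain ⟨lam, hlam, hcont⟩ := Honeycomb.exists_eigenvalueSeq ha α
  obtain ⟨h12, h45, d1, s1, d4, s4⟩ := Honeycomb.dirac_levels ha (hlam (Honeycomb.diracPoint a))
  obtain ⟨c1, c2⟩ := Honeycomb.dirac_cone ha hlam hcont (show (1 : ℕ+) < 2 by decide) rfl h12.symm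
    d1 s1
  obtain ⟨c4, c5⟩ := Honeycomb.dirac_cone ha hlam hcont (show (4 : ℕ+) < 5 by decide) rfl h45.symm
    d4 s4
  have hne : ∀ {μ : ℝ} {m : ℤ × ℤ}, Honeycomb.den a (Honeycomb.diracPoint a) (μ : ℂ) m ≠ 0 →
      ‖Honeycomb.ξ a m + Honeycomb.diracPoint a‖ ^ 2 ≠ μ := fun h he => h (by
    rw [Honeycomb.den, Honeycomb.free, he, sub_self])
  refine ⟨lam, hlam, h12, h45, fun m => ⟨hne (d1 m), hne (d4 m)⟩, c1, ?_, c4, ?_⟩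
  · rw [← h12]; exact c2
  · rw [← h45]; exact c5
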